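/- Let $\mathbb R^3_1$ be $\mathbb R^3$ with the pseudo-scalar product $\langle u,v\rangle=u_0v_0+u_1v_1-u_2v_2$ and let $u\times v$ be defined by $\langle u\times v,w\rangle=\det(u,v,w)$. For a smooth immersion $x(u,v)$ into $\mathbb R^3_1$ put $E=\langle x_u,x_u\rangle$, $F=\langle x_u,x_v\rangle$, $G=\langle x_v,x_v\rangle$, $\bar l=\langle x_u\times x_v,x_{uu}\rangle$, $\bar m=\langle x_u\times x_v,x_{uv}\rangle$, $\bar n=\langle x_u\times x_v,x_{vv}\rangle$. The lightlike principal locus (LPL), the parabolic curve (PC) and the mean curvature null curve (MCNC) are the zero sets of $$\tilde\delta=(E\bar n-G\bar l)^2-4(F\bar n-G\bar m)(E\bar m-F\bar l),\qquad \bar K=\bar l\bar n-\bar m^2,\qquad \bar H=\bar lG-2\bar mF+\bar nE .$$ A flat timelike umbilic point is a point where $F^2-EG>0$, the shape operator is a multiple of the identity, and the Gaussian curvature vanishes. Let $\mathcal G$ be the space of germs $(M,p)$ of smooth surfaces in $\mathbb R^3_1$, that is, of germs of smooth immersions $(\mathbb R^2,0)\to\mathbb R^3_1$ modulo germs of diffeomorphisms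 of $(\mathbb R^2,0)$, with the quotient of the topology given by the jets at $0$. Let $\mathcal G_2\subset\mathcal G$ be the subspace of those $(M,p)$ for which $p$ is a flat timelike umbilic point. A germ of a function on $(\mathbb R^2,0)$ has an $A_1^{\pm}$ singularity if some germ of a diffeomorphism of $(\mathbb R^2,0)$ takes it to $x^2\pm y^2$ or to $-(x^2\pm y^2)$. For a real number $c$ and a parameter $T$ consider the curves in the $(X,Z)$-plane $$\mathrm{LPL}:\ XZ=0,\qquad \mathrm{MCNC}:\ X+Z+T=0,\qquad \mathrm{PC}:\ XZ=c\,(X+Z+T)^2 .$$ **Theorem.** (0) The set $\mathcal P$ of those $(M,p)\in\mathcal G_2$ for which, at $p$, $\tilde\delta$ (the LPL) has an $A_1^-$ singularity, $\bar K$ (the PC) has an $A_1^+$ or an $A_1^-$ singularity, the MCNC is regular ($d\bar H\ne0$), and the real branches of the LPL, of the PC and of the MCNC are pairwise transverse (each branch of one of the curves to each branch of another), is open and dense in $\mathcal G_2$. (1) There are exactly three configurations: for every $(M,p)\in\mathcal P$ there is exactly one $c\in\{1,\tfrac18,-1\}$ such that some germ of a homeomorphism $(\mathbb R^2,0)\to(\mathbb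 R^2,0)$ that is a smooth diffeomorphism off the origin takes the LPL, the PC and the MCNC of $M$ to the model curves with $T=0$. (For $c=1$ the PC is an isolated point; for $c=\tfrac18$ it is a pair of lines separated from the MCNC by the LPL; for $c=-1$ it is a pair of lines with the MCNC between them, in the same pair of sectors bounded by the LPL.) Each of the three values of $c$ occurs, on a non-empty open subset of $\mathcal G_2$. (2) Let $(M,p)\in\mathcal P$ have the configuration $c$, and let $x$ be a parametrisation of $M$ at $p$. For generic smooth 1-parameter families $x_t$ with $x_0=x$ there is a germ at the origin of a homeomorphism $(q,t)\mapsto(\varphi_t(q),t)$ of $\mathbb R^2\times\mathbb R$, fixing the origin and a smooth diffeomorphism off the origin, that takes the LPL, the PC and the MCNC of $x_t$ to the model curves with $T=t$ and this $c$. Thus for $t\ne0$ the PC is an ellipse ($c=1$) or a hyperbola ($c=\tfrac18$, $c=-1$), tangent to the two branches of the LPL at the points where these cross the MCNC; these two points lie on the same branch of the hyperbola if $c=\tfrac18$ and on different branches if $c=-1$. Here "generic" means: for all families in an open and dense subset, for the topology given by the jets at the origin, of the families deforming $x$; moreover, for every vector $w$ transverse to $M$ at $p$, the families $x_t=x+h(\cdot,t)\,w$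 in that subset correspond to an open and dense set of functions $h$ with $h(\cdot,0)=0$. -/

import Mathlib

open Filter Topology
open scoped ContDiff

noncomputable section

/-! ### The geometry of a parametrised surface in Minkowski 3-space -/

namespace Minkowski

/-- The pseudo-scalar product `u₀ v₀ + u₁ v₁ - u₂ v₂` of `ℝ³₁`. -/
def inner (u v : Fin 3 → ℝ) : ℝ := u 0 * v 0 + u 1 * v 1 - u 2 * v 2

/-- The Lorentzian vector product, characterised by `⟨u × v, w⟩ = det (u, v, w)`. -/
def cross (u v : Fin 3 → ℝ) : Fin 3 → ℝ :=
  ![u 1 * v 2 - u 2 * v 1, u 2 * v 0 - u 0 * v 2, -(u 0 * v 1 - u 1 * v 0)]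

/-- Partial derivative with respect to the first variable. -/
def du (x : ℝ × ℝ → Fin 3 → ℝ) (q : ℝ × ℝ) : Fin 3 → ℝ := fderiv ℝ x q (1, 0)

/-- Partial derivative with respect to the second variable. -/
def dv (x : ℝ × ℝ → Fin 3 → ℝ) (q : ℝ × ℝ) : Fin 3 → ℝ := fderiv ℝ x q (0, 1)

variable (x : ℝ × ℝ → Fin 3 → ℝ) (q : ℝ × ℝ)

/-- Coefficients of the first fundamental form. -/
def E : ℝ := inner (du x q) (du x q)

def F : ℝ := inner (du x q) (dv x q)

def G : ℝ := inner (dv x q) (dv x q)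

/-- `δ = F² - EG`; the induced metric is Lorentzian exactly where `δ > 0`. -/
def delta : ℝ := F x q ^ 2 - E x q * G x q

/-- The normal vector `x_u × x_v` (not normalised). -/
def normal : Fin 3 → ℝ := cross (du x q) (dv x q)

/-- The unit normal vector (Gauss map), defined where `δ ≠ 0`. -/
def unitNormal : Fin 3 → ℝ :=
  (Real.sqrt |inner (normal x q) (normal x q)|)⁻¹ • normal x q

/-- The coefficients `l, m, n` of the second fundamental form. -/
def l : ℝ := inner (unitNormal x q) (du (du x) q)

def m : ℝ := inner (unitNormal x q) (dv (du x) q)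

def n : ℝ := inner (unitNormal x q) (dv (dv x) q)

/-- The Gaussian curvature. -/
def gaussCurvature : ℝ := (l x q * n x q - m x q ^ 2) / (E x q * G x q - F x q ^ 2)

/-- The shape operator `A = -dN` is a multiple of the identity of the tangent plane. -/
def IsUmbilic : Prop :=
  ∃ κ : ℝ, ∀ w : ℝ × ℝ, -(fderiv ℝ (unitNormal x) q w) = κ • fderiv ℝ x q w

/-- An umbilic point in the Lorentzian region at which the Gaussian curvature vanishes. -/
def IsFlatTimelikeUmbilic : Prop :=
  0 < delta x q ∧ IsUmbilic x q ∧ gaussCurvature x q = 0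

/-- The coefficients `l̄, m̄, n̄` obtained with the non-normalised normal vector. -/
def lBar : ℝ := inner (normal x q) (du (du x) q)

def mBar : ℝ := inner (normal x q) (dv (du x) q)

def nBar : ℝ := inner (normal x q) (dv (dv x) q)

/-- The lightlike principal locus (`LPL`) is the zero set of this function, the discriminant of
the equation of the lines of principal curvature. -/
def lplFun : ℝ :=
  (E x q * nBar x q - G x q * lBar x q) ^ 2
    - 4 * (F x q * nBar x q - G x q * mBar x q) * (E x q * mBar x q - F x q * lBar x q)

/-- The parabolic curve (`PC`) is the zero set of this function. -/
def pcFun : ℝ := lBar x q * nBar x q - mBar x q ^ 2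

/-- The mean curvature null curve (`MCNC`) is the zero set of this function. -/
def mcncFun : ℝ := lBar x q * G x q - 2 * mBar x q * F x q + nBar x q * E x q

end Minkowski

/-! ### Germs: diffeomorphisms, right equivalence, singularities, branches -/

/-- A function or map is smooth on a neighbourhood of the point `a`. -/
def SmoothNear {V W : Type*} [NormedAddCommGroup V] [NormedSpace ℝ V]
    [NormedAddCommGroup W] [NormedSpace ℝ W] (f : V → W) (a : V) : Prop :=
  ∀ᶠ q in 𝓝 a, ContDiffAt ℝ ∞ f q

/-- `h` represents a germ of a diffeomorphism `(ℝ², 0) → (ℝ², 0)`. -/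
structure IsDiffeoGerm (h : OpenPartialHomeomorph (ℝ × ℝ) (ℝ × ℝ)) : Prop where
  mem_source : (0 : ℝ × ℝ) ∈ h.source
  map_zero : h 0 = 0
  smooth : ContDiffOn ℝ ∞ h h.source
  smooth_symm : ContDiffOn ℝ ∞ h.symm h.target

/-- Right equivalence of germs at the origin of the plane. -/
def RightEquiv {W : Type*} (f g : ℝ × ℝ → W) : Prop :=
  ∃ h : OpenPartialHomeomorph (ℝ × ℝ) (ℝ × ℝ), IsDiffeoGerm h ∧ ∀ᶠ q in 𝓝 0, f q = g (h q)

theorem IsDiffeoGerm.tendsto {h : OpenPartialHomeomorph (ℝ × ℝ) (ℝ × ℝ)} (hh : IsDiffeoGerm h) :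
    Tendsto h (𝓝 0) (𝓝 0) := by
  have := h.continuousAt hh.mem_source
  rwa [ContinuousAt, hh.map_zero] at this

theorem IsDiffeoGerm.symm {h : OpenPartialHomeomorph (ℝ × ℝ) (ℝ × ℝ)} (hh : IsDiffeoGerm h) :
    IsDiffeoGerm h.symm where
  mem_source := by simpa [hh.map_zero] using h.map_source hh.mem_source
  map_zero := by simpa [hh.map_zero] using h.left_inv hh.mem_source
  smooth := hh.smooth_symm
  smooth_symm := hh.smooth

theorem IsDiffeoGerm.trans {h k : OpenPartialHomeomorph (ℝ × ℝ) (ℝ × ℝ)} (hh : IsDiffeoGerm h)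
    (hk : IsDiffeoGerm k) : IsDiffeoGerm (h.trans k) where
  mem_source := by simp [hh.mem_source, hh.map_zero, hk.mem_source]
  map_zero := by simp [hh.map_zero, hk.map_zero]
  smooth := by
    rw [OpenPartialHomeomorph.coe_trans, OpenPartialHomeomorph.trans_source]
    exact hk.smooth.comp (hh.smooth.mono fun _ h => h.1) fun _ h => h.2
  smooth_symm := by
    rw [OpenPartialHomeomorph.coe_trans_symm, OpenPartialHomeomorph.trans_target]
    exact hh.smooth_symm.comp (hk.smooth_symm.mono fun _ h => h.1) fun _ h => h.2

theorem rightEquiv_equivalence {W : Type*} :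
    Equivalence (RightEquiv : (ℝ × ℝ → W) → (ℝ × ℝ → W) → Prop) where
  refl f := ⟨OpenPartialHomeomorph.refl _,
    ⟨by simp, by simp, contDiff_id.contDiffOn, contDiff_id.contDiffOn⟩, by simp⟩
  symm := by
    rintro f g ⟨h, hh, e⟩
    refine ⟨h.symm, hh.symm, ?_⟩
    filter_upwards [hh.symm.tendsto.eventually e, h.symm.open_source.mem_nhds hh.symm.mem_source]
      with q hq hs
    rw [hq, h.right_inv hs]
  trans := by
    rintro f g k ⟨h, hh, e⟩ ⟨h', hh', e'⟩
    refine ⟨h.trans h', hh.trans hh', ?_⟩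
    filter_upwards [e, hh.tendsto.eventually e'] with q hq hq'
    simp [hq, hq']

/-- The germ at the origin has an `A₁⁺` singularity: normal form `±(x² + y²)`. -/
def HasA1Plus (f : ℝ × ℝ → ℝ) : Prop :=
  RightEquiv f (fun p => p.1 ^ 2 + p.2 ^ 2) ∨ RightEquiv f (fun p => -(p.1 ^ 2 + p.2 ^ 2))

/-- The germ at the origin has an `A₁⁻` singularity: normal form `±(x² - y²)`, where the two signs
are exchanged by interchanging the variables. -/
def HasA1Minus (f : ℝ × ℝ → ℝ) : Prop := RightEquiv f (fun p => p.1 ^ 2 - p.2 ^ 2)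

/-- The zero set of `f` is a regular curve through the origin. -/
def IsRegularCurve (f : ℝ × ℝ → ℝ) : Prop := f 0 = 0 ∧ fderiv ℝ f 0 ≠ 0

/-- `γ` parametrises a (real, smooth, regular) branch through the origin of the curve `f = 0`. -/
structure IsBranch (f : ℝ × ℝ → ℝ) (γ : ℝ → ℝ × ℝ) : Prop where
  smooth : SmoothNear γ 0
  map_zero : γ 0 = 0
  regular : deriv γ 0 ≠ 0
  mem : ∀ᶠ s in 𝓝 0, f (γ s) = 0

/-- Every real branch of `f = 0` at the origin is transverse to every real branch of `g = 0`. -/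
def BranchesTransverse (f g : ℝ × ℝ → ℝ) : Prop :=
  ∀ γ η : ℝ → ℝ × ℝ, IsBranch f γ → IsBranch g η →
    LinearIndependent ℝ ![deriv γ 0, deriv η 0]

/-! ### The space of germs of surfaces -/

/-- All the derivatives at the origin of a map. -/
def jets {V W : Type*} [NormedAddCommGroup V] [NormedSpace ℝ V]
    [NormedAddCommGroup W] [NormedSpace ℝ W] (f : V → W) :
    (k : ℕ) → ContinuousMultilinearMap ℝ (fun _ : Fin k => V) W :=
  fun k => iteratedFDeriv ℝ k f 0

/-- Representatives of germs at the origin of local parametrisations of surfaces in `ℝ³₁`.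
(An immersion is, near the origin, a homeomorphism onto its image.) -/
structure LocalParam where
  toFun : ℝ × ℝ → Fin 3 → ℝ
  smooth : SmoothNear toFun 0
  immersion : Function.Injective (fderiv ℝ toFun 0)

/-- The Whitney topology on germs: the coarsest topology for which all the jet maps
`x ↦ jᵏx(0)` are continuous. -/
instance : TopologicalSpace LocalParam :=
  TopologicalSpace.induced (fun x => jets x.toFun) inferInstance

/-- Two parametrisations are identified when they differ, as germs, by a change of parameters. -/
instance LocalParam.setoid : Setoid LocalParam where
  r x y := RightEquiv x.toFun y.toFun
  iseqv :=
    ⟨fun _ => rightEquiv_equivalence.refl _, rightEquiv_equivalence.symm,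
      rightEquiv_equivalence.trans⟩

/-- Germs `(M, p)` of surfaces in `ℝ³₁`, with the quotient topology. -/
abbrev SurfaceGerm : Type := Quotient LocalParam.setoid

/-- The germs `(M, p)` such that `p` is a flat timelike umbilic point of `M`. -/
def flatTimelikeUmbilics : Set SurfaceGerm :=
  {g | ∃ x : LocalParam, Quotient.mk _ x = g ∧ Minkowski.IsFlatTimelikeUmbilic x.toFun 0}

/-- The singularity types and the transversality at the base point: the `LPL` has an `A₁⁻`
singularity, the `PC` an `A₁⁺` or an `A₁⁻` singularity, the `MCNC` is regular, and the real
branches of these three curves are pairwise transverse. -/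
structure IsNondegenerate (x : ℝ × ℝ → Fin 3 → ℝ) : Prop where
  lpl : HasA1Minus (Minkowski.lplFun x)
  pc : HasA1Plus (Minkowski.pcFun x) ∨ HasA1Minus (Minkowski.pcFun x)
  mcnc : IsRegularCurve (Minkowski.mcncFun x)
  lpl_pc : BranchesTransverse (Minkowski.lplFun x) (Minkowski.pcFun x)
  lpl_mcnc : BranchesTransverse (Minkowski.lplFun x) (Minkowski.mcncFun x)
  pc_mcnc : BranchesTransverse (Minkowski.pcFun x) (Minkowski.mcncFun x)

/-- The germs in `flatTimelikeUmbilics` with these properties, in every parametrisation. -/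
def nondegenerateUmbilics : Set flatTimelikeUmbilics :=
  {g | ∀ x : LocalParam, Quotient.mk _ x = g.1 → IsNondegenerate x.toFun}

/-! ### The three configurations and their bifurcations -/

/-- The three configurations. For the model curves below (with `T = 0`):
* `isolated`: the `PC` is an isolated point;
* `separated`: the `PC` is a pair of lines and the `LPL` separates it from the `MCNC`;
* `between`: the `PC` is a pair of lines, and the `MCNC` lies between them in the pair of
  opposite sectors bounded by the `LPL` that contains them. -/
inductive Configuration
  | isolated
  | separated
  | between

/-- The coefficient of the model `PC`. -/
def Configuration.coeff : Configuration → ℝ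
  | isolated => 1
  | separated => 1 / 8
  | between => -1

/-- The model family of curves in the `(X, Z)`-plane with parameter `T`:
`LPL : XZ = 0`, `MCNC : X + Z + T = 0` and `PC : XZ = c (X + Z + T)²`. The model `PC` is the section
by the plane `T = const` of a quadratic cone: for `T ≠ 0` it is an ellipse (`c = 1`) or a hyperbola
(`c = 1/8`, `c = -1`), tangent to the two lines of the `LPL` at the points where they meet the
`MCNC`; these two points lie on the same branch (`c = 1/8`) or on different branches (`c = -1`) of
the hyperbola. -/
def modelLPL (p : (ℝ × ℝ) × ℝ) : ℝ := p.1.1 * p.1.2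

def modelMCNC (p : (ℝ × ℝ) × ℝ) : ℝ := p.1.1 + p.1.2 + p.2

def modelPC (k : Configuration) (p : (ℝ × ℝ) × ℝ) : ℝ :=
  p.1.1 * p.1.2 - k.coeff * (p.1.1 + p.1.2 + p.2) ^ 2

/-- A germ of a homeomorphism fixing the origin which is a smooth diffeomorphism away from the
origin. -/
structure IsConeDiffeoGerm {V : Type*} [NormedAddCommGroup V] [NormedSpace ℝ V]
    (φ : OpenPartialHomeomorph V V) : Prop where
  mem_source : (0 : V) ∈ φ.source
  map_zero : φ 0 = 0
  smooth : ContDiffOn ℝ ∞ φ (φ.source \ {0})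
  smooth_symm : ContDiffOn ℝ ∞ φ.symm (φ.target \ {0})

/-- At the origin the `LPL`, the `PC` and the `MCNC` of `x` form the configuration `k`. -/
def HasConfiguration (x : ℝ × ℝ → Fin 3 → ℝ) (k : Configuration) : Prop :=
  ∃ φ : OpenPartialHomeomorph (ℝ × ℝ) (ℝ × ℝ), IsConeDiffeoGerm φ ∧
    ∀ q ∈ φ.source,
      (Minkowski.lplFun x q = 0 ↔ modelLPL (φ q, 0) = 0) ∧
      (Minkowski.pcFun x q = 0 ↔ modelPC k (φ q, 0) = 0) ∧
      (Minkowski.mcncFun x q = 0 ↔ modelMCNC (φ q, 0) = 0)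

/-- The germs in `nondegenerateUmbilics` with the configuration `k`, in every parametrisation. -/
def umbilicsWithConfiguration (k : Configuration) : Set flatTimelikeUmbilics :=
  {g | g ∈ nondegenerateUmbilics ∧
    ∀ x : LocalParam, Quotient.mk _ x = g.1 → HasConfiguration x.toFun k}

/-- One-parameter families of parametrised surfaces, depending smoothly on the parameter `t` near
`t = 0`, that deform the surface parametrised by `x`. -/
structure Deformation (x : LocalParam) where
  toFun : (ℝ × ℝ) × ℝ → Fin 3 → ℝ
  smooth : SmoothNear toFun 0
  at_zero : ∀ᶠ q in 𝓝 (0 : ℝ × ℝ), toFun (q, 0) = x.toFun q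

instance (x : LocalParam) : TopologicalSpace (Deformation x) :=
  TopologicalSpace.induced (fun X => jets X.toFun) inferInstance

/-- Functions `h(q, t)`, smooth near the origin, with `h(q, 0) = 0`. -/
structure Perturbation where
  toFun : (ℝ × ℝ) × ℝ → ℝ
  smooth : SmoothNear toFun 0
  at_zero : ∀ᶠ q in 𝓝 (0 : ℝ × ℝ), toFun (q, 0) = 0

instance : TopologicalSpace Perturbation :=
  TopologicalSpace.induced (fun h => jets h.toFun) inferInstance

/-- The deformation `x(q) + h(q, t) w` of the surface in the direction of a fixed vector `w`.
When `x` is a Monge form and `w` its vertical direction this is the family of graphs of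
`f + h(·, t)`. -/
def graphDeformation (x : LocalParam) (w : Fin 3 → ℝ) (h : Perturbation) : Deformation x where
  toFun p := x.toFun p.1 + h.toFun p • w
  smooth := by
    have hx : ∀ᶠ p in 𝓝 (0 : (ℝ × ℝ) × ℝ), ContDiffAt ℝ ∞ x.toFun p.1 :=
      (continuous_fst.tendsto (0 : (ℝ × ℝ) × ℝ)).eventually x.smooth
    have hh : ∀ᶠ p in 𝓝 (0 : (ℝ × ℝ) × ℝ), ContDiffAt ℝ ∞ h.toFun p := h.smooth
    show ∀ᶠ p in 𝓝 (0 : (ℝ × ℝ) × ℝ), _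
    filter_upwards [hx, hh] with p hp hp'
    exact (hp.comp p contDiffAt_fst).add (hp'.smul contDiffAt_const)
  at_zero := by
    filter_upwards [h.at_zero] with q hq
    simp [hq]

/-- The property `P` holds for generic one-parameter families deforming the surface `x`: it holds
on an open and dense set of families; moreover, for every direction `w` transverse to the surface,
the families `x + h w` in that set are those of an open and dense set of functions `h`. -/
def ForGenericFamilies (x : LocalParam) (P : ((ℝ × ℝ) × ℝ → Fin 3 → ℝ) → Prop) : Prop :=
  ∃ O : Set (Deformation x), IsOpen O ∧ Dense O ∧
    (∀ w : Fin 3 → ℝ, w ∉ Set.range (fderiv ℝ x.toFun 0) →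
      IsOpen {h : Perturbation | graphDeformation x w h ∈ O} ∧
      Dense {h : Perturbation | graphDeformation x w h ∈ O}) ∧
    ∀ X ∈ O, P X.toFun

/-- In the family `X` the three curves deform as in the model family of the configuration `k`: some
germ at `(0, 0)` of a homeomorphism of `ℝ² × ℝ`, smooth in both directions off the origin and of the
form `(q, t) ↦ (φ_t(q), t)`, takes the `LPL`, the `PC` and the `MCNC` of every surface of the family
to the model curves with the same parameter. -/
def DeformsAs (k : Configuration) (X : (ℝ × ℝ) × ℝ → Fin 3 → ℝ) : Prop :=
  ∃ Φ : OpenPartialHomeomorph ((ℝ × ℝ) × ℝ) ((ℝ × ℝ) × ℝ), IsConeDiffeoGerm Φ ∧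
    ∀ p ∈ Φ.source, (Φ p).2 = p.2 ∧
      (Minkowski.lplFun (fun q => X (q, p.2)) p.1 = 0 ↔ modelLPL (Φ p) = 0) ∧
      (Minkowski.pcFun (fun q => X (q, p.2)) p.1 = 0 ↔ modelPC k (Φ p) = 0) ∧
      (Minkowski.mcncFun (fun q => X (q, p.2)) p.1 = 0 ↔ modelMCNC (Φ p) = 0)

end

open Filter Topology
open scoped ContDiff

noncomputable section

/-! ### Smooth germs -/

section SmoothGerms

variable {V W : Type*} [NormedAddCommGroup V] [NormedSpace ℝ V]
  [NormedAddCommGroup W] [NormedSpace ℝ W]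

/-! Lightlike frame. Where `δ > 0`, a root `R = F + σ√δ ≠ 0` of `R² - 2FR + EG = 0` gives two
independent lightlike vectors `A = (R, -E)` and `B = (-G, R)`. Let `L`, `N`, `-M` be the values of
the second fundamental form on `(A, A)`, `(B, B)`, `(A, B)`. Then `R² δ̃ = LN`, `4δR² K̄ = LN - M²`
and `R H̄ = M` (`sq_mul_frameLpl`, `four_mul_framePc`, `nullM`), so up to units the three curves are
`LN = 0`, `LN = M²` and `M = 0`. The same formulas hold for a family, with the parameter as a third
variable. A flat timelike umbilic is a timelike point where the second fundamental form vanishes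
(`isFlatTimelikeUmbilic_iff`). There `L`, `N`, `M` vanish, and their differentials `l`, `n`, `m` are
functions of the 3-jet.

Nondegeneracy. If `l`, `n` are independent and `m = αl + βn`, the tangent cones of the curves are
governed by `r = αβ`, the `crossRatio`. The singularity and transversality conditions together say
exactly that `l`, `n`, `m` are pairwise independent and `r ≠ 1/4` (`GeneralPosition`). The three
components of `ℝ \ {0, 1/4}` are the three configurations.

Bifurcation. In a family with independent `dL`, `dN`, `dM`, suitable multiples `X`, `Z`, `P` of `L`,
`N`, `M` are coordinates on `ℝ² × ℝ`. In them the curves of all members sweep out the fixed planes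
`XZ = 0`, `P = 0` and the cone `XZ = sP²`. Only the parameter `t` still depends on the family; its
linear part is `κ⁻¹P - X - Z` with `r = sκ²`. In the model the parameter is `μP - X - Z`. So a germ
of a homeomorphism preserving the planes and the cone has to carry one function to the other.

This is done by an explicit displacement instead of integrating vector fields. Rescaling `X`, `Z`,
`P` by `a²`, `b²`, `ab` preserves the arrangement, and so does a change of `P` by a multiple of `P ·
cone²`, if it is small. These moves change the height by any small amount as long as the height is
noncritical along the strata, that is, `μ ≠ 0` and `μ² ≠ 4s` (`slope_pos`). The displacement is
homogeneous of degree one. Hence, if the change of height has small differential at the origin,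
identity plus displacement is a homeomorphism, smooth off the origin
(`exists_isConeDiffeoGerm_of_homogeneous`). This absorbs the terms of higher order and small changes
of the slope; connectedness of an interval of admissible slopes then joins `κ⁻¹` to `μ`
(`straightens_height`). The slice `t = 0` of such a family gives the configuration of the surface.

Distinctness is topological: the `PC` is or is not a point, and it does or does not share sectors of
the complement of the `LPL` with the `MCNC`.

Genericity. All conditions are open conditions on 3-jets, and the quotient map to germs of surfaces
is open (`isOpenMap_mk`). Cubic perturbations along a transverse direction keep the 2-jet and change
`l`, `n`, `m` by explicit forms (`IsFlatFrame.add_cubic`). This gives density, the existence of each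
configuration (starting from a plane), and the generic independence of `dL`, `dN`, `dM` in families.
-/

theorem SmoothNear.contDiffAt {f : V → W} {a : V} (hf : SmoothNear f a) : ContDiffAt ℝ ∞ f a :=
  hf.self_of_nhds

theorem SmoothNear.differentiableAt {f : V → W} {a : V} (hf : SmoothNear f a) :
    DifferentiableAt ℝ f a :=
  hf.contDiffAt.differentiableAt (by simp)

theorem SmoothNear.fderiv_apply {f : V → W} {a : V} (hf : SmoothNear f a) (e : V) :
    SmoothNear (fun q => fderiv ℝ f q e) a := by
  filter_upwards [hf] with q hq
  exact (hq.fderiv_right (m := ∞) (by simp)).clm_apply contDiffAt_const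

theorem SmoothNear.comp {U : Type*} [NormedAddCommGroup U] [NormedSpace ℝ U] {g : W → U}
    {f : V → W} {a : V} (hg : SmoothNear g (f a)) (hf : SmoothNear f a) :
    SmoothNear (fun q => g (f q)) a := by
  filter_upwards [hf, hf.contDiffAt.continuousAt.eventually hg] with q hq hq'
  exact hq'.comp q hq

theorem ContDiff.smoothNear {f : V → W} {a : V} (hf : ContDiff ℝ ∞ f) : SmoothNear f a :=
  Eventually.of_forall fun _ => hf.contDiffAt

theorem SmoothNear.prodMk {U : Type*} [NormedAddCommGroup U] [NormedSpace ℝ U] {g : V → U}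
    {f : V → W} {a : V} (hf : SmoothNear f a) (hg : SmoothNear g a) :
    SmoothNear (fun q => (f q, g q)) a := by
  filter_upwards [hf, hg] with q hq hq'
  exact hq.prodMk hq'

theorem SmoothNear.add {f g : V → W} {a : V} (hf : SmoothNear f a) (hg : SmoothNear g a) :
    SmoothNear (fun q => f q + g q) a := by
  filter_upwards [hf, hg] with q hq hq'
  exact hq.add hq'

theorem SmoothNear.sub {f g : V → W} {a : V} (hf : SmoothNear f a) (hg : SmoothNear g a) :
    SmoothNear (fun q => f q - g q) a := by
  filter_upwards [hf, hg] with q hq hq'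
  exact hq.sub hq'

theorem SmoothNear.mul {f g : V → ℝ} {a : V} (hf : SmoothNear f a) (hg : SmoothNear g a) :
    SmoothNear (fun q => f q * g q) a := by
  filter_upwards [hf, hg] with q hq hq'
  exact hq.mul hq'

theorem SmoothNear.pow {f : V → ℝ} {a : V} (hf : SmoothNear f a) (n : ℕ) :
    SmoothNear (fun q => f q ^ n) a := by
  filter_upwards [hf] with q hq
  exact hq.pow n

theorem SmoothNear.div {f g : V → ℝ} {a : V} (hf : SmoothNear f a) (hg : SmoothNear g a)
    (h0 : g a ≠ 0) : SmoothNear (fun q => f q / g q) a := by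
  filter_upwards [hf, hg, hg.contDiffAt.continuousAt.eventually_ne h0] with q hq hq' h
  exact hq.div hq' h

theorem SmoothNear.sqrt {f : V → ℝ} {a : V} (hf : SmoothNear f a) (h0 : f a ≠ 0) :
    SmoothNear (fun q => √(f q)) a := by
  filter_upwards [hf, hf.contDiffAt.continuousAt.eventually_ne h0] with q hq h
  exact hq.sqrt h

theorem smoothNear_const {a : V} (c : W) : SmoothNear (fun _ : V => c) a :=
  contDiff_const.smoothNear

/-- Inverse function theorem for germs of smooth maps. -/
theorem SmoothNear.exists_openPartialHomeomorph [FiniteDimensional ℝ V] {f : V → V}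
    (hf : SmoothNear f 0) (hinj : Function.Injective (fderiv ℝ f 0)) :
    ∃ h : OpenPartialHomeomorph V V, (0 : V) ∈ h.source ∧ ⇑h = f ∧
      ContDiffOn ℝ ∞ h h.source ∧ ContDiffOn ℝ ∞ h.symm h.target := by
  have : CompleteSpace V := FiniteDimensional.complete ℝ V
  let e : V ≃L[ℝ] V :=
    (LinearEquiv.ofInjectiveEndo (fderiv ℝ f 0).toLinearMap hinj).toContinuousLinearEquiv
  have he : (e : V →L[ℝ] V) = fderiv ℝ f 0 := by ext v; rfl
  have hd : HasFDerivAt f (e : V →L[ℝ] V) 0 := by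
    rw [he]; exact hf.differentiableAt.hasFDerivAt
  have hc : ContinuousAt (fderiv ℝ f) 0 :=
    (hf.contDiffAt.fderiv_right (m := ∞) (by simp)).continuousAt
  -- Smoothness of the inverse on the whole target needs an invertible derivative at every point of
  -- the source, so the source is cut down to such points.
  have hev : ∀ᶠ q in 𝓝 (0 : V), ∃ e' : V ≃L[ℝ] V, (e' : V →L[ℝ] V) = fderiv ℝ f q := by
    have := e.nhds
    rw [he] at this
    exact hc.eventually this
  obtain ⟨s, hs, hso, h0s⟩ := eventually_nhds_iff.1 (hev.and hf)
  let h₀ := hf.contDiffAt.toOpenPartialHomeomorph f hd (by simp)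
  refine ⟨h₀.restrOpen s hso, ?_, rfl, ?_, ?_⟩
  · exact ⟨hf.contDiffAt.mem_toOpenPartialHomeomorph_source hd (by simp), h0s⟩
  · intro q hq
    exact (hs q hq.2).2.contDiffWithinAt
  · intro q hq
    have hq' : (h₀.restrOpen s hso).symm q ∈ s := ((h₀.restrOpen s hso).map_target hq).2
    obtain ⟨⟨e', he'⟩, hq''⟩ := hs _ hq'
    refine ((h₀.restrOpen s hso).contDiffAt_symm (f₀' := e') hq ?_ hq'').contDiffWithinAt
    rw [he']
    exact (hq''.differentiableAt (by simp)).hasFDerivAt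

end SmoothGerms

theorem SmoothNear.exists_isDiffeoGerm {f : ℝ × ℝ → ℝ × ℝ} (hf : SmoothNear f 0) (h0 : f 0 = 0)
    (hinj : Function.Injective (fderiv ℝ f 0)) :
    ∃ h : OpenPartialHomeomorph (ℝ × ℝ) (ℝ × ℝ), IsDiffeoGerm h ∧ ⇑h = f := by
  obtain ⟨h, h1, h2, h3, h4⟩ := hf.exists_openPartialHomeomorph hinj
  exact ⟨h, ⟨h1, by rw [h2, h0], h3, h4⟩, h2⟩

theorem IsDiffeoGerm.smoothNear {h : OpenPartialHomeomorph (ℝ × ℝ) (ℝ × ℝ)} (hh : IsDiffeoGerm h) :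
    SmoothNear h 0 := by
  filter_upwards [h.open_source.mem_nhds hh.mem_source] with q hq
  exact hh.smooth.contDiffAt (h.open_source.mem_nhds hq)

/-- The derivative of a diffeomorphism at a point of its domain is injective. -/
theorem OpenPartialHomeomorph.injective_fderiv {V : Type*} [NormedAddCommGroup V]
    [NormedSpace ℝ V] (h : OpenPartialHomeomorph V V)
    {q : V} (hq : q ∈ h.source) (hd : DifferentiableAt ℝ h q)
    (hd' : DifferentiableAt ℝ h.symm (h q)) : Function.Injective (fderiv ℝ h q) := by
  have h1 : fderiv ℝ (fun p => h.symm (h p)) q = ContinuousLinearMap.id ℝ V := by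
    rw [← fderiv_id (x := q)]
    apply Filter.EventuallyEq.fderiv_eq
    filter_upwards [h.open_source.mem_nhds hq] with p hp
    exact h.left_inv hp
  have h2 := fderiv_comp q hd' hd
  intro v w hvw
  have h3 : ∀ v, fderiv ℝ h.symm (h q) (fderiv ℝ h q v) = v := by
    intro v
    have := congrArg (fun A : V →L[ℝ] V => A v) (h2.symm.trans h1)
    simpa using this
  rw [← h3 v, ← h3 w, hvw]

theorem IsDiffeoGerm.injective_fderiv {h : OpenPartialHomeomorph (ℝ × ℝ) (ℝ × ℝ)}
    (hh : IsDiffeoGerm h) {q : ℝ × ℝ} (hq : q ∈ h.source) :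
    Function.Injective (fderiv ℝ h q) := by
  refine h.injective_fderiv hq ?_ ?_
  · exact (hh.smooth.contDiffAt (h.open_source.mem_nhds hq)).differentiableAt (by simp)
  · exact (hh.smooth_symm.contDiffAt (h.open_target.mem_nhds (h.map_source hq))).differentiableAt
      (by simp)

/-! ### Germs of homeomorphisms smooth off the origin -/

section ConeGerms

variable {V : Type*} [NormedAddCommGroup V] [NormedSpace ℝ V]

theorem IsConeDiffeoGerm.of_smooth {φ : OpenPartialHomeomorph V V} (h0 : (0 : V) ∈ φ.source)
    (hz : φ 0 = 0) (h : ContDiffOn ℝ ∞ φ φ.source) (h' : ContDiffOn ℝ ∞ φ.symm φ.target) :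
    IsConeDiffeoGerm φ :=
  ⟨h0, hz, h.mono fun _ h => h.1, h'.mono fun _ h => h.1⟩

theorem IsConeDiffeoGerm.symm {φ : OpenPartialHomeomorph V V} (hφ : IsConeDiffeoGerm φ) :
    IsConeDiffeoGerm φ.symm where
  mem_source := by simpa [hφ.map_zero] using φ.map_source hφ.mem_source
  map_zero := by simpa [hφ.map_zero] using φ.left_inv hφ.mem_source
  smooth := hφ.smooth_symm
  smooth_symm := hφ.smooth

theorem IsConeDiffeoGerm.map_ne_zero {φ : OpenPartialHomeomorph V V} (hφ : IsConeDiffeoGerm φ)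
    {p : V} (hp : p ∈ φ.source) (h : p ≠ 0) : φ p ≠ 0 := fun h' =>
  h (φ.injOn hp hφ.mem_source (h'.trans hφ.map_zero.symm))

theorem IsConeDiffeoGerm.trans {φ ψ : OpenPartialHomeomorph V V} (hφ : IsConeDiffeoGerm φ)
    (hψ : IsConeDiffeoGerm ψ) : IsConeDiffeoGerm (φ.trans ψ) where
  mem_source := by simp [hφ.mem_source, hφ.map_zero, hψ.mem_source]
  map_zero := by simp [hφ.map_zero, hψ.map_zero]
  smooth := by
    rw [OpenPartialHomeomorph.coe_trans, OpenPartialHomeomorph.trans_source]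
    exact hψ.smooth.comp (hφ.smooth.mono fun _ h => ⟨h.1.1, h.2⟩)
      fun p h => ⟨h.1.2, hφ.map_ne_zero h.1.1 h.2⟩
  smooth_symm := by
    rw [OpenPartialHomeomorph.coe_trans_symm, OpenPartialHomeomorph.trans_target]
    exact hφ.smooth_symm.comp (hψ.smooth_symm.mono fun _ h => ⟨h.1.1, h.2⟩)
      fun p h => ⟨h.1.2, hψ.symm.map_ne_zero h.1.1 h.2⟩

theorem IsConeDiffeoGerm.exists_restr {φ : OpenPartialHomeomorph V V} (hφ : IsConeDiffeoGerm φ)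
    {p : V → Prop} (hp : ∀ᶠ x in 𝓝 0, p x) :
    ∃ ψ : OpenPartialHomeomorph V V, IsConeDiffeoGerm ψ ∧ ⇑ψ = φ ∧ ∀ x ∈ ψ.source, p x := by
  obtain ⟨s, hs, hso, h0s⟩ := eventually_nhds_iff.1 hp
  refine ⟨φ.restrOpen s hso, ⟨⟨hφ.mem_source, h0s⟩, hφ.map_zero, ?_, ?_⟩, rfl, fun x hx => ?_⟩
  · exact hφ.smooth.mono fun x hx => ⟨hx.1.1, hx.2⟩
  · refine hφ.smooth_symm.mono fun x hx => ⟨?_, hx.2⟩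
    have h1 := hx.1
    rw [OpenPartialHomeomorph.restrOpen_toPartialEquiv] at h1
    exact h1.1
  · exact hs x hx.2

end ConeGerms

/-! ### Hadamard's lemma -/

/-- Differentiation under the integral sign; compactness of the closed unit ball times `[0, 1]`
supplies the dominating constant. -/
theorem hasFDerivAt_intervalIntegral_comp_smul {V W : Type} [NormedAddCommGroup V]
    [NormedSpace ℝ V] [FiniteDimensional ℝ V] [NormedAddCommGroup W] [NormedSpace ℝ W]
    [CompleteSpace W] {f : V → W} (hf : ContDiff ℝ 1 f) {c : ℝ → ℝ} (hc : Continuous c) (x : V) :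
    HasFDerivAt (fun x => ∫ s in (0 : ℝ)..1, c s • f (s • x))
      (∫ s in (0 : ℝ)..1, (c s * s) • fderiv ℝ f (s • x)) x := by
  have : ProperSpace V := FiniteDimensional.proper ℝ V
  have hf' : Continuous (fderiv ℝ f) := hf.continuous_fderiv (by simp)
  have hcont : Continuous fun p : V × ℝ => (c p.2 * p.2) • fderiv ℝ f (p.2 • p.1) := by fun_prop
  obtain ⟨C, hC⟩ := ((isCompact_closedBall x 1).prod (isCompact_Icc (a := (0 : ℝ)) (b := 1))
    ).exists_bound_of_continuousOn hcont.continuousOn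
  refine intervalIntegral.hasFDerivAt_integral_of_dominated_of_fderiv_le
    (F := fun x s => c s • f (s • x)) (F' := fun x s => (c s * s) • fderiv ℝ f (s • x))
    (bound := fun _ => C) (Metric.ball_mem_nhds x one_pos) ?_ ?_ ?_ ?_ ?_ ?_
  · have := hf.continuous
    refine Eventually.of_forall fun y => Continuous.aestronglyMeasurable ?_
    fun_prop
  · have := hf.continuous
    refine Continuous.intervalIntegrable ?_ _ _
    fun_prop
  · have : SecondCountableTopologyEither ℝ (V →L[ℝ] W) := secondCountableTopologyEither_of_left _ _
    refine Continuous.aestronglyMeasurable ?_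
    fun_prop
  · refine Eventually.of_forall fun s hs y hy => hC (y, s) ⟨Metric.ball_subset_closedBall hy, ?_⟩
    rw [Set.uIoc_of_le zero_le_one] at hs
    exact ⟨hs.1.le, hs.2⟩
  · exact intervalIntegrable_const
  · refine Eventually.of_forall fun s _ y _ => ?_
    have h1 : HasFDerivAt f (fderiv ℝ f (s • y)) (s • y) :=
      (hf.differentiable (by simp) _).hasFDerivAt
    have h2 : HasFDerivAt (fun y : V => s • y) (s • ContinuousLinearMap.id ℝ V) y :=
      (hasFDerivAt_id y).const_smul s
    have h3 := (h1.comp y h2).const_smul (c s)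
    refine h3.congr_fderiv ?_
    ext v
    simp [mul_smul]

/-- Each derivative brings out a factor `s` and replaces the target `W` by `V →L[ℝ] W`. The
induction therefore runs over all weights `c` and all targets; both spaces lie in `Type` so that the
universe does not change. -/
theorem contDiff_intervalIntegral_comp_smul (n : ℕ) {V W : Type} [NormedAddCommGroup V]
    [NormedSpace ℝ V] [FiniteDimensional ℝ V] [NormedAddCommGroup W] [NormedSpace ℝ W]
    [CompleteSpace W] {f : V → W} (hf : ContDiff ℝ n f) {c : ℝ → ℝ} (hc : Continuous c) :
    ContDiff ℝ n (fun x => ∫ s in (0 : ℝ)..1, c s • f (s • x)) := by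
  induction n generalizing W c with
  | zero =>
    have := hf.continuous
    refine contDiff_zero.2 (intervalIntegral.continuous_parametric_intervalIntegral_of_continuous'
      (by fun_prop) 0 1)
  | succ n ih =>
    have hf1 : ContDiff ℝ 1 f := hf.of_le (by simp)
    have hd := fun x => hasFDerivAt_intervalIntegral_comp_smul hf1 hc x
    push_cast at hf ⊢
    rw [contDiff_succ_iff_fderiv] at hf ⊢
    refine ⟨fun x => (hd x).differentiableAt, by simp, ?_⟩
    have : (fderiv ℝ fun x => ∫ s in (0 : ℝ)..1, c s • f (s • x)) =
        fun x => ∫ s in (0 : ℝ)..1, (c s * s) • fderiv ℝ f (s • x) := by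
      ext1 x; exact (hd x).fderiv
    rw [this]
    exact ih hf.2.2 (c := fun s => c s * s) (by fun_prop)

/-- The form `g x` is the mean of the derivative of `f` over the segment from `0` to `x`. -/
theorem ContDiff.hadamard {V : Type} [NormedAddCommGroup V]
    [NormedSpace ℝ V] [FiniteDimensional ℝ V] {f : V → ℝ} (hf : ContDiff ℝ ∞ f) (h0 : f 0 = 0) :
    ∃ g : V → V →L[ℝ] ℝ, ContDiff ℝ ∞ g ∧ (∀ x, f x = g x x) ∧ g 0 = fderiv ℝ f 0 := by
  have hf' : ContDiff ℝ ∞ (fderiv ℝ f) := hf.fderiv_right (by simp)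
  have hfc : Continuous (fderiv ℝ f) := hf'.continuous
  refine ⟨fun x => ∫ s in (0 : ℝ)..1, (1 : ℝ) • fderiv ℝ f (s • x), ?_, fun x => ?_, ?_⟩
  · rw [contDiff_infty]
    intro n
    exact contDiff_intervalIntegral_comp_smul n (hf'.of_le (by exact_mod_cast le_top))
      (c := fun _ => 1) continuous_const
  · have hder : ∀ s : ℝ, HasDerivAt (fun s : ℝ => f (s • x)) (fderiv ℝ f (s • x) x) s := by
      intro s
      have h1 : HasFDerivAt f (fderiv ℝ f (s • x)) (s • x) :=
        (hf.differentiable (by simp) _).hasFDerivAt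
      have h2 : HasDerivAt (fun s : ℝ => s • x) x s := by
        simpa using (hasDerivAt_id s).smul_const x
      exact h1.comp_hasDerivAt s h2
    have h3 := intervalIntegral.integral_eq_sub_of_hasDerivAt (a := 0) (b := 1)
      (fun s _ => hder s) (Continuous.intervalIntegrable (by fun_prop) _ _)
    simp only [one_smul]
    rw [ContinuousLinearMap.intervalIntegral_apply
      (Continuous.intervalIntegrable (by fun_prop) _ _), h3]
    simp [h0]
  · simp

/-- Hadamard's lemma for germs of functions on the plane. -/
theorem SmoothNear.hadamard {f : ℝ × ℝ → ℝ} (hf : SmoothNear f 0) (h0 : f 0 = 0) :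
    ∃ g₁ g₂ : ℝ × ℝ → ℝ, SmoothNear g₁ 0 ∧ SmoothNear g₂ 0 ∧
      (∀ᶠ x in 𝓝 0, f x = g₁ x * x.1 + g₂ x * x.2) ∧
      g₁ 0 = fderiv ℝ f 0 (1, 0) ∧ g₂ 0 = fderiv ℝ f 0 (0, 1) := by
  obtain ⟨r, hr, hball⟩ := Metric.eventually_nhds_iff.1 hf
  -- A cutoff makes the germ a globally smooth function, as the integral formula requires.
  let χ : ContDiffBump (0 : ℝ × ℝ) := ⟨r / 4, r / 2, by positivity, by linarith⟩
  have hF : ContDiff ℝ ∞ (fun x => χ x * f x) := by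
    rw [contDiff_iff_contDiffAt]
    intro x
    by_cases hx : dist x 0 < r
    · exact χ.contDiff.contDiffAt.mul (hball hx)
    · have : (fun x => χ x * f x) =ᶠ[𝓝 x] fun _ => 0 := by
        have hx' : r / 2 < dist x 0 := by linarith [not_lt.1 hx]
        filter_upwards [(isOpen_lt continuous_const (continuous_id.dist continuous_const)).mem_nhds
          hx'] with y hy
        have : χ y = 0 := χ.zero_of_le_dist (le_of_lt hy)
        simp [this]
      exact contDiffAt_const.congr_of_eventuallyEq this
  have hev : (fun x => χ x * f x) =ᶠ[𝓝 0] f := by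
    filter_upwards [χ.eventuallyEq_one] with x hx
    simp [hx]
  obtain ⟨g, hg, hfg, hg0⟩ := hF.hadamard (by simp [h0])
  refine ⟨fun x => g x (1, 0), fun x => g x (0, 1), (hg.clm_apply contDiff_const).smoothNear,
    (hg.clm_apply contDiff_const).smoothNear, ?_, ?_, ?_⟩
  · filter_upwards [hev] with x hx
    rw [← hx, hfg x]
    conv_lhs => rw [show x = x.1 • ((1, 0) : ℝ × ℝ) + x.2 • ((0, 1) : ℝ × ℝ) by ext <;> simp]
    rw [map_add, map_smul, map_smul]
    conv_rhs => rw [show x = x.1 • ((1, 0) : ℝ × ℝ) + x.2 • ((0, 1) : ℝ × ℝ) by ext <;> simp]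
    simp [mul_comm]
  · simp only [hg0, hev.fderiv_eq]
  · simp only [hg0, hev.fderiv_eq]

/-! ### Cone germs obtained from homogeneous perturbations of the identity -/

section HomogeneousPerturbation

variable {V : Type*} [NormedAddCommGroup V] [NormedSpace ℝ V] [FiniteDimensional ℝ V]

/-- A map close to the identity in the `C¹` sense off the origin is a homeomorphism, smooth off the
origin, on a neighbourhood of the origin. -/
theorem exists_isConeDiffeoGerm_of_norm_fderiv_le {ψ : V → V} {r : ℝ} (hr : 0 < r)
    (hsm : ∀ x ∈ Metric.ball (0 : V) r, x ≠ 0 → ContDiffAt ℝ ∞ ψ x)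
    (hd : ∀ x ∈ Metric.ball (0 : V) r, x ≠ 0 → ‖fderiv ℝ ψ x‖ ≤ 1 / 2)
    (hb : ∀ x ∈ Metric.ball (0 : V) r, ‖ψ x‖ ≤ 1 / 2 * ‖x‖) :
    ∃ Φ : OpenPartialHomeomorph V V, IsConeDiffeoGerm Φ ∧ Φ.source = Metric.ball 0 r ∧
      ∀ x, Φ x = x + ψ x := by
  have : CompleteSpace V := FiniteDimensional.complete ℝ V
  have hlip : ∀ x ∈ Metric.ball (0 : V) r, ∀ y ∈ Metric.ball (0 : V) r,
      ‖ψ x - ψ y‖ ≤ 1 / 2 * ‖x - y‖ := by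
    intro x hx y hy
    -- The mean value inequality fails only on segments through the origin, where `ψ` may not be
    -- differentiable. There `‖x - y‖ = ‖x‖ + ‖y‖`, and the bound on `‖ψ‖` suffices.
    by_cases h0 : (0 : V) ∈ segment ℝ y x
    · have h1 := dist_add_dist_of_mem_segment h0
      rw [dist_zero_right, dist_zero_left, dist_comm, dist_eq_norm] at h1
      calc ‖ψ x - ψ y‖ ≤ ‖ψ x‖ + ‖ψ y‖ := norm_sub_le _ _
        _ ≤ 1 / 2 * ‖x‖ + 1 / 2 * ‖y‖ := add_le_add (hb x hx) (hb y hy)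
        _ = 1 / 2 * ‖x - y‖ := by rw [← h1]; ring
    · have hsub : segment ℝ y x ⊆ Metric.ball (0 : V) r :=
        (convex_ball (0 : V) r).segment_subset hy hx
      have hne : ∀ z ∈ segment ℝ y x, z ≠ 0 := fun z hz h => h0 (h ▸ hz)
      exact (convex_segment y x).norm_image_sub_le_of_norm_hasFDerivWithin_le
        (fun z hz => ((hsm z (hsub hz) (hne z hz)).differentiableAt
          (by simp)).hasFDerivAt.hasFDerivWithinAt)
        (fun z hz => hd z (hsub hz) (hne z hz)) (left_mem_segment ℝ y x) (right_mem_segment ℝ y x)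
  have happ : ApproximatesLinearOn (fun x => x + ψ x)
      ((ContinuousLinearEquiv.refl ℝ V : V ≃L[ℝ] V) : V →L[ℝ] V) (Metric.ball 0 r) (1 / 2) := by
    intro x hx y hy
    have : x + ψ x - (y + ψ y) - (x - y) = ψ x - ψ y := by abel
    simpa [this] using hlip x hx y hy
  have hc : Subsingleton V ∨ (1 / 2 : NNReal) <
      ‖((ContinuousLinearEquiv.refl ℝ V).symm : V →L[ℝ] V)‖₊⁻¹ := by
    rcases subsingleton_or_nontrivial V with h | h
    · exact Or.inl h
    · right
      have : ‖((ContinuousLinearEquiv.refl ℝ V).symm : V →L[ℝ] V)‖₊ = 1 := by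
        ext; exact ContinuousLinearMap.norm_id
      rw [this, inv_one]
      exact NNReal.half_lt_self one_ne_zero
  let Φ := happ.toOpenPartialHomeomorph _ _ hc Metric.isOpen_ball
  have hΦ : ∀ x, Φ x = x + ψ x := fun _ => rfl
  have hsrc : Φ.source = Metric.ball 0 r := rfl
  have h0 : ψ 0 = 0 := by
    have := hb 0 (Metric.mem_ball_self hr)
    simpa using this
  have hΦs : ∀ x ∈ Metric.ball (0 : V) r, x ≠ 0 → ContDiffAt ℝ ∞ Φ x := fun x hx hx0 =>
    contDiffAt_id.add (hsm x hx hx0)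
  refine ⟨Φ, ⟨Metric.mem_ball_self hr, by simp [hΦ, h0], fun x hx =>
    (hΦs x hx.1 hx.2).contDiffWithinAt, fun y hy => ?_⟩, hsrc, hΦ⟩
  have hy1 : Φ.symm y ∈ Metric.ball (0 : V) r := Φ.map_target hy.1
  have hy2 : Φ.symm y ≠ 0 := by
    intro h
    have := Φ.right_inv hy.1
    rw [h, hΦ, h0, add_zero] at this
    exact hy.2 this.symm
  have hder : HasFDerivAt Φ (ContinuousLinearMap.id ℝ V + fderiv ℝ ψ (Φ.symm y)) (Φ.symm y) :=
    (hasFDerivAt_id _).add ((hsm _ hy1 hy2).differentiableAt (by simp)).hasFDerivAt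
  have hinj : Function.Injective
      (ContinuousLinearMap.id ℝ V + fderiv ℝ ψ (Φ.symm y)).toLinearMap := by
    rw [← LinearMap.ker_eq_bot, LinearMap.ker_eq_bot']
    intro v hv
    have hv' : v + fderiv ℝ ψ (Φ.symm y) v = 0 := hv
    have h1 : ‖v‖ ≤ 1 / 2 * ‖v‖ := by
      calc ‖v‖ = ‖fderiv ℝ ψ (Φ.symm y) v‖ :=
            (congrArg norm (eq_neg_of_add_eq_zero_left hv')).trans (norm_neg _)
        _ ≤ ‖fderiv ℝ ψ (Φ.symm y)‖ * ‖v‖ := ContinuousLinearMap.le_opNorm _ _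
        _ ≤ 1 / 2 * ‖v‖ := by gcongr; exact hd _ hy1 hy2
    have : ‖v‖ = 0 := by linarith [norm_nonneg v]
    exact norm_eq_zero.1 this
  let e : V ≃L[ℝ] V := (LinearEquiv.ofInjectiveEndo _ hinj).toContinuousLinearEquiv
  refine (Φ.contDiffAt_symm (f₀' := e) hy.1 ?_ (hΦs _ hy1 hy2)).contDiffWithinAt
  exact hder

/-- The derivative of a map of degree one has degree zero, so bounds on the unit sphere hold in a
whole conical neighbourhood `|κ| < ε₀‖x‖` of `κ = 0`. If `dk(0)` is small, the graph of `k` stays in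
it. The derivative of `x ↦ N (x, k x)` is then small: its part in `x` because `N (x, 0) = 0`, its
part in `κ` because `dk` is small. -/
theorem exists_isConeDiffeoGerm_of_homogeneous {N : V × ℝ → V}
    (hN : ∀ x : V, x ≠ 0 → SmoothNear N (x, 0))
    (hhom : ∀ c : ℝ, 0 < c → ∀ p, N (c • p) = c • N p) (h0 : ∀ x, N (x, 0) = 0)
    {Good : V × ℝ → Prop} (hG : ∀ x : V, x ≠ 0 → ∀ᶠ p in 𝓝 (x, (0 : ℝ)), Good p)
    (hGhom : ∀ c : ℝ, 0 < c → ∀ p, Good p → Good (c • p)) :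
    ∃ ε > 0, ∀ k : V → ℝ, SmoothNear k 0 → k 0 = 0 → ‖fderiv ℝ k 0‖ < ε →
      ∃ Φ : OpenPartialHomeomorph V V, IsConeDiffeoGerm Φ ∧
        ∀ x ∈ Φ.source, Φ x = x + N (x, k x) ∧ (x ≠ 0 → Good (x, k x)) := by
  have : ProperSpace V := FiniteDimensional.proper ℝ V
  have hcf : ∀ x : V, x ≠ 0 → ContinuousAt (fderiv ℝ N) (x, 0) := fun x hx =>
    ((hN x hx).contDiffAt.fderiv_right (m := ∞) (by simp)).continuousAt
  have hsph : ∀ x ∈ Metric.sphere (0 : V) 1, x ≠ 0 := by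
    rintro x hx rfl
    simp at hx
  have hcr : ∀ x : V, x ≠ 0 →
      ContinuousAt (fun p => (fderiv ℝ N p).comp (ContinuousLinearMap.inr ℝ V ℝ)) (x, (0 : ℝ)) :=
    fun x hx => ((ContinuousLinearMap.compL ℝ ℝ (V × ℝ) V).flip
      (ContinuousLinearMap.inr ℝ V ℝ)).continuous.continuousAt.comp (hcf x hx)
  have hcl : ∀ x : V, x ≠ 0 →
      ContinuousAt (fun p => (fderiv ℝ N p).comp (ContinuousLinearMap.inl ℝ V ℝ)) (x, (0 : ℝ)) :=
    fun x hx => ((ContinuousLinearMap.compL ℝ V (V × ℝ) V).flip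
      (ContinuousLinearMap.inl ℝ V ℝ)).continuous.continuousAt.comp (hcf x hx)
  obtain ⟨C, hC⟩ := (isCompact_sphere (0 : V) 1).exists_bound_of_continuousOn
    (f := fun x => (fderiv ℝ N (x, 0)).comp (ContinuousLinearMap.inr ℝ V ℝ))
    (fun x hx => (ContinuousAt.comp (f := fun x : V => (x, (0 : ℝ))) (hcr x (hsph x hx))
      (by fun_prop)).continuousWithinAt)
  have hinl : ∀ x : V, x ≠ 0 → (fderiv ℝ N (x, 0)).comp (ContinuousLinearMap.inl ℝ V ℝ) = 0 := by
    intro x hx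
    have h1 : HasFDerivAt (fun y : V => N (y, 0))
        ((fderiv ℝ N (x, 0)).comp (ContinuousLinearMap.inl ℝ V ℝ)) x :=
      HasFDerivAt.comp x (f := fun y : V => (y, (0 : ℝ))) (hN x hx).differentiableAt.hasFDerivAt
        (hasFDerivAt_prodMk_left x 0)
    have h2 : (fun y : V => N (y, 0)) = fun _ => 0 := funext h0
    rw [h2] at h1
    exact h1.unique (hasFDerivAt_const 0 x)
  let B : ℝ := |C| + 1
  have hB : 0 < B := by positivity
  -- Everything the contraction argument needs at a point. It is open at the points `(x, 0)` of the
  -- sphere and invariant under positive scaling.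
  let Fine : V × ℝ → Prop := fun p => Good p ∧ ContDiffAt ℝ ∞ N p ∧ ‖N p‖ ≤ 1 / 2 * ‖p.1‖ ∧
    ‖(fderiv ℝ N p).comp (ContinuousLinearMap.inl ℝ V ℝ)‖ ≤ 1 / 4 ∧
    ‖(fderiv ℝ N p).comp (ContinuousLinearMap.inr ℝ V ℝ)‖ ≤ B
  have hFine : ∀ x ∈ Metric.sphere (0 : V) 1, ∀ᶠ p in 𝓝 (x, (0 : ℝ)), Fine p := by
    intro x hx
    have hx0 := hsph x hx
    have hx1 : ‖x‖ = 1 := by simpa using hx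
    have e3 : ∀ᶠ p in 𝓝 (x, (0 : ℝ)), ‖N p‖ < 1 / 2 * ‖p.1‖ := by
      refine ContinuousAt.eventually_lt (hN x hx0).contDiffAt.continuousAt.norm
        (by fun_prop) ?_
      simp [h0, hx1]
    have e4 := (hcl x hx0).norm.tendsto.eventually_lt_const (u := 1 / 4)
      (by rw [hinl x hx0, norm_zero]; norm_num)
    have e5 := (hcr x hx0).norm.tendsto.eventually_lt_const (u := B)
      (lt_of_le_of_lt (hC x hx) (by change C < |C| + 1; linarith [le_abs_self C]))
    filter_upwards [hG x hx0, hN x hx0, e3, e4, e5] with p h1 h2 h3 h4 h5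
    exact ⟨h1, h2, h3.le, h4.le, h5.le⟩
  have hFhom : ∀ c : ℝ, 0 < c → ∀ p, Fine p → Fine (c • p) := by
    rintro c hc p ⟨h1, h2, h3, h4, h5⟩
    have hcne := hc.ne'
    have hNe : N = fun p => c • N (c⁻¹ • p) := by
      ext1 p
      rw [← hhom c hc, smul_smul, mul_inv_cancel₀ hcne, one_smul]
    have hfd : HasFDerivAt N (fderiv ℝ N p) (c • p) := by
      have hp : HasFDerivAt N (fderiv ℝ N p) (c⁻¹ • (c • p)) := by
        rw [smul_smul, inv_mul_cancel₀ hcne, one_smul]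
        exact (h2.differentiableAt (by simp)).hasFDerivAt
      have h6 : HasFDerivAt (fun p : V × ℝ => c⁻¹ • p)
          (c⁻¹ • ContinuousLinearMap.id ℝ (V × ℝ)) (c • p) :=
        (c⁻¹ • ContinuousLinearMap.id ℝ (V × ℝ)).hasFDerivAt
      have h7 := (hp.comp (c • p) h6).const_smul c
      rw [hNe]
      refine h7.congr_fderiv ?_
      rw [← hNe]
      refine ContinuousLinearMap.ext fun v => ?_
      simp [smul_smul, mul_inv_cancel₀ hcne]
    refine ⟨hGhom c hc p h1, ?_, ?_, ?_, ?_⟩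
    · rw [hNe]
      refine ContDiffAt.const_smul c (ContDiffAt.comp (c • p) (f := fun p => c⁻¹ • p) ?_
        (by fun_prop))
      rwa [smul_smul, inv_mul_cancel₀ hcne, one_smul]
    · rw [hhom c hc, norm_smul, Prod.smul_fst, norm_smul]
      calc ‖c‖ * ‖N p‖ ≤ ‖c‖ * (1 / 2 * ‖p.1‖) := by gcongr
        _ = _ := by ring
    · rwa [hfd.fderiv]
    · rwa [hfd.fderiv]
  obtain ⟨ε₀, hε₀, hev⟩ := Metric.eventually_nhds_iff.1
    ((isCompact_sphere (0 : V) 1).eventually_forall_of_forall_eventually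
      (x₀ := (0 : ℝ)) (P := fun κ x => Fine (x, κ)) (fun x hx => by
        have h1 := hFine x hx
        have h2 : Tendsto (fun z : ℝ × V => (z.2, z.1)) (𝓝 (0, x)) (𝓝 (x, 0)) :=
          (continuous_swap.tendsto (0, x))
        exact h2.eventually h1))
  have hfine : ∀ x : V, x ≠ 0 → ∀ κ : ℝ, |κ| < ε₀ * ‖x‖ → Fine (x, κ) := by
    intro x hx κ hκ
    have hn : 0 < ‖x‖ := norm_pos_iff.2 hx
    have h1 : dist (κ / ‖x‖) 0 < ε₀ := by
      rw [dist_zero_right, Real.norm_eq_abs, abs_div, abs_norm, div_lt_iff₀ hn]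
      exact hκ
    have h2 := hev h1 (‖x‖⁻¹ • x) (by simp [norm_smul, hn.ne'])
    have h3 := hFhom ‖x‖ hn _ h2
    have h4 : ‖x‖ • ((‖x‖⁻¹ • x, κ / ‖x‖) : V × ℝ) = (x, κ) := by
      ext1
      · simp [smul_smul, hn.ne']
      · simp only [Prod.smul_mk, smul_eq_mul]; field_simp
    rwa [h4] at h3
  -- The first bound keeps `(x, k x)` in the conical neighbourhood; the second gives `1/4 + Bε ≤
  -- 1/2` for the derivative.
  let ε := min (ε₀ / 2) (1 / (4 * B))
  have hε : 0 < ε := lt_min (by positivity) (by positivity)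
  refine ⟨ε, hε, fun k hk hk0 hkd => ?_⟩
  have hkc : ContinuousAt (fderiv ℝ k) 0 :=
    (hk.contDiffAt.fderiv_right (m := ∞) (by simp)).continuousAt
  obtain ⟨r, hr, hrk⟩ := Metric.eventually_nhds_iff.1
    (hk.and (hkc.norm.eventually (gt_mem_nhds hkd)))
  have hkb : ∀ x ∈ Metric.ball (0 : V) r, |k x| ≤ ε * ‖x‖ := by
    intro x hx
    have := (convex_ball (0 : V) r).norm_image_sub_le_of_norm_hasFDerivWithin_le (f := k)
      (fun z hz => ((hrk hz).1.differentiableAt (by simp)).hasFDerivAt.hasFDerivWithinAt)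
      (fun z hz => (hrk hz).2.le) (Metric.mem_ball_self hr) hx
    simpa [hk0] using this
  have hF : ∀ x ∈ Metric.ball (0 : V) r, x ≠ 0 → Fine (x, k x) := by
    intro x hx hx0
    have hn : 0 < ‖x‖ := norm_pos_iff.2 hx0
    refine hfine x hx0 _ ((hkb x hx).trans_lt ?_)
    have : ε ≤ ε₀ / 2 := min_le_left _ _
    nlinarith
  suffices h : ∃ Φ : OpenPartialHomeomorph V V, IsConeDiffeoGerm Φ ∧
      Φ.source = Metric.ball 0 r ∧ ∀ x, Φ x = x + N (x, k x) by
    obtain ⟨Φ, hΦ, hΦs, hΦe⟩ := h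
    exact ⟨Φ, hΦ, fun x hx => ⟨hΦe x, fun hx0 => (hF x (hΦs ▸ hx) hx0).1⟩⟩
  refine exists_isConeDiffeoGerm_of_norm_fderiv_le hr ?_ ?_ ?_
  · intro x hx hx0
    exact (hF x hx hx0).2.1.comp x (contDiffAt_id.prodMk (hrk hx).1)
  · intro x hx hx0
    obtain ⟨-, h2, -, h4, h5⟩ := hF x hx hx0
    have hkx : HasFDerivAt k (fderiv ℝ k x) x :=
      ((hrk hx).1.differentiableAt (by simp)).hasFDerivAt
    have h6 : HasFDerivAt (fun x => N (x, k x))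
        ((fderiv ℝ N (x, k x)).comp ((ContinuousLinearMap.id ℝ V).prod (fderiv ℝ k x))) x :=
      HasFDerivAt.comp x (f := fun x => (x, k x)) (h2.differentiableAt (by simp)).hasFDerivAt
        ((hasFDerivAt_id x).prodMk hkx)
    rw [h6.fderiv]
    refine ContinuousLinearMap.opNorm_le_bound _ (by norm_num) fun v => ?_
    have h7 : ((fderiv ℝ N (x, k x)).comp ((ContinuousLinearMap.id ℝ V).prod (fderiv ℝ k x))) v =
        ((fderiv ℝ N (x, k x)).comp (ContinuousLinearMap.inl ℝ V ℝ)) v +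
        ((fderiv ℝ N (x, k x)).comp (ContinuousLinearMap.inr ℝ V ℝ)) (fderiv ℝ k x v) := by
      simp [← map_add]
    rw [h7]
    have h8 : B * ε ≤ 1 / 4 := by
      calc B * ε ≤ B * (1 / (4 * B)) := by gcongr; exact min_le_right _ _
        _ = 1 / 4 := by field_simp
    calc _ ≤ ‖(fderiv ℝ N (x, k x)).comp (ContinuousLinearMap.inl ℝ V ℝ)‖ * ‖v‖ +
          ‖(fderiv ℝ N (x, k x)).comp (ContinuousLinearMap.inr ℝ V ℝ)‖ *
            (‖fderiv ℝ k x‖ * ‖v‖) :=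
          (norm_add_le _ _).trans (add_le_add (ContinuousLinearMap.le_opNorm _ _)
            ((ContinuousLinearMap.le_opNorm _ _).trans
              (by gcongr; exact ContinuousLinearMap.le_opNorm _ _)))
      _ ≤ 1 / 4 * ‖v‖ + B * (ε * ‖v‖) := by
          gcongr
          exact (hrk hx).2.le
      _ = (1 / 4 + B * ε) * ‖v‖ := by ring
      _ ≤ 1 / 2 * ‖v‖ := by gcongr; linarith
  · intro x hx
    by_cases hx0 : x = 0
    · simp [hx0, hk0, h0]
    · exact (hF x hx hx0).2.2.1

end HomogeneousPerturbation

/-! ### The arrangement of three planes and a cone -/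

namespace Arrangement

/-- The function whose zero set is the cone `XZ = s P²`. -/
def cone (s : ℝ) (p : (ℝ × ℝ) × ℝ) : ℝ := p.1.1 * p.1.2 - s * p.2 ^ 2

/-- The linear function `μ P - X - Z`. -/
def height (μ : ℝ) (p : (ℝ × ℝ) × ℝ) : ℝ := μ * p.2 - p.1.1 - p.1.2

/-- `p'` and `p` lie on the same ones of the planes `X = 0`, `Z = 0`, `P = 0` and of the cone. -/
def SameStrata (s : ℝ) (p' p : (ℝ × ℝ) × ℝ) : Prop :=
  (p'.1.1 = 0 ↔ p.1.1 = 0) ∧ (p'.1.2 = 0 ↔ p.1.2 = 0) ∧ (p'.2 = 0 ↔ p.2 = 0) ∧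
    (cone s p' = 0 ↔ cone s p = 0)

/-- Some cone germ preserves the arrangement and takes the function `τ` to `height μ`. -/
def Straightens (s μ : ℝ) (τ : (ℝ × ℝ) × ℝ → ℝ) : Prop :=
  ∃ Φ : OpenPartialHomeomorph ((ℝ × ℝ) × ℝ) ((ℝ × ℝ) × ℝ), IsConeDiffeoGerm Φ ∧
    ∀ p ∈ Φ.source, SameStrata s (Φ p) p ∧ height μ (Φ p) = τ p

variable (s μ : ℝ) (p : (ℝ × ℝ) × ℝ)

def sqNorm : ℝ := p.1.1 ^ 2 + p.1.2 ^ 2 + p.2 ^ 2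

/-- For an amount `w`, `X` is multiplied by `(1 + w moveX)²` and `P` by `1 + w moveX`, which
preserves the cone; `moveZ` plays the same role for `Z`, and `moveP` scales `P` alone. Each
coefficient is a nonnegative factor times a derivative of the height, up to sharing factors, so that
`slope` is a sum of squares. The power of `sqNorm` gives all three the degree 5. -/
def moveX : ℝ := sqNorm p ^ 2 * (μ * p.2 - 2 * p.1.1)

def moveZ : ℝ := sqNorm p ^ 2 * (μ * p.2 - 2 * p.1.2)

def moveP : ℝ := μ * p.2 * cone s p ^ 2

/-- The derivative of the height in the direction of the move. -/
def slope : ℝ :=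
  moveX μ p * (μ * p.2 - 2 * p.1.1) + moveZ μ p * (μ * p.2 - 2 * p.1.2) + moveP s μ p * (μ * p.2)

/-- The second-order variation of the height along the move. -/
def curv : ℝ :=
  μ * p.2 * (moveX μ p * moveZ μ p) - moveX μ p ^ 2 * p.1.1 - moveZ μ p ^ 2 * p.1.2

/-- The amount of the move changing the height by a given quantity. -/
def amount (z : ((ℝ × ℝ) × ℝ) × ℝ) : ℝ :=
  2 * z.2 / (slope s μ z.1 + √(slope s μ z.1 ^ 2 + 4 * curv μ z.1 * z.2))

/-- The displacement, preserving the arrangement, that changes the height by a given quantity. -/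
def shift (z : ((ℝ × ℝ) × ℝ) × ℝ) : (ℝ × ℝ) × ℝ :=
  ((z.1.1.1 * ((1 + amount s μ z * moveX μ z.1) ^ 2 - 1),
    z.1.1.2 * ((1 + amount s μ z * moveZ μ z.1) ^ 2 - 1)),
   z.1.2 * ((1 + amount s μ z * moveX μ z.1) * (1 + amount s μ z * moveZ μ z.1)
     + amount s μ z * moveP s μ z.1 - 1))

/-! ### Positivity, homogeneity and smoothness of the displacement -/

variable {s μ} {p : (ℝ × ℝ) × ℝ}

theorem sqNorm_pos (hp : p ≠ 0) : 0 < sqNorm p := by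
  obtain ⟨⟨X, Z⟩, P⟩ := p
  unfold sqNorm
  by_contra h
  apply hp
  have hX : X = 0 := by nlinarith [sq_nonneg X, sq_nonneg Z, sq_nonneg P]
  have hZ : Z = 0 := by nlinarith [sq_nonneg X, sq_nonneg Z, sq_nonneg P]
  have hP : P = 0 := by nlinarith [sq_nonneg X, sq_nonneg Z, sq_nonneg P]
  simp [hX, hZ, hP]

/-- The slope is a sum of squares. Its vanishing forces `X = Z = μP/2` off the origin, hence `cone =
(μ² - 4s)P²/4`, and then `μP · cone = 0` forces `P = 0`. -/
theorem slope_pos (hμ : μ ≠ 0) (hs : μ ^ 2 ≠ 4 * s) (hp : p ≠ 0) : 0 < slope s μ p := by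
  have hρ := sqNorm_pos hp
  have e : slope s μ p = sqNorm p ^ 2 * ((μ * p.2 - 2 * p.1.1) ^ 2 + (μ * p.2 - 2 * p.1.2) ^ 2)
      + (μ * p.2 * cone s p) ^ 2 := by
    unfold slope moveX moveZ moveP; ring
  have h1 : 0 ≤ sqNorm p ^ 2 * ((μ * p.2 - 2 * p.1.1) ^ 2 + (μ * p.2 - 2 * p.1.2) ^ 2) := by
    positivity
  rw [e]
  refine lt_of_le_of_ne (by positivity) fun h => hp ?_
  have h2 : (μ * p.2 * cone s p) ^ 2 = 0 := by nlinarith [sq_nonneg (μ * p.2 * cone s p)]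
  have h3 : sqNorm p ^ 2 * ((μ * p.2 - 2 * p.1.1) ^ 2 + (μ * p.2 - 2 * p.1.2) ^ 2) = 0 := by
    nlinarith [sq_nonneg (μ * p.2 * cone s p)]
  have h4 : (μ * p.2 - 2 * p.1.1) ^ 2 + (μ * p.2 - 2 * p.1.2) ^ 2 = 0 :=
    (mul_eq_zero.1 h3).resolve_left (by positivity)
  have hX : μ * p.2 - 2 * p.1.1 = 0 := by
    nlinarith [sq_nonneg (μ * p.2 - 2 * p.1.1), sq_nonneg (μ * p.2 - 2 * p.1.2)]
  have hZ : μ * p.2 - 2 * p.1.2 = 0 := by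
    nlinarith [sq_nonneg (μ * p.2 - 2 * p.1.1), sq_nonneg (μ * p.2 - 2 * p.1.2)]
  have hX' : p.1.1 = μ * p.2 / 2 := by linarith
  have hZ' : p.1.2 = μ * p.2 / 2 := by linarith
  have h5 : μ * p.2 * cone s p = 0 := by simpa using h2
  have h6 : cone s p = (μ ^ 2 - 4 * s) / 4 * p.2 ^ 2 := by
    unfold cone; rw [hX', hZ']; ring
  have hP : p.2 = 0 := by
    rw [h6] at h5
    by_contra hP
    have : (μ ^ 2 - 4 * s) ≠ 0 := sub_ne_zero.2 hs
    have h7 : μ * p.2 * ((μ ^ 2 - 4 * s) / 4 * p.2 ^ 2) ≠ 0 := by positivity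
    exact h7 h5
  rw [hP] at hX' hZ'
  ext <;> simp [hX', hZ', hP]

theorem contDiff_slope : ContDiff ℝ ∞ (slope s μ) := by
  unfold slope moveX moveZ moveP sqNorm cone
  fun_prop

theorem contDiff_curv : ContDiff ℝ ∞ (curv μ) := by
  unfold curv moveX moveZ sqNorm
  fun_prop

/-- The slope has degree 6, the second variation degree 11 and the change of height degree 1, so the
amount has degree -5. The moves have degree 5, so the displacement has degree 1. -/
theorem amount_smul {c : ℝ} (hc : 0 < c) (z : ((ℝ × ℝ) × ℝ) × ℝ) :
    amount s μ (c • z) * c ^ 5 = amount s μ z := by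
  have h1 : slope s μ (c • z.1) = c ^ 6 * slope s μ z.1 := by
    simp only [slope, moveX, moveZ, moveP, sqNorm, cone, Prod.smul_fst, Prod.smul_snd, smul_eq_mul]
    ring
  have h2 : curv μ (c • z.1) = c ^ 11 * curv μ z.1 := by
    simp only [curv, moveX, moveZ, sqNorm, Prod.smul_fst, Prod.smul_snd, smul_eq_mul]
    ring
  have h3 : √((c ^ 6 * slope s μ z.1) ^ 2 + 4 * (c ^ 11 * curv μ z.1) * (c * z.2)) =
      c ^ 6 * √(slope s μ z.1 ^ 2 + 4 * curv μ z.1 * z.2) := by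
    rw [show (c ^ 6 * slope s μ z.1) ^ 2 + 4 * (c ^ 11 * curv μ z.1) * (c * z.2) =
      (c ^ 6) ^ 2 * (slope s μ z.1 ^ 2 + 4 * curv μ z.1 * z.2) by ring,
      Real.sqrt_mul (by positivity), Real.sqrt_sq (by positivity)]
  unfold amount
  rw [Prod.smul_fst, h1, h2, Prod.smul_snd, smul_eq_mul, h3, ← mul_add]
  by_cases h : slope s μ z.1 + √(slope s μ z.1 ^ 2 + 4 * curv μ z.1 * z.2) = 0
  · simp [h]
  · field_simp

theorem moveX_smul (c : ℝ) : moveX μ (c • p) = c ^ 5 * moveX μ p := by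
  simp only [moveX, sqNorm, Prod.smul_fst, Prod.smul_snd, smul_eq_mul]; ring

theorem moveZ_smul (c : ℝ) : moveZ μ (c • p) = c ^ 5 * moveZ μ p := by
  simp only [moveZ, sqNorm, Prod.smul_fst, Prod.smul_snd, smul_eq_mul]; ring

theorem moveP_smul (c : ℝ) : moveP s μ (c • p) = c ^ 5 * moveP s μ p := by
  simp only [moveP, cone, Prod.smul_fst, Prod.smul_snd, smul_eq_mul]; ring

theorem shift_smul {c : ℝ} (hc : 0 < c) (z : ((ℝ × ℝ) × ℝ) × ℝ) :
    shift s μ (c • z) = c • shift s μ z := by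
  have h := amount_smul (s := s) (μ := μ) hc z
  have hX : amount s μ (c • z) * moveX μ (c • z.1) = amount s μ z * moveX μ z.1 := by
    rw [moveX_smul, ← h]; ring
  have hZ : amount s μ (c • z) * moveZ μ (c • z.1) = amount s μ z * moveZ μ z.1 := by
    rw [moveZ_smul, ← h]; ring
  have hP : amount s μ (c • z) * moveP s μ (c • z.1) = amount s μ z * moveP s μ z.1 := by
    rw [moveP_smul, ← h]; ring
  unfold shift
  rw [Prod.smul_fst, hX, hZ, hP]
  simp only [Prod.smul_fst, Prod.smul_snd, smul_eq_mul, Prod.smul_mk, mul_assoc]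

/-- At zero change of height the radicand is `slope² > 0` and the denominator is `2 · slope > 0`.
The form of the root with the radical in the denominator needs no assumption on `curv`. -/
theorem smoothNear_amount (hμ : μ ≠ 0) (hs : μ ^ 2 ≠ 4 * s) (hp : p ≠ 0) :
    SmoothNear (amount s μ) (p, 0) := by
  have hD := slope_pos hμ hs hp
  have h1 : ContDiff ℝ ∞ (fun z : ((ℝ × ℝ) × ℝ) × ℝ => slope s μ z.1) :=
    contDiff_slope.comp contDiff_fst
  have h2 : ContDiff ℝ ∞ (fun z : ((ℝ × ℝ) × ℝ) × ℝ => curv μ z.1) :=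
    contDiff_curv.comp contDiff_fst
  refine SmoothNear.div (ContDiff.smoothNear (by fun_prop))
    (SmoothNear.add h1.smoothNear (SmoothNear.sqrt (ContDiff.smoothNear (by fun_prop)) ?_)) ?_
  · simp only [mul_zero, add_zero]; positivity
  · simp only [mul_zero, add_zero]; positivity

theorem smoothNear_shift (hμ : μ ≠ 0) (hs : μ ^ 2 ≠ 4 * s) (hp : p ≠ 0) :
    SmoothNear (shift s μ) (p, 0) := by
  filter_upwards [smoothNear_amount hμ hs hp] with z hz
  unfold shift moveX moveZ moveP sqNorm cone
  fun_prop

theorem shift_zero : shift s μ (p, 0) = 0 := by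
  simp [shift, amount]

/-- The factor by which the displacement multiplies the equation of the cone. -/
def coneFactor (s μ : ℝ) (z : ((ℝ × ℝ) × ℝ) × ℝ) : ℝ :=
  (1 + amount s μ z * moveX μ z.1) ^ 2 * (1 + amount s μ z * moveZ μ z.1) ^ 2
    - s * z.1.2 ^ 2 * (2 * ((1 + amount s μ z * moveX μ z.1) * (1 + amount s μ z * moveZ μ z.1))
      + amount s μ z * moveP s μ z.1) * (amount s μ z * (μ * z.1.2 * cone s z.1))

/-- The conditions under which the displacement preserves the strata and has the required effect. -/
def Admissible (s μ : ℝ) (z : ((ℝ × ℝ) × ℝ) × ℝ) : Prop :=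
  0 < slope s μ z.1 ∧ 0 < slope s μ z.1 ^ 2 + 4 * curv μ z.1 * z.2 ∧
  0 < 1 + amount s μ z * moveX μ z.1 ∧ 0 < 1 + amount s μ z * moveZ μ z.1 ∧
  0 < (1 + amount s μ z * moveX μ z.1) * (1 + amount s μ z * moveZ μ z.1)
     + amount s μ z * moveP s μ z.1 ∧ 0 < coneFactor s μ z

theorem eventually_admissible (hμ : μ ≠ 0) (hs : μ ^ 2 ≠ 4 * s) (hp : p ≠ 0) :
    ∀ᶠ z in 𝓝 (p, (0 : ℝ)), Admissible s μ z := by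
  have hD := slope_pos hμ hs hp
  have ha : ContinuousAt (amount s μ) (p, 0) :=
    (smoothNear_amount hμ hs hp).contDiffAt.continuousAt
  have ha0 : amount s μ (p, 0) = 0 := by simp [amount]
  have cD : Continuous (slope s μ) := contDiff_slope.continuous
  have cQ : Continuous (curv μ) := contDiff_curv.continuous
  have cX : Continuous (moveX μ) := by unfold moveX sqNorm; fun_prop
  have cZ : Continuous (moveZ μ) := by unfold moveZ sqNorm; fun_prop
  have cP : Continuous (moveP s μ) := by unfold moveP cone; fun_prop
  have cq : Continuous (cone s) := by unfold cone; fun_prop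
  have cX' : ContinuousAt (fun z : ((ℝ × ℝ) × ℝ) × ℝ => moveX μ z.1) (p, 0) :=
    (cX.comp continuous_fst).continuousAt
  have cZ' : ContinuousAt (fun z : ((ℝ × ℝ) × ℝ) × ℝ => moveZ μ z.1) (p, 0) :=
    (cZ.comp continuous_fst).continuousAt
  have cP' : ContinuousAt (fun z : ((ℝ × ℝ) × ℝ) × ℝ => moveP s μ z.1) (p, 0) :=
    (cP.comp continuous_fst).continuousAt
  have cq' : ContinuousAt (fun z : ((ℝ × ℝ) × ℝ) × ℝ => cone s z.1) (p, 0) :=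
    (cq.comp continuous_fst).continuousAt
  have pos : ∀ {f : ((ℝ × ℝ) × ℝ) × ℝ → ℝ}, ContinuousAt f (p, 0) → 0 < f (p, 0) →
      ∀ᶠ z in 𝓝 (p, (0 : ℝ)), 0 < f z := fun hf h0 => hf.eventually (lt_mem_nhds h0)
  refine (pos (cD.comp continuous_fst).continuousAt hD).and ((pos ?_ ?_).and ((pos ?_ ?_).and
    ((pos ?_ ?_).and ((pos ?_ ?_).and (pos ?_ ?_)))))
  · fun_prop
  · simp only [mul_zero, add_zero]; positivity
  · fun_prop
  · simp [ha0]
  · fun_prop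
  · simp [ha0]
  · fun_prop
  · simp [ha0]
  · unfold coneFactor; fun_prop
  · simp [ha0, coneFactor]

theorem Admissible.smul {c : ℝ} (hc : 0 < c) {z : ((ℝ × ℝ) × ℝ) × ℝ} (h : Admissible s μ z) :
    Admissible s μ (c • z) := by
  have ha := amount_smul (s := s) (μ := μ) hc z
  have hX : amount s μ (c • z) * moveX μ (c • z.1) = amount s μ z * moveX μ z.1 := by
    rw [moveX_smul, ← ha]; ring
  have hZ : amount s μ (c • z) * moveZ μ (c • z.1) = amount s μ z * moveZ μ z.1 := by
    rw [moveZ_smul, ← ha]; ring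
  have hP : amount s μ (c • z) * moveP s μ (c • z.1) = amount s μ z * moveP s μ z.1 := by
    rw [moveP_smul, ← ha]; ring
  have h1 : slope s μ (c • z.1) = c ^ 6 * slope s μ z.1 := by
    simp only [slope, moveX, moveZ, moveP, sqNorm, cone, Prod.smul_fst, Prod.smul_snd, smul_eq_mul]
    ring
  have h2 : curv μ (c • z.1) = c ^ 11 * curv μ z.1 := by
    simp only [curv, moveX, moveZ, sqNorm, Prod.smul_fst, Prod.smul_snd, smul_eq_mul]
    ring
  obtain ⟨g1, g2, g3, g4, g5, g6⟩ := h
  refine ⟨?_, ?_, ?_, ?_, ?_, ?_⟩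
  · rw [Prod.smul_fst, h1]; positivity
  · rw [Prod.smul_fst, Prod.smul_snd, h1, h2, smul_eq_mul]
    rw [show (c ^ 6 * slope s μ z.1) ^ 2 + 4 * (c ^ 11 * curv μ z.1) * (c * z.2) =
      (c ^ 6) ^ 2 * (slope s μ z.1 ^ 2 + 4 * curv μ z.1 * z.2) by ring]
    positivity
  · rwa [Prod.smul_fst, hX]
  · rwa [Prod.smul_fst, hZ]
  · rwa [Prod.smul_fst, hX, hZ, hP]
  · have : coneFactor s μ (c • z) = coneFactor s μ z := by
      unfold coneFactor
      rw [Prod.smul_fst, hX, hZ, hP, ← ha]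
      simp only [cone, Prod.smul_fst, Prod.smul_snd, smul_eq_mul]
      ring
    rwa [this]

/-- Each coordinate and the equation of the cone are multiplied by a positive factor. The cone
divides its own displaced equation because `moveP` contains `cone²`. -/
theorem Admissible.sameStrata {z : ((ℝ × ℝ) × ℝ) × ℝ} (h : Admissible s μ z) :
    SameStrata s (z.1 + shift s μ z) z.1 := by
  obtain ⟨-, -, g3, g4, g5, g6⟩ := h
  have eX : (z.1 + shift s μ z).1.1 = z.1.1.1 * (1 + amount s μ z * moveX μ z.1) ^ 2 := by
    simp only [shift, Prod.fst_add]; ring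
  have eZ : (z.1 + shift s μ z).1.2 = z.1.1.2 * (1 + amount s μ z * moveZ μ z.1) ^ 2 := by
    simp only [shift, Prod.fst_add, Prod.snd_add]; ring
  have eP : (z.1 + shift s μ z).2 = z.1.2 * ((1 + amount s μ z * moveX μ z.1) *
      (1 + amount s μ z * moveZ μ z.1) + amount s μ z * moveP s μ z.1) := by
    simp only [shift, Prod.snd_add]; ring
  have ec : cone s (z.1 + shift s μ z) = cone s z.1 * coneFactor s μ z := by
    rw [cone, eX, eZ, eP]
    unfold coneFactor moveP cone
    ring
  refine ⟨?_, ?_, ?_, ?_⟩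
  · rw [eX]; simp [g3.ne']
  · rw [eZ]; simp [g4.ne']
  · rw [eP]; simp [g5.ne']
  · rw [ec]; simp [g6.ne']

/-- The height changes by `w · slope + w² · curv` exactly, and `amount` is the root `w` of this
quadratic equation that vanishes with the prescribed change. -/
theorem Admissible.height {z : ((ℝ × ℝ) × ℝ) × ℝ} (h : Admissible s μ z) :
    height μ (z.1 + shift s μ z) = height μ z.1 + z.2 := by
  obtain ⟨g1, g2, -⟩ := h
  have hr := Real.sqrt_pos.2 g2
  have hr2 := Real.sq_sqrt g2.le
  have e1 : Arrangement.height μ (z.1 + shift s μ z) = Arrangement.height μ z.1 +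
      amount s μ z * slope s μ z.1 + amount s μ z ^ 2 * curv μ z.1 := by
    simp only [Arrangement.height, shift, Prod.fst_add, Prod.snd_add, slope, curv]
    ring
  have e2 : amount s μ z * (slope s μ z.1 + √(slope s μ z.1 ^ 2 + 4 * curv μ z.1 * z.2)) =
      2 * z.2 := by
    unfold amount
    field_simp
  rw [e1, add_assoc, add_right_inj]
  generalize amount s μ z = w at *
  generalize slope s μ z.1 = D at *
  generalize √(D ^ 2 + 4 * curv μ z.1 * z.2) = r at *
  have hpos : D + r ≠ 0 := by positivity
  apply mul_left_cancel₀ (pow_ne_zero 2 hpos)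
  linear_combination (D * (D + r) + curv μ z.1 * (w * (D + r) + 2 * z.2)) * e2 - z.2 * hr2

/-- The differential of `k` at the origin may be small instead of zero; this also allows the slope
`μ` itself to be varied. -/
theorem exists_straightens_perturbation (hμ : μ ≠ 0) (hs : μ ^ 2 ≠ 4 * s) :
    ∃ ε > 0, ∀ k : (ℝ × ℝ) × ℝ → ℝ, SmoothNear k 0 → k 0 = 0 → ‖fderiv ℝ k 0‖ < ε →
      Straightens s μ (fun p => Arrangement.height μ p + k p) := by
  obtain ⟨ε, hε, h⟩ := exists_isConeDiffeoGerm_of_homogeneous (N := shift s μ)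
    (fun x hx => smoothNear_shift hμ hs hx) (fun c hc z => shift_smul hc z) (fun x => shift_zero)
    (fun x hx => eventually_admissible hμ hs hx) (fun c hc z => Admissible.smul hc)
  refine ⟨ε, hε, fun k hk hk0 hkd => ?_⟩
  obtain ⟨Φ, hΦ, hΦ'⟩ := h k hk hk0 hkd
  refine ⟨Φ, hΦ, fun p hp => ?_⟩
  by_cases hp0 : p = 0
  · subst hp0
    rw [hΦ.map_zero]
    exact ⟨⟨Iff.rfl, Iff.rfl, Iff.rfl, Iff.rfl⟩, by simp [hk0]⟩
  · obtain ⟨h1, h2⟩ := hΦ' p hp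
    rw [h1]
    exact ⟨(h2 hp0).sameStrata, (h2 hp0).height⟩

/-! ### Deforming one height function into another -/

theorem SameStrata.trans {p q r : (ℝ × ℝ) × ℝ} (h : SameStrata s p q) (h' : SameStrata s q r) :
    SameStrata s p r :=
  ⟨h.1.trans h'.1, h.2.1.trans h'.2.1, h.2.2.1.trans h'.2.2.1, h.2.2.2.trans h'.2.2.2⟩

theorem SameStrata.symm {p q : (ℝ × ℝ) × ℝ} (h : SameStrata s p q) : SameStrata s q p :=
  ⟨h.1.symm, h.2.1.symm, h.2.2.1.symm, h.2.2.2.symm⟩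

theorem Straightens.trans {μ' : ℝ} {τ : (ℝ × ℝ) × ℝ → ℝ} (h : Straightens s μ τ)
    (h' : Straightens s μ' (Arrangement.height μ)) : Straightens s μ' τ := by
  obtain ⟨Φ, hΦ, h1⟩ := h
  obtain ⟨Ψ, hΨ, h2⟩ := h'
  refine ⟨Φ.trans Ψ, hΦ.trans hΨ, fun p hp => ?_⟩
  have hp1 : p ∈ Φ.source := hp.1
  have hp2 : Φ p ∈ Ψ.source := hp.2
  exact ⟨(h2 _ hp2).1.trans (h1 _ hp1).1, (h2 _ hp2).2.trans (h1 _ hp1).2⟩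

theorem Straightens.symm {μ' : ℝ} (h : Straightens s μ (Arrangement.height μ')) :
    Straightens s μ' (Arrangement.height μ) := by
  obtain ⟨Φ, hΦ, h1⟩ := h
  refine ⟨Φ.symm, hΦ.symm, fun p hp => ?_⟩
  have h2 := h1 _ (Φ.map_target hp)
  rw [Φ.right_inv hp] at h2
  exact ⟨h2.1.symm, h2.2.symm⟩

theorem hasFDerivAt_height (p : (ℝ × ℝ) × ℝ) :
    HasFDerivAt (Arrangement.height μ) (μ • ContinuousLinearMap.snd ℝ (ℝ × ℝ) ℝ -
      (ContinuousLinearMap.fst ℝ ℝ ℝ).comp (ContinuousLinearMap.fst ℝ (ℝ × ℝ) ℝ) -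
      (ContinuousLinearMap.snd ℝ ℝ ℝ).comp (ContinuousLinearMap.fst ℝ (ℝ × ℝ) ℝ)) p :=
  (μ • ContinuousLinearMap.snd ℝ (ℝ × ℝ) ℝ -
      (ContinuousLinearMap.fst ℝ ℝ ℝ).comp (ContinuousLinearMap.fst ℝ (ℝ × ℝ) ℝ) -
      (ContinuousLinearMap.snd ℝ ℝ ℝ).comp (ContinuousLinearMap.fst ℝ (ℝ × ℝ) ℝ)).hasFDerivAt

/-- Nearby slopes are related by a small linear perturbation, and the relation is symmetric and
transitive. Hence it holds throughout a preconnected set of admissible slopes. -/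
theorem straightens_height {I : Set ℝ} (hI : IsPreconnected I)
    (hI' : ∀ μ ∈ I, μ ≠ 0 ∧ μ ^ 2 ≠ 4 * s) {μ' : ℝ} (h : μ ∈ I) (h' : μ' ∈ I) :
    Straightens s μ (Arrangement.height μ') := by
  refine hI.induction₂ (fun μ μ' => Straightens s μ (Arrangement.height μ')) ?_ ?_ ?_ h h'
  · intro ν hν
    obtain ⟨ε, hε, H⟩ := exists_straightens_perturbation (hI' ν hν).1 (hI' ν hν).2
    have h1 : Tendsto (fun ν' : ℝ => ‖(ν' - ν) • ContinuousLinearMap.snd ℝ (ℝ × ℝ) ℝ‖) (𝓝 ν)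
        (𝓝 0) := by
      have : Continuous fun ν' : ℝ => ‖(ν' - ν) • ContinuousLinearMap.snd ℝ (ℝ × ℝ) ℝ‖ := by
        fun_prop
      simpa using this.tendsto ν
    filter_upwards [nhdsWithin_le_nhds (h1.eventually_lt_const hε)] with ν' hν'
    have h2 := H (fun p => ((ν' - ν) • ContinuousLinearMap.snd ℝ (ℝ × ℝ) ℝ) p)
      (ContDiff.smoothNear (ContinuousLinearMap.contDiff _)) (by simp)
      (by rwa [ContinuousLinearMap.fderiv])
    convert h2 using 2 with p
    simp [Arrangement.height]
    ring
  · intro a b c _ _ _ hab hbc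
    exact hbc.trans hab
  · intro a b _ _ hab
    exact hab.symm

/-- The remainder after the linear part has zero differential, so it is removed first; then the
slope is changed from `μ'` to `μ`. -/
theorem straightens_of_fderiv_eq {I : Set ℝ} (hI : IsPreconnected I)
    (hI' : ∀ μ ∈ I, μ ≠ 0 ∧ μ ^ 2 ≠ 4 * s) {μ' : ℝ} (h : μ ∈ I) (h' : μ' ∈ I)
    {τ : (ℝ × ℝ) × ℝ → ℝ} (hτ : SmoothNear τ 0) (hτ0 : τ 0 = 0)
    (hτd : ∀ v, fderiv ℝ τ 0 v = Arrangement.height μ' v) : Straightens s μ τ := by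
  obtain ⟨ε, hε, H⟩ := exists_straightens_perturbation (hI' μ' h').1 (hI' μ' h').2
  have hh : SmoothNear (Arrangement.height μ') 0 :=
    ContDiff.smoothNear (by unfold Arrangement.height; fun_prop)
  have h1 := H (fun p => τ p - Arrangement.height μ' p) (hτ.sub hh)
    (by simp [hτ0, Arrangement.height]) (by
      have hd := hτ.differentiableAt.hasFDerivAt.sub (hasFDerivAt_height (μ := μ') 0)
      have : fderiv ℝ (fun p => τ p - Arrangement.height μ' p) 0 = 0 := by
        refine (HasFDerivAt.fderiv hd).trans ?_
        refine ContinuousLinearMap.ext fun v => ?_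
        simp only [sub_apply, hτd v]
        simp [Arrangement.height]
      rw [this, norm_zero]
      exact hε)
  have h2 : Straightens s μ' τ := by
    convert h1 using 2 with p
    ring
  exact h2.trans (straightens_height hI hI' h h')

end Arrangement

/-! ### Fundamental forms along a frame of constant directions -/

namespace Minkowski

theorem hasDerivAt_inner {f g : ℝ → Fin 3 → ℝ} {f' g' : Fin 3 → ℝ} {t : ℝ}
    (hf : HasDerivAt f f' t) (hg : HasDerivAt g g' t) :
    HasDerivAt (fun s => inner (f s) (g s)) (inner f' (g t) + inner (f t) g') t := by
  have hf' := hasDerivAt_pi.1 hf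
  have hg' := hasDerivAt_pi.1 hg
  have := (((hf' 0).mul (hg' 0)).add ((hf' 1).mul (hg' 1))).sub ((hf' 2).mul (hg' 2))
  refine this.congr_deriv ?_
  simp only [inner]
  ring

theorem hasDerivAt_cross {f g : ℝ → Fin 3 → ℝ} {f' g' : Fin 3 → ℝ} {t : ℝ}
    (hf : HasDerivAt f f' t) (hg : HasDerivAt g g' t) :
    HasDerivAt (fun s => cross (f s) (g s)) (cross f' (g t) + cross (f t) g') t := by
  have hf' := hasDerivAt_pi.1 hf
  have hg' := hasDerivAt_pi.1 hg
  rw [hasDerivAt_pi]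
  intro i
  fin_cases i
  · refine (((hf' 1).mul (hg' 2)).sub ((hf' 2).mul (hg' 1))).congr_deriv ?_
    simp [cross]; ring
  · refine (((hf' 2).mul (hg' 0)).sub ((hf' 0).mul (hg' 2))).congr_deriv ?_
    simp [cross]; ring
  · refine (((hf' 0).mul (hg' 1)).sub ((hf' 1).mul (hg' 0))).neg.congr_deriv ?_
    simp [cross]; ring

theorem contDiff_inner : ContDiff ℝ ∞ (fun p : (Fin 3 → ℝ) × (Fin 3 → ℝ) => inner p.1 p.2) := by
  unfold inner
  fun_prop

theorem contDiff_cross : ContDiff ℝ ∞ (fun p : (Fin 3 → ℝ) × (Fin 3 → ℝ) => cross p.1 p.2) := by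
  rw [contDiff_pi]
  intro i
  fin_cases i <;> simp [cross] <;> fun_prop

theorem inner_add_right (a b c : Fin 3 → ℝ) : inner a (b + c) = inner a b + inner a c := by
  simp [inner]; ring

theorem inner_smul_right (a b : Fin 3 → ℝ) (c : ℝ) : inner a (c • b) = c * inner a b := by
  simp [inner]; ring

theorem inner_smul_left (a b : Fin 3 → ℝ) (c : ℝ) : inner (c • a) b = c * inner a b := by
  simp [inner]; ring

theorem inner_comm (a b : Fin 3 → ℝ) : inner a b = inner b a := by
  simp [inner]; ring

theorem inner_cross_left (a b : Fin 3 → ℝ) : inner (cross a b) a = 0 := by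
  simp [inner, cross]; ring

theorem inner_cross_right (a b : Fin 3 → ℝ) : inner (cross a b) b = 0 := by
  simp [inner, cross]; ring

theorem inner_cross_self (a b : Fin 3 → ℝ) :
    inner (cross a b) (cross a b) = inner a b ^ 2 - inner a a * inner b b := by
  simp [inner, cross]; ring

section Frame

variable {V : Type*} [NormedAddCommGroup V] [NormedSpace ℝ V]

/-- Derivative in a constant direction. -/
def dir {W : Type*} [NormedAddCommGroup W] [NormedSpace ℝ W] (a : V) (X : V → W) (p : V) : W :=
  fderiv ℝ X p a

variable (e : V × V) (σ : ℝ) (X : V → Fin 3 → ℝ) (p : V)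

def frameE : ℝ := inner (dir e.1 X p) (dir e.1 X p)

def frameF : ℝ := inner (dir e.1 X p) (dir e.2 X p)

def frameG : ℝ := inner (dir e.2 X p) (dir e.2 X p)

def frameDelta : ℝ := frameF e X p ^ 2 - frameE e X p * frameG e X p

/-- The second fundamental form (with the non-normalised normal vector) of the frame. -/
def frameSnd (a b : V) : ℝ := inner (cross (dir e.1 X p) (dir e.2 X p)) (dir b (dir a X) p)

/-- `F ± √δ`; the vectors `(R, -E)` and `(-G, R)` of the frame are lightlike. -/
def frameR : ℝ := frameF e X p + σ * √(frameDelta e X p)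

/-- The second fundamental form at the lightlike vector `(R, -E)`. -/
def nullL : ℝ :=
  frameR e σ X p ^ 2 * frameSnd e X p e.1 e.1
    - 2 * frameR e σ X p * frameE e X p * frameSnd e X p e.1 e.2
    + frameE e X p ^ 2 * frameSnd e X p e.2 e.2

/-- The second fundamental form at the lightlike vector `(-G, R)`. -/
def nullN : ℝ :=
  frameG e X p ^ 2 * frameSnd e X p e.1 e.1
    - 2 * frameR e σ X p * frameG e X p * frameSnd e X p e.1 e.2
    + frameR e σ X p ^ 2 * frameSnd e X p e.2 e.2

def frameMcnc : ℝ :=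
  frameSnd e X p e.1 e.1 * frameG e X p - 2 * frameSnd e X p e.1 e.2 * frameF e X p
    + frameSnd e X p e.2 e.2 * frameE e X p

def framePc : ℝ :=
  frameSnd e X p e.1 e.1 * frameSnd e X p e.2 e.2 - frameSnd e X p e.1 e.2 ^ 2

def frameLpl : ℝ :=
  (frameE e X p * frameSnd e X p e.2 e.2 - frameG e X p * frameSnd e X p e.1 e.1) ^ 2
    - 4 * (frameF e X p * frameSnd e X p e.2 e.2 - frameG e X p * frameSnd e X p e.1 e.2)
      * (frameE e X p * frameSnd e X p e.1 e.2 - frameF e X p * frameSnd e X p e.1 e.1)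

/-- The second fundamental form at the two lightlike vectors, up to sign. -/
def nullM : ℝ := frameR e σ X p * frameMcnc e X p

variable {e σ X p}

/-- This quadratic equation is the condition that `(R, -E)` and `(-G, R)` be lightlike; all later
identities hold modulo it. -/
theorem frameR_sq (hσ : σ ^ 2 = 1) (hδ : 0 ≤ frameDelta e X p) :
    frameR e σ X p ^ 2 = 2 * frameF e X p * frameR e σ X p - frameE e X p * frameG e X p := by
  have h := Real.sq_sqrt hδ
  have h' : frameDelta e X p = frameF e X p ^ 2 - frameE e X p * frameG e X p := rfl
  have h'' : frameR e σ X p = frameF e X p + σ * √(frameDelta e X p) := rfl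
  rw [h'']
  linear_combination σ ^ 2 * h + σ ^ 2 * h' +
    (frameF e X p ^ 2 - frameE e X p * frameG e X p) * hσ

/-- A lightlike principal direction is a lightlike direction on which the second fundamental form
vanishes. Algebraically, both sides agree after `EG = 2FR - R²` is substituted. -/
theorem sq_mul_frameLpl (hσ : σ ^ 2 = 1) (hδ : 0 ≤ frameDelta e X p) :
    frameR e σ X p ^ 2 * frameLpl e X p = nullL e σ X p * nullN e σ X p := by
  have h := frameR_sq hσ hδ
  unfold frameLpl nullL nullN
  generalize frameR e σ X p = R at *
  generalize frameE e X p = E at *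
  generalize frameF e X p = F at *
  generalize frameG e X p = G at *
  generalize frameSnd e X p e.1 e.1 = l at *
  generalize frameSnd e X p e.1 e.2 = m at *
  generalize frameSnd e X p e.2 e.2 = n at *
  have hEG : E * G = 2 * F * R - R ^ 2 := by linarith
  have h2 : R ^ 2 * ((E * n - G * l) ^ 2 - 4 * (F * n - G * m) * (E * m - F * l)) -
      (R ^ 2 * l - 2 * R * E * m + E ^ 2 * n) * (G ^ 2 * l - 2 * R * G * m + R ^ 2 * n) =
      -(l * n) * (E * G) ^ 2 - 2 * R ^ 2 * (l * n) * (E * G) + 4 * F ^ 2 * R ^ 2 * (l * n)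
        - R ^ 4 * (l * n)
        + 2 * R * (m * n) * E * (E * G + R ^ 2 - 2 * F * R)
        + 2 * R * (l * m) * G * (E * G + R ^ 2 - 2 * F * R) := by
    ring
  have h3 : (R ^ 2 * ((E * n - G * l) ^ 2 - 4 * (F * n - G * m) * (E * m - F * l)) -
      (R ^ 2 * l - 2 * R * E * m + E ^ 2 * n) * (G ^ 2 * l - 2 * R * G * m + R ^ 2 * n)) = 0 := by
    rw [h2, hEG]; ring
  linarith

/-- The determinant of the second fundamental form in the lightlike basis acquires the factor `(R² -
EG)² = 4δR²`. The computation uses `δ̃ = H̄² + 4δK̄`. -/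
theorem four_mul_framePc (hσ : σ ^ 2 = 1) (hδ : 0 ≤ frameDelta e X p) :
    4 * frameDelta e X p * frameR e σ X p ^ 2 * framePc e X p =
      nullL e σ X p * nullN e σ X p - nullM e σ X p ^ 2 := by
  rw [← sq_mul_frameLpl hσ hδ]
  unfold frameLpl nullM framePc frameMcnc frameDelta
  ring

variable {a b : V}

theorem smoothNear_dir {W : Type*} [NormedAddCommGroup W] [NormedSpace ℝ W] {X : V → W}
    (hX : SmoothNear X p) (a : V) : SmoothNear (dir a X) p :=
  hX.fderiv_apply a

theorem smoothNear_inner {f g : V → Fin 3 → ℝ} (hf : SmoothNear f p) (hg : SmoothNear g p) :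
    SmoothNear (fun q => inner (f q) (g q)) p :=
  SmoothNear.comp (g := fun p : (Fin 3 → ℝ) × (Fin 3 → ℝ) => inner p.1 p.2)
    contDiff_inner.smoothNear (hf.prodMk hg)

theorem smoothNear_cross {f g : V → Fin 3 → ℝ} (hf : SmoothNear f p) (hg : SmoothNear g p) :
    SmoothNear (fun q => cross (f q) (g q)) p :=
  SmoothNear.comp (g := fun p : (Fin 3 → ℝ) × (Fin 3 → ℝ) => cross p.1 p.2)
    contDiff_cross.smoothNear (hf.prodMk hg)

theorem smoothNear_frameE (hX : SmoothNear X p) : SmoothNear (frameE e X) p :=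
  smoothNear_inner (smoothNear_dir hX _) (smoothNear_dir hX _)

theorem smoothNear_frameF (hX : SmoothNear X p) : SmoothNear (frameF e X) p :=
  smoothNear_inner (smoothNear_dir hX _) (smoothNear_dir hX _)

theorem smoothNear_frameG (hX : SmoothNear X p) : SmoothNear (frameG e X) p :=
  smoothNear_inner (smoothNear_dir hX _) (smoothNear_dir hX _)

theorem smoothNear_frameSnd (hX : SmoothNear X p) (a b : V) :
    SmoothNear (fun q => frameSnd e X q a b) p :=
  smoothNear_inner (smoothNear_cross (smoothNear_dir hX _) (smoothNear_dir hX _))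
    (smoothNear_dir (smoothNear_dir hX _) _)

theorem smoothNear_frameDelta (hX : SmoothNear X p) : SmoothNear (frameDelta e X) p := by
  filter_upwards [smoothNear_frameE (e := e) hX, smoothNear_frameF (e := e) hX,
    smoothNear_frameG (e := e) hX] with q h1 h2 h3
  unfold frameDelta
  fun_prop

theorem smoothNear_frameR (hX : SmoothNear X p) (hδ : 0 < frameDelta e X p) :
    SmoothNear (frameR e σ X) p :=
  (smoothNear_frameF hX).add ((smoothNear_const σ).mul ((smoothNear_frameDelta hX).sqrt hδ.ne'))

theorem smoothNear_frameMcnc (hX : SmoothNear X p) : SmoothNear (frameMcnc e X) p := by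
  filter_upwards [smoothNear_frameE (e := e) hX, smoothNear_frameF (e := e) hX,
    smoothNear_frameG (e := e) hX, smoothNear_frameSnd (e := e) hX e.1 e.1,
    smoothNear_frameSnd (e := e) hX e.1 e.2, smoothNear_frameSnd (e := e) hX e.2 e.2]
    with q h1 h2 h3 h4 h5 h6
  unfold frameMcnc
  fun_prop

theorem smoothNear_nullM (hX : SmoothNear X p) (hδ : 0 < frameDelta e X p) :
    SmoothNear (nullM e σ X) p :=
  (smoothNear_frameR hX hδ).mul (smoothNear_frameMcnc hX)

theorem smoothNear_nullL (hX : SmoothNear X p) (hδ : 0 < frameDelta e X p) :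
    SmoothNear (nullL e σ X) p := by
  filter_upwards [smoothNear_frameE (e := e) hX, smoothNear_frameR (σ := σ) hX hδ,
    smoothNear_frameSnd (e := e) hX e.1 e.1,
    smoothNear_frameSnd (e := e) hX e.1 e.2, smoothNear_frameSnd (e := e) hX e.2 e.2]
    with q h1 h2 h4 h5 h6
  unfold nullL
  fun_prop

theorem smoothNear_nullN (hX : SmoothNear X p) (hδ : 0 < frameDelta e X p) :
    SmoothNear (nullN e σ X) p := by
  filter_upwards [smoothNear_frameG (e := e) hX, smoothNear_frameR (σ := σ) hX hδ,
    smoothNear_frameSnd (e := e) hX e.1 e.1,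
    smoothNear_frameSnd (e := e) hX e.1 e.2, smoothNear_frameSnd (e := e) hX e.2 e.2]
    with q h1 h2 h4 h5 h6
  unfold nullN
  fun_prop

/-- The derivative of a function in a direction, computed along a line. -/
theorem hasDerivAt_line {W : Type*} [NormedAddCommGroup W] [NormedSpace ℝ W] {f : V → W}
    (hf : DifferentiableAt ℝ f p) (c : V) :
    HasDerivAt (fun t : ℝ => f (p + t • c)) (dir c f p) 0 :=
  hf.hasFDerivAt.hasLineDerivAt c

theorem dir_eq_of_hasDerivAt_line {f : V → ℝ} (hf : DifferentiableAt ℝ f p) {c : V} {d : ℝ}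
    (h : HasDerivAt (fun t : ℝ => f (p + t • c)) d 0) : dir c f p = d :=
  (hasDerivAt_line hf c).unique h

theorem dir_frameSnd (hX : SmoothNear X p) (a b c : V) :
    dir c (fun q => frameSnd e X q a b) p =
      inner (cross (dir c (dir e.1 X) p) (dir e.2 X p)) (dir b (dir a X) p) +
      inner (cross (dir e.1 X p) (dir c (dir e.2 X) p)) (dir b (dir a X) p) +
      inner (cross (dir e.1 X p) (dir e.2 X p)) (dir c (dir b (dir a X)) p) := by
  have h1 := fun a => (smoothNear_dir hX a).differentiableAt
  have h2 := fun a b => (smoothNear_dir (smoothNear_dir hX a) b).differentiableAt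
  have h3 := hasDerivAt_inner (hasDerivAt_cross (hasDerivAt_line (h1 e.1) c)
    (hasDerivAt_line (h1 e.2) c)) (hasDerivAt_line (h2 a b) c)
  rw [dir_eq_of_hasDerivAt_line (smoothNear_frameSnd hX a b).differentiableAt h3]
  simp only [zero_smul, add_zero]
  simp [inner]
  ring

/-- At a point where the second fundamental form vanishes. -/
def SndVanishes (e : V × V) (X : V → Fin 3 → ℝ) (p : V) : Prop :=
  frameSnd e X p e.1 e.1 = 0 ∧ frameSnd e X p e.1 e.2 = 0 ∧ frameSnd e X p e.2 e.2 = 0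

/-- The derivative of the second fundamental form in the direction `c`. -/
def dSnd (e : V × V) (X : V → Fin 3 → ℝ) (p : V) (a b c : V) : ℝ :=
  dir c (fun q => frameSnd e X q a b) p

/-- The derivative of `nullL` where the second fundamental form vanishes. -/
def dNullL (e : V × V) (σ : ℝ) (X : V → Fin 3 → ℝ) (p c : V) : ℝ :=
  frameR e σ X p ^ 2 * dSnd e X p e.1 e.1 c
    - 2 * frameR e σ X p * frameE e X p * dSnd e X p e.1 e.2 c
    + frameE e X p ^ 2 * dSnd e X p e.2 e.2 c

/-- The derivative of `nullN` where the second fundamental form vanishes. -/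
def dNullN (e : V × V) (σ : ℝ) (X : V → Fin 3 → ℝ) (p c : V) : ℝ :=
  frameG e X p ^ 2 * dSnd e X p e.1 e.1 c
    - 2 * frameR e σ X p * frameG e X p * dSnd e X p e.1 e.2 c
    + frameR e σ X p ^ 2 * dSnd e X p e.2 e.2 c

/-- The derivative of `nullM` where the second fundamental form vanishes. -/
def dNullM (e : V × V) (σ : ℝ) (X : V → Fin 3 → ℝ) (p c : V) : ℝ :=
  frameR e σ X p * (dSnd e X p e.1 e.1 c * frameG e X p
    - 2 * dSnd e X p e.1 e.2 c * frameF e X p + dSnd e X p e.2 e.2 c * frameE e X p)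

theorem hasDerivAt_line_frameSnd (hX : SmoothNear X p) (a b c : V) :
    HasDerivAt (fun t : ℝ => frameSnd e X (p + t • c) a b) (dSnd e X p a b c) 0 :=
  hasDerivAt_line (smoothNear_frameSnd hX a b).differentiableAt c

/-- Where the second fundamental form vanishes, the terms with derivatives of `E` and `R` drop out.
The derivative thus becomes an expression in the 3-jet without derivatives of the square root. -/
theorem dir_nullL (hX : SmoothNear X p) (hδ : 0 < frameDelta e X p) (h0 : SndVanishes e X p)
    (c : V) : dir c (nullL e σ X) p = dNullL e σ X p c := by
  refine dir_eq_of_hasDerivAt_line (smoothNear_nullL hX hδ).differentiableAt ?_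
  have hE := hasDerivAt_line (smoothNear_frameE (e := e) hX).differentiableAt c
  have hR := hasDerivAt_line (smoothNear_frameR (σ := σ) hX hδ).differentiableAt c
  have h1 := hasDerivAt_line_frameSnd (e := e) hX e.1 e.1 c
  have h2 := hasDerivAt_line_frameSnd (e := e) hX e.1 e.2 c
  have h3 := hasDerivAt_line_frameSnd (e := e) hX e.2 e.2 c
  refine ((((hR.pow 2).mul h1).sub (((hR.const_mul 2).mul hE).mul h2)).add
    ((hE.pow 2).mul h3)).congr_deriv ?_
  simp [dNullL, h0.1, h0.2.1, h0.2.2]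

theorem dir_nullN (hX : SmoothNear X p) (hδ : 0 < frameDelta e X p) (h0 : SndVanishes e X p)
    (c : V) : dir c (nullN e σ X) p = dNullN e σ X p c := by
  refine dir_eq_of_hasDerivAt_line (smoothNear_nullN hX hδ).differentiableAt ?_
  have hG := hasDerivAt_line (smoothNear_frameG (e := e) hX).differentiableAt c
  have hR := hasDerivAt_line (smoothNear_frameR (σ := σ) hX hδ).differentiableAt c
  have h1 := hasDerivAt_line_frameSnd (e := e) hX e.1 e.1 c
  have h2 := hasDerivAt_line_frameSnd (e := e) hX e.1 e.2 c
  have h3 := hasDerivAt_line_frameSnd (e := e) hX e.2 e.2 c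
  refine ((((hG.pow 2).mul h1).sub (((hR.const_mul 2).mul hG).mul h2)).add
    ((hR.pow 2).mul h3)).congr_deriv ?_
  simp [dNullN, h0.1, h0.2.1, h0.2.2]

theorem dir_nullM (hX : SmoothNear X p) (hδ : 0 < frameDelta e X p) (h0 : SndVanishes e X p)
    (c : V) : dir c (nullM e σ X) p = dNullM e σ X p c := by
  refine dir_eq_of_hasDerivAt_line (smoothNear_nullM hX hδ).differentiableAt ?_
  have hE := hasDerivAt_line (smoothNear_frameE (e := e) hX).differentiableAt c
  have hF := hasDerivAt_line (smoothNear_frameF (e := e) hX).differentiableAt c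
  have hG := hasDerivAt_line (smoothNear_frameG (e := e) hX).differentiableAt c
  have hR := hasDerivAt_line (smoothNear_frameR (σ := σ) hX hδ).differentiableAt c
  have h1 := hasDerivAt_line_frameSnd (e := e) hX e.1 e.1 c
  have h2 := hasDerivAt_line_frameSnd (e := e) hX e.1 e.2 c
  have h3 := hasDerivAt_line_frameSnd (e := e) hX e.2 e.2 c
  refine (hR.mul (((h1.mul hG).sub ((h2.const_mul 2).mul hF)).add (h3.mul hE))).congr_deriv ?_
  simp [dNullM, h0.1, h0.2.1, h0.2.2]

theorem SndVanishes.nullL (h0 : SndVanishes e X p) : nullL e σ X p = 0 := by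
  simp [Minkowski.nullL, h0.1, h0.2.1, h0.2.2]

theorem SndVanishes.nullN (h0 : SndVanishes e X p) : nullN e σ X p = 0 := by
  simp [Minkowski.nullN, h0.1, h0.2.1, h0.2.2]

theorem SndVanishes.nullM (h0 : SndVanishes e X p) : nullM e σ X p = 0 := by
  simp [Minkowski.nullM, Minkowski.frameMcnc, h0.1, h0.2.1, h0.2.2]

end Frame

/-- The coordinate frame of the plane. -/
def planeFrame : (ℝ × ℝ) × (ℝ × ℝ) := ((1, 0), (0, 1))

/-- The coordinate frame of the plane, in the space of a one-parameter family. -/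
def familyFrame : ((ℝ × ℝ) × ℝ) × ((ℝ × ℝ) × ℝ) := (((1, 0), 0), ((0, 1), 0))

theorem lplFun_eq (x : ℝ × ℝ → Fin 3 → ℝ) (q : ℝ × ℝ) :
    lplFun x q = frameLpl planeFrame x q := rfl

theorem pcFun_eq (x : ℝ × ℝ → Fin 3 → ℝ) (q : ℝ × ℝ) :
    pcFun x q = framePc planeFrame x q := rfl

theorem mcncFun_eq (x : ℝ × ℝ → Fin 3 → ℝ) (q : ℝ × ℝ) :
    mcncFun x q = frameMcnc planeFrame x q := rfl

/-! ### Slices of a family -/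

theorem eventually_dir_slice {W : Type*} [NormedAddCommGroup W] [NormedSpace ℝ W]
    {X : (ℝ × ℝ) × ℝ → W} (hX : SmoothNear X 0) (a : ℝ × ℝ) :
    ∀ᶠ p in 𝓝 (0 : (ℝ × ℝ) × ℝ), dir a (fun q => X (q, p.2)) p.1 = dir (a, (0 : ℝ)) X p := by
  filter_upwards [hX] with p hp
  have h1 : HasFDerivAt (fun q => X (q, p.2))
      ((fderiv ℝ X p).comp (ContinuousLinearMap.inl ℝ (ℝ × ℝ) ℝ)) p.1 :=
    HasFDerivAt.comp p.1 (f := fun q : ℝ × ℝ => (q, p.2))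
      (hp.differentiableAt (by simp)).hasFDerivAt (hasFDerivAt_prodMk_left p.1 p.2)
  simp [dir, h1.fderiv]

/-- An identity valid near the origin of `ℝ² × ℝ` also holds near `p.1` within the slice through
`p`, so both sides may be differentiated again along the slice. -/
theorem eventually_slice {W : Type*} {f g : (ℝ × ℝ) × ℝ → W}
    (h : ∀ᶠ p in 𝓝 (0 : (ℝ × ℝ) × ℝ), f p = g p) :
    ∀ᶠ p in 𝓝 (0 : (ℝ × ℝ) × ℝ),
      (fun q => f (q, p.2)) =ᶠ[𝓝 p.1] fun q => g (q, p.2) := by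
  filter_upwards [eventually_eventually_nhds.2 h] with p hp
  have : Tendsto (fun q : ℝ × ℝ => (q, p.2)) (𝓝 p.1) (𝓝 p) := by
    have : Continuous fun q : ℝ × ℝ => (q, p.2) := by fun_prop
    exact this.tendsto p.1
  exact this.eventually hp

theorem eventually_dir_dir_slice {X : (ℝ × ℝ) × ℝ → Fin 3 → ℝ} (hX : SmoothNear X 0)
    (a b : ℝ × ℝ) : ∀ᶠ p in 𝓝 (0 : (ℝ × ℝ) × ℝ),
      dir b (dir a (fun q => X (q, p.2))) p.1 = dir (b, (0 : ℝ)) (dir (a, (0 : ℝ)) X) p := by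
  filter_upwards [eventually_dir_slice (smoothNear_dir hX (a, 0)) b,
    eventually_slice (eventually_dir_slice hX a)] with p h1 h2
  rw [← h1]
  simp only [dir]
  exact congrArg (fun A : ℝ × ℝ →L[ℝ] (Fin 3 → ℝ) => A b) (Filter.EventuallyEq.fderiv_eq h2)

theorem eventually_frame_slice {X : (ℝ × ℝ) × ℝ → Fin 3 → ℝ} (hX : SmoothNear X 0) :
    ∀ᶠ p in 𝓝 (0 : (ℝ × ℝ) × ℝ),
      frameE planeFrame (fun q => X (q, p.2)) p.1 = frameE familyFrame X p ∧
      frameF planeFrame (fun q => X (q, p.2)) p.1 = frameF familyFrame X p ∧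
      frameG planeFrame (fun q => X (q, p.2)) p.1 = frameG familyFrame X p ∧
      frameSnd planeFrame (fun q => X (q, p.2)) p.1 (1, 0) (1, 0) =
        frameSnd familyFrame X p ((1, 0), 0) ((1, 0), 0) ∧
      frameSnd planeFrame (fun q => X (q, p.2)) p.1 (1, 0) (0, 1) =
        frameSnd familyFrame X p ((1, 0), 0) ((0, 1), 0) ∧
      frameSnd planeFrame (fun q => X (q, p.2)) p.1 (0, 1) (0, 1) =
        frameSnd familyFrame X p ((0, 1), 0) ((0, 1), 0) := by
  filter_upwards [eventually_dir_slice hX (1, 0), eventually_dir_slice hX (0, 1),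
    eventually_dir_dir_slice hX (1, 0) (1, 0), eventually_dir_dir_slice hX (1, 0) (0, 1),
    eventually_dir_dir_slice hX (0, 1) (0, 1)] with p h1 h2 h3 h4 h5
  simp only [frameE, frameF, frameG, frameSnd, planeFrame, familyFrame, h1, h2, h3, h4, h5,
    and_self]

theorem eventually_lplFun_slice {X : (ℝ × ℝ) × ℝ → Fin 3 → ℝ} (hX : SmoothNear X 0) :
    ∀ᶠ p in 𝓝 (0 : (ℝ × ℝ) × ℝ),
      lplFun (fun q => X (q, p.2)) p.1 = frameLpl familyFrame X p ∧
      pcFun (fun q => X (q, p.2)) p.1 = framePc familyFrame X p ∧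
      mcncFun (fun q => X (q, p.2)) p.1 = frameMcnc familyFrame X p := by
  filter_upwards [eventually_frame_slice hX] with p ⟨h1, h2, h3, h4, h5, h6⟩
  rw [lplFun_eq, pcFun_eq, mcncFun_eq]
  simp only [frameLpl, framePc, frameMcnc, h1, h2, h3]
  simp only [planeFrame, familyFrame] at *
  simp only [h4, h5, h6, and_self]

end Minkowski

/-! ### Change of parameters -/

namespace Minkowski

section Second

variable {V W : Type*} [NormedAddCommGroup V] [NormedSpace ℝ V] [NormedAddCommGroup W]
  [NormedSpace ℝ W]

theorem dir_dir_eq {X : V → W} {p : V} (hX : ContDiffAt ℝ ∞ X p) (a b : V) :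
    dir b (dir a X) p = fderiv ℝ (fderiv ℝ X) p b a := by
  have h : DifferentiableAt ℝ (fderiv ℝ X) p :=
    (hX.fderiv_right (m := ∞) (by simp)).differentiableAt (by simp)
  have h1 : HasFDerivAt (fun q => fderiv ℝ X q a) ((fderiv ℝ (fderiv ℝ X) p).flip a) p := by
    simpa using h.hasFDerivAt.clm_apply (hasFDerivAt_const a p)
  exact congrArg (fun A : V →L[ℝ] W => A b) h1.fderiv

theorem dir_dir_comm {X : V → W} {p : V} (hX : ContDiffAt ℝ ∞ X p) (a b : V) :
    dir b (dir a X) p = dir a (dir b X) p := by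
  rw [dir_dir_eq hX, dir_dir_eq hX]
  exact (hX.isSymmSndFDerivAt (by simpa using WithTop.coe_le_coe.2 (le_top (a := (2 : ℕ∞))))) b a

theorem eventually_dir_comp {U : Type*} [NormedAddCommGroup U] [NormedSpace ℝ U] {x : V → W}
    {h : U → V} {y : U → W} {q₀ : U} (hx : SmoothNear x (h q₀)) (hh : SmoothNear h q₀)
    (hy : y =ᶠ[𝓝 q₀] fun q => x (h q)) (a : U) :
    ∀ᶠ q in 𝓝 q₀, dir a y q = fderiv ℝ x (h q) (dir a h q) := by
  filter_upwards [hy.eventuallyEq_nhds, hh, hh.contDiffAt.continuousAt.eventually hx]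
    with q h1 h2 h3
  have h4 : HasFDerivAt (fun q => x (h q)) ((fderiv ℝ x (h q)).comp (fderiv ℝ h q)) q :=
    (h3.differentiableAt (by simp)).hasFDerivAt.comp q (h2.differentiableAt (by simp)).hasFDerivAt
  simp only [dir, h1.fderiv_eq, h4.fderiv]
  rfl

/-- The second term, a first derivative of `x` applied to a second derivative of `h`, is tangent to
the surface and disappears on pairing with the normal. -/
theorem eventually_dir_dir_comp {U : Type*} [NormedAddCommGroup U] [NormedSpace ℝ U] {x : V → W}
    {h : U → V} {y : U → W} {q₀ : U} (hx : SmoothNear x (h q₀)) (hh : SmoothNear h q₀)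
    (hy : y =ᶠ[𝓝 q₀] fun q => x (h q)) (a b : U) :
    ∀ᶠ q in 𝓝 q₀, dir b (dir a y) q =
      fderiv ℝ (fderiv ℝ x) (h q) (dir b h q) (dir a h q) +
        fderiv ℝ x (h q) (dir b (dir a h) q) := by
  filter_upwards [Filter.EventuallyEq.eventuallyEq_nhds (eventually_dir_comp hx hh hy a), hh,
    smoothNear_dir hh a, hh.contDiffAt.continuousAt.eventually hx]
    with q h1 h2 h2' h3
  have h4 : HasFDerivAt (fderiv ℝ x) (fderiv ℝ (fderiv ℝ x) (h q)) (h q) :=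
    ((h3.fderiv_right (m := ∞) (by simp)).differentiableAt (by simp)).hasFDerivAt
  have h5 := (h4.comp q (h2.differentiableAt (by simp)).hasFDerivAt).clm_apply
    (h2'.differentiableAt (by simp)).hasFDerivAt
  have h6 : dir b (dir a y) q = dir b (fun q => fderiv ℝ x (h q) (dir a h q)) q := by
    simp only [dir] at h1 ⊢
    rw [h1.fderiv_eq]
  rw [h6]
  unfold dir at h5 ⊢
  simp only [Function.comp_def] at h5
  rw [h5.fderiv]
  simp [add_comm]

end Second

/-- The Jacobian determinant of a map of the plane. -/
def jac (h : ℝ × ℝ → ℝ × ℝ) (q : ℝ × ℝ) : ℝ :=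
  (dir (1, 0) h q).1 * (dir (0, 1) h q).2 - (dir (1, 0) h q).2 * (dir (0, 1) h q).1

theorem clm_plane_apply {W : Type*} [NormedAddCommGroup W] [NormedSpace ℝ W]
    (A : ℝ × ℝ →L[ℝ] W) (v : ℝ × ℝ) : A v = v.1 • A (1, 0) + v.2 • A (0, 1) := by
  rw [← map_smul, ← map_smul, ← map_add]
  congr 1
  ext <;> simp

theorem jac_ne_zero {h : ℝ × ℝ → ℝ × ℝ} {q : ℝ × ℝ}
    (hinj : Function.Injective (fderiv ℝ h q)) : jac h q ≠ 0 := by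
  intro h0
  unfold jac dir at h0
  have h1 : fderiv ℝ h q ((fderiv ℝ h q (0, 1)).2, -(fderiv ℝ h q (1, 0)).2) = fderiv ℝ h q 0 := by
    rw [clm_plane_apply, map_zero]
    ext
    · simp; linarith
    · simp; ring
  have h2 : fderiv ℝ h q ((fderiv ℝ h q (0, 1)).1, -(fderiv ℝ h q (1, 0)).1) = fderiv ℝ h q 0 := by
    rw [clm_plane_apply, map_zero]
    ext
    · simp; ring
    · simp; linarith
  have h3 := hinj h1
  have h4 := hinj h2
  have h5 : fderiv ℝ h q (1, 0) = fderiv ℝ h q 0 := by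
    rw [map_zero]
    ext
    · simpa using congrArg Prod.snd h4
    · simpa using congrArg Prod.snd h3
  simpa using hinj h5

/-- Bilinear expansion of the second fundamental form: the tangential vector `αu + βv` is orthogonal
to the normal, and `B = C` is the symmetry of second derivatives. -/
theorem snd_transform {u v N : Fin 3 → ℝ} {A B C D n' : Fin 3 → ℝ} {c d e f g : ℝ}
    (hn : n' = g • N) (hu : inner N u = 0) (hv : inner N v = 0) {α β : ℝ}
    (hBC : B = C) :
    inner n' (c • (e • A + f • B) + d • (e • C + f • D) + (α • u + β • v)) =
      g * (c * e * inner N A + (c * f + d * e) * inner N B + d * f * inner N D) := by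
  subst hn
  subst hBC
  simp only [inner_add_right, inner_smul_right, inner_smul_left, hu, hv]
  ring

/-- Transformation rules of the functions attached to a surface under a change of parameters. -/
theorem eventually_comp {x : ℝ × ℝ → Fin 3 → ℝ} {h : ℝ × ℝ → ℝ × ℝ} {y : ℝ × ℝ → Fin 3 → ℝ}
    (hx : SmoothNear x (h 0)) (hh : SmoothNear h 0) (hy : y =ᶠ[𝓝 0] fun q => x (h q)) :
    ∀ᶠ q in 𝓝 0, lplFun y q = jac h q ^ 6 * lplFun x (h q) ∧
      pcFun y q = jac h q ^ 4 * pcFun x (h q) ∧ mcncFun y q = jac h q ^ 3 * mcncFun x (h q) ∧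
      delta y q = jac h q ^ 2 * delta x (h q) ∧
      (SndVanishes planeFrame x (h q) → SndVanishes planeFrame y q) := by
  filter_upwards [eventually_dir_comp hx hh hy (1, 0), eventually_dir_comp hx hh hy (0, 1),
    eventually_dir_dir_comp hx hh hy (1, 0) (1, 0), eventually_dir_dir_comp hx hh hy (1, 0) (0, 1),
    eventually_dir_dir_comp hx hh hy (0, 1) (0, 1), hh.contDiffAt.continuousAt.eventually hx]
    with q h1 h2 h11 h12 h22 hxq
  set u := dir (1, 0) x (h q) with hu
  set v := dir (0, 1) x (h q) with hv
  set a := dir (1, 0) h q with ha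
  set b := dir (0, 1) h q with hb
  have e1 : dir (1, 0) y q = a.1 • u + a.2 • v := by rw [h1, clm_plane_apply]; rfl
  have e2 : dir (0, 1) y q = b.1 • u + b.2 • v := by rw [h2, clm_plane_apply]; rfl
  have hE : frameE planeFrame y q = a.1 ^ 2 * frameE planeFrame x (h q) +
      2 * a.1 * a.2 * frameF planeFrame x (h q) + a.2 ^ 2 * frameG planeFrame x (h q) := by
    simp only [frameE, frameF, frameG, planeFrame, e1, ← hu, ← hv]
    simp [inner]; ring
  have hF : frameF planeFrame y q = a.1 * b.1 * frameE planeFrame x (h q) +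
      (a.1 * b.2 + a.2 * b.1) * frameF planeFrame x (h q) +
      a.2 * b.2 * frameG planeFrame x (h q) := by
    simp only [frameE, frameF, frameG, planeFrame, e1, e2, ← hu, ← hv]
    simp [inner]; ring
  have hG : frameG planeFrame y q = b.1 ^ 2 * frameE planeFrame x (h q) +
      2 * b.1 * b.2 * frameF planeFrame x (h q) + b.2 ^ 2 * frameG planeFrame x (h q) := by
    simp only [frameE, frameF, frameG, planeFrame, e2, ← hu, ← hv]
    simp [inner]; ring
  have hj : jac h q = a.1 * b.2 - a.2 * b.1 := rfl
  have hn : cross (dir (1, 0) y q) (dir (0, 1) y q) = jac h q • cross u v := by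
    rw [e1, e2, hj]
    ext i
    fin_cases i <;> simp [cross] <;> ring
  have hsym : dir (1, 0) (dir (0, 1) x) (h q) = dir (0, 1) (dir (1, 0) x) (h q) :=
    dir_dir_comm hxq _ _
  have expand : ∀ c d : ℝ × ℝ, fderiv ℝ (fderiv ℝ x) (h q) c d =
      c.1 • (d.1 • dir (1, 0) (dir (1, 0) x) (h q) + d.2 • dir (1, 0) (dir (0, 1) x) (h q)) +
      c.2 • (d.1 • dir (0, 1) (dir (1, 0) x) (h q) + d.2 • dir (0, 1) (dir (0, 1) x) (h q)) := by
    intro c d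
    rw [dir_dir_eq hxq, dir_dir_eq hxq, dir_dir_eq hxq, dir_dir_eq hxq]
    rw [clm_plane_apply (fderiv ℝ (fderiv ℝ x) (h q)) c]
    rw [add_apply, smul_apply, smul_apply, clm_plane_apply _ d,
      clm_plane_apply (fderiv ℝ (fderiv ℝ x) (h q) (0, 1)) d]
  have key : ∀ c d w : ℝ × ℝ, inner (cross (dir (1, 0) y q) (dir (0, 1) y q))
      (fderiv ℝ (fderiv ℝ x) (h q) c d + fderiv ℝ x (h q) w) =
      jac h q * (c.1 * d.1 * frameSnd planeFrame x (h q) (1, 0) (1, 0) +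
        (c.1 * d.2 + c.2 * d.1) * frameSnd planeFrame x (h q) (1, 0) (0, 1) +
        c.2 * d.2 * frameSnd planeFrame x (h q) (0, 1) (0, 1)) := by
    intro c d w
    rw [expand, clm_plane_apply (fderiv ℝ x (h q)) w]
    refine (snd_transform hn (inner_cross_left u v) (inner_cross_right u v) hsym).trans ?_
    simp only [frameSnd, planeFrame, ← hu, ← hv, hsym]
  have hl := key a a (dir (1, 0) (dir (1, 0) h) q)
  rw [← h11] at hl
  change frameSnd planeFrame y q (1, 0) (1, 0) = _ at hl
  have hm := key b a (dir (0, 1) (dir (1, 0) h) q)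
  rw [← h12] at hm
  change frameSnd planeFrame y q (1, 0) (0, 1) = _ at hm
  have hnn := key b b (dir (0, 1) (dir (0, 1) h) q)
  rw [← h22] at hnn
  change frameSnd planeFrame y q (0, 1) (0, 1) = _ at hnn
  have hp1 : planeFrame.1 = ((1, 0) : ℝ × ℝ) := rfl
  have hp2 : planeFrame.2 = ((0, 1) : ℝ × ℝ) := rfl
  refine ⟨?_, ?_, ?_, ?_, ?_⟩
  -- The three functions are invariants of the pair of fundamental forms, of degrees (2, 2), (0, 2)
  -- and (1, 1). A form of degree `d` in all contributes `J^d` by substitution, and each second form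
  -- one more `J` through the normal: weights 6, 4 and 3.
  · rw [lplFun_eq, lplFun_eq]
    simp only [frameLpl, hE, hF, hG, hp1, hp2, hl, hm, hnn, hj]
    ring
  · rw [pcFun_eq, pcFun_eq]
    simp only [framePc, hp1, hp2, hl, hm, hnn, hj]
    ring
  · rw [mcncFun_eq, mcncFun_eq]
    simp only [frameMcnc, hE, hF, hG, hp1, hp2, hl, hm, hnn, hj]
    ring
  · change frameDelta planeFrame y q = jac h q ^ 2 * frameDelta planeFrame x (h q)
    simp only [frameDelta, hE, hF, hG, hj]
    ring
  · rintro ⟨s1, s2, s3⟩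
    simp only [hp1, hp2] at s1 s2 s3
    refine ⟨?_, ?_, ?_⟩
    · simp only [hp1, hl, s1, s2, s3]; ring
    · simp only [hp1, hp2, hm, s1, s2, s3]; ring
    · simp only [hp2, hnn, s1, s2, s3]; ring

/-! ### Flat timelike umbilic points -/

/-- `a`, `b` and `a × b` are a basis when `⟨a × b, a × b⟩`, their determinant, is nonzero. The
coefficients below are those of the reciprocal basis. -/
theorem eq_zero_of_inner_eq_zero {a b y : Fin 3 → ℝ} (hδ : inner (cross a b) (cross a b) ≠ 0)
    (ha : inner y a = 0) (hb : inner y b = 0) (hc : inner y (cross a b) = 0) : y = 0 := by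
  have key : ∀ i, inner (cross a b) (cross a b) * y i = 0 := by
    intro i
    simp only [inner, cross] at *
    simp only [Matrix.cons_val_zero, Matrix.cons_val_one, Matrix.cons_val] at *
    fin_cases i
    · simp only [Fin.zero_eta]
      linear_combination (a 1 * b 2 - a 2 * b 1) * hc -
        (b 2 * (a 2 * b 0 - a 0 * b 2) - b 1 * (-(a 0 * b 1 - a 1 * b 0))) * ha -
        (a 1 * (-(a 0 * b 1 - a 1 * b 0)) - a 2 * (a 2 * b 0 - a 0 * b 2)) * hb
    · simp only [Fin.mk_one]
      linear_combination (a 2 * b 0 - a 0 * b 2) * hc -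
        (b 0 * (-(a 0 * b 1 - a 1 * b 0)) - b 2 * (a 1 * b 2 - a 2 * b 1)) * ha -
        (a 2 * (a 1 * b 2 - a 2 * b 1) - a 0 * (-(a 0 * b 1 - a 1 * b 0))) * hb
    · simp only [Fin.reduceFinMk]
      linear_combination (-(a 0 * b 1 - a 1 * b 0)) * hc -
        (b 0 * (a 2 * b 0 - a 0 * b 2) - b 1 * (a 1 * b 2 - a 2 * b 1)) * ha -
        (a 1 * (a 1 * b 2 - a 2 * b 1) - a 0 * (a 2 * b 0 - a 0 * b 2)) * hb
  ext i
  exact (mul_eq_zero.1 (key i)).resolve_left hδ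

theorem inner_normal_normal (x : ℝ × ℝ → Fin 3 → ℝ) (q : ℝ × ℝ) :
    inner (normal x q) (normal x q) = delta x q :=
  inner_cross_self _ _

theorem unitNormal_eq (x : ℝ × ℝ → Fin 3 → ℝ) (q : ℝ × ℝ) :
    unitNormal x q = (√|delta x q|)⁻¹ • normal x q := by
  rw [unitNormal, inner_normal_normal]

theorem differentiableAt_unitNormal {x : ℝ × ℝ → Fin 3 → ℝ} {q : ℝ × ℝ} (hx : SmoothNear x q)
    (hδ : 0 < delta x q) : DifferentiableAt ℝ (unitNormal x) q := by
  have h1 : SmoothNear (delta x) q := smoothNear_frameDelta (e := planeFrame) hx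
  have h2 : SmoothNear (normal x) q :=
    smoothNear_cross (smoothNear_dir hx (1, 0)) (smoothNear_dir hx (0, 1))
  have h3 : unitNormal x =ᶠ[𝓝 q] fun q => (√(delta x q))⁻¹ • normal x q := by
    filter_upwards [h1.contDiffAt.continuousAt.eventually (lt_mem_nhds hδ)] with p hp
    rw [unitNormal_eq, abs_of_pos hp]
  refine DifferentiableAt.congr_of_eventuallyEq ?_ h3
  exact ((h1.sqrt hδ.ne').differentiableAt.inv (Real.sqrt_pos.2 hδ).ne').smul h2.differentiableAt

theorem inner_dir_unitNormal {x : ℝ × ℝ → Fin 3 → ℝ} {q : ℝ × ℝ} (hx : SmoothNear x q)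
    (hδ : 0 < delta x q) (a b : ℝ × ℝ) (ha : ∀ p, inner (unitNormal x p) (dir a x p) = 0) :
    inner (dir b (unitNormal x) q) (dir a x q) + inner (unitNormal x q) (dir b (dir a x) q) = 0 := by
  have h1 := hasDerivAt_inner (hasDerivAt_line (differentiableAt_unitNormal hx hδ) b)
    (hasDerivAt_line (smoothNear_dir hx a).differentiableAt b)
  simp only [ha, zero_smul, add_zero] at h1
  exact h1.unique (hasDerivAt_const 0 0)

theorem inner_unitNormal_du (x : ℝ × ℝ → Fin 3 → ℝ) (p : ℝ × ℝ) :
    inner (unitNormal x p) (dir (1, 0) x p) = 0 := by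
  rw [unitNormal, inner_smul_left]
  exact mul_eq_zero_of_right _ (inner_cross_left _ _)

theorem inner_unitNormal_dv (x : ℝ × ℝ → Fin 3 → ℝ) (p : ℝ × ℝ) :
    inner (unitNormal x p) (dir (0, 1) x p) = 0 := by
  rw [unitNormal, inner_smul_left]
  exact mul_eq_zero_of_right _ (inner_cross_right _ _)

/-- At an umbilic the second fundamental form is `κ` times the first and the Gaussian curvature is
`κ²`. Conversely, if the second form vanishes, the derivative of the unit normal is orthogonal to
both tangent vectors and to the normal, hence zero. -/
theorem isFlatTimelikeUmbilic_iff {x : ℝ × ℝ → Fin 3 → ℝ} {q : ℝ × ℝ} (hx : SmoothNear x q) :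
    IsFlatTimelikeUmbilic x q ↔
      0 < frameDelta planeFrame x q ∧ SndVanishes planeFrame x q := by
  have key : 0 < delta x q → ∀ a b : ℝ × ℝ, inner (unitNormal x q) (dir b (dir a x) q) =
      (√(delta x q))⁻¹ * frameSnd planeFrame x q a b := by
    intro hδ a b
    rw [unitNormal_eq, abs_of_pos hδ, inner_smul_left]
    rfl
  constructor
  · rintro ⟨hδ, ⟨κ, hκ⟩, hK⟩
    have hs := (Real.sqrt_pos.2 hδ).ne'
    have hN : ∀ b, dir b (unitNormal x) q = (-κ) • dir b x q := by
      intro b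
      have := hκ b
      simp only [dir]
      rw [neg_smul, ← this, neg_neg]
    have hl := inner_dir_unitNormal hx hδ (1, 0) (1, 0) (inner_unitNormal_du x)
    have hm := inner_dir_unitNormal hx hδ (1, 0) (0, 1) (inner_unitNormal_du x)
    have hn := inner_dir_unitNormal hx hδ (0, 1) (0, 1) (inner_unitNormal_dv x)
    rw [hN, inner_smul_left] at hl hm hn
    have hl' : l x q = κ * E x q := by
      change inner (unitNormal x q) (dir (1, 0) (dir (1, 0) x) q) =
        κ * inner (dir (1, 0) x q) (dir (1, 0) x q)
      linarith
    have hm' : m x q = κ * F x q := by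
      change inner (unitNormal x q) (dir (0, 1) (dir (1, 0) x) q) =
        κ * inner (dir (1, 0) x q) (dir (0, 1) x q)
      rw [inner_comm (dir (1, 0) x q)]
      linarith
    have hn' : n x q = κ * G x q := by
      change inner (unitNormal x q) (dir (0, 1) (dir (0, 1) x) q) =
        κ * inner (dir (0, 1) x q) (dir (0, 1) x q)
      linarith
    have hκ0 : κ = 0 := by
      rw [gaussCurvature, hl', hm', hn'] at hK
      have hne : E x q * G x q - F x q ^ 2 ≠ 0 := by
        have : delta x q = F x q ^ 2 - E x q * G x q := rfl
        intro h; linarith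
      rw [div_eq_zero_iff, or_iff_left hne] at hK
      have : κ ^ 2 * (E x q * G x q - F x q ^ 2) = 0 := by rw [← hK]; ring
      simpa [hne] using this
    have hz : ∀ a b : ℝ × ℝ, inner (unitNormal x q) (dir b (dir a x) q) = 0 →
        frameSnd planeFrame x q a b = 0 := by
      intro a b hab
      rw [key hδ] at hab
      exact (mul_eq_zero.1 hab).resolve_left (inv_ne_zero hs)
    refine ⟨hδ, hz _ _ ?_, hz _ _ ?_, hz _ _ ?_⟩
    · exact hl'.trans (by rw [hκ0, zero_mul])
    · exact hm'.trans (by rw [hκ0, zero_mul])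
    · exact hn'.trans (by rw [hκ0, zero_mul])
  · rintro ⟨hδ, h1, h2, h3⟩
    have hδ' : 0 < delta x q := hδ
    have hs := Real.sqrt_pos.2 hδ'
    have hl : inner (unitNormal x q) (dir (1, 0) (dir (1, 0) x) q) = 0 := by
      rw [key hδ']; exact mul_eq_zero_of_right _ h1
    have hm : inner (unitNormal x q) (dir (0, 1) (dir (1, 0) x) q) = 0 := by
      rw [key hδ']; exact mul_eq_zero_of_right _ h2
    have hn : inner (unitNormal x q) (dir (0, 1) (dir (0, 1) x) q) = 0 := by
      rw [key hδ']; exact mul_eq_zero_of_right _ h3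
    have hm2 : inner (unitNormal x q) (dir (1, 0) (dir (0, 1) x) q) = 0 := by
      rw [dir_dir_comm hx.contDiffAt]; exact hm
    refine ⟨hδ, ⟨0, fun w => ?_⟩, ?_⟩
    · have hNN : ∀ b, inner (dir b (unitNormal x) q) (normal x q) = 0 := by
        intro b
        have h1 := hasDerivAt_inner (hasDerivAt_line (differentiableAt_unitNormal hx hδ') b)
          (hasDerivAt_line (differentiableAt_unitNormal hx hδ') b)
        -- Near `q` the unit normal has square exactly 1, since the square of the unnormalised
        -- normal is `δ > 0`; its derivative is therefore orthogonal to it.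
        have h2 : (fun s : ℝ => inner (unitNormal x (q + s • b)) (unitNormal x (q + s • b)))
            =ᶠ[𝓝 0] fun _ => 1 := by
          have hc : ContinuousAt (fun s : ℝ => delta x (q + s • b)) 0 := by
            refine ContinuousAt.comp (g := delta x) ?_ (by fun_prop)
            rw [zero_smul, add_zero]
            exact (smoothNear_frameDelta (e := planeFrame) hx).contDiffAt.continuousAt
          filter_upwards [hc.eventually (lt_mem_nhds (a := 0) (by simpa using hδ'))] with s hs
          rw [unitNormal_eq, inner_smul_left, inner_smul_right, inner_normal_normal,
            abs_of_pos hs]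
          have h3 := Real.sqrt_pos.2 hs
          have h4 := Real.sq_sqrt hs.le
          field_simp
          linarith
        have h3 := (h1.congr_of_eventuallyEq h2.symm).unique (hasDerivAt_const 0 1)
        simp only [zero_smul, add_zero] at h3
        rw [inner_comm (unitNormal x q), unitNormal_eq x q, inner_smul_right,
          abs_of_pos hδ'] at h3
        have h5 : (√(delta x q))⁻¹ * inner (dir b (unitNormal x) q) (normal x q) = 0 := by
          linarith
        exact (mul_eq_zero.1 h5).resolve_left (inv_ne_zero hs.ne')
      have hb : ∀ b, inner (dir b (unitNormal x) q) (dir (1, 0) x q) = 0 →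
          inner (dir b (unitNormal x) q) (dir (0, 1) x q) = 0 → dir b (unitNormal x) q = 0 := by
        intro b hb1 hb2
        refine eq_zero_of_inner_eq_zero (a := dir (1, 0) x q) (b := dir (0, 1) x q) ?_ hb1 hb2
          (hNN b)
        exact (inner_normal_normal x q).trans_ne hδ'.ne'
      have hu : dir (1, 0) (unitNormal x) q = 0 := by
        have g1 := inner_dir_unitNormal hx hδ (1, 0) (1, 0) (inner_unitNormal_du x)
        have g2 := inner_dir_unitNormal hx hδ (0, 1) (1, 0) (inner_unitNormal_dv x)
        rw [hl, add_zero] at g1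
        rw [hm2, add_zero] at g2
        exact hb _ g1 g2
      have hv : dir (0, 1) (unitNormal x) q = 0 := by
        have g1 := inner_dir_unitNormal hx hδ (1, 0) (0, 1) (inner_unitNormal_du x)
        have g2 := inner_dir_unitNormal hx hδ (0, 1) (0, 1) (inner_unitNormal_dv x)
        rw [hm, add_zero] at g1
        rw [hn, add_zero] at g2
        exact hb _ g1 g2
      simp only [dir] at hu hv
      rw [clm_plane_apply, hu, hv]
      simp
    · have hl' : l x q = 0 := hl
      have hm' : m x q = 0 := hm
      simp [gaussCurvature, hl', hm']

end Minkowski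

/-! ### Germs of the form `LN`, `LN - M²`, `M` -/

/-- The determinant of two linear forms on the plane. -/
def wedge (A B : ℝ × ℝ →L[ℝ] ℝ) : ℝ := A (1, 0) * B (0, 1) - A (0, 1) * B (1, 0)

theorem planeForm_apply (A : ℝ × ℝ →L[ℝ] ℝ) (v : ℝ × ℝ) : A v = v.1 * A (1, 0) + v.2 * A (0, 1) :=
  Minkowski.clm_plane_apply A v

theorem eq_zero_of_wedge_ne_zero {A B : ℝ × ℝ →L[ℝ] ℝ} (h : wedge A B ≠ 0) {v : ℝ × ℝ}
    (hA : A v = 0) (hB : B v = 0) : v = 0 := by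
  rw [planeForm_apply] at hA hB
  unfold wedge at h
  have h1 : wedge A B * v.1 = 0 := by
    unfold wedge; linear_combination B (0, 1) * hA - A (0, 1) * hB
  have h2 : wedge A B * v.2 = 0 := by
    unfold wedge; linear_combination A (1, 0) * hB - B (1, 0) * hA
  ext
  · exact (mul_eq_zero.1 h1).resolve_left h
  · exact (mul_eq_zero.1 h2).resolve_left h

/-- Cramer's rule: three linear forms on the plane are dependent, with these determinants as
coefficients. -/
theorem wedge_mul_apply (A B C : ℝ × ℝ →L[ℝ] ℝ) (v : ℝ × ℝ) :
    wedge A B * C v = wedge C B * A v + wedge A C * B v := by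
  rw [planeForm_apply A, planeForm_apply B, planeForm_apply C]
  unfold wedge
  ring

theorem mul_comm_of_wedge_eq_zero {A B : ℝ × ℝ →L[ℝ] ℝ} (h : wedge A B = 0) (v w : ℝ × ℝ) :
    A v * B w = A w * B v := by
  rw [planeForm_apply A v, planeForm_apply A w, planeForm_apply B v, planeForm_apply B w]
  unfold wedge at h
  linear_combination (v.1 * w.2 - v.2 * w.1) * h

/-- The linear forms `l`, `n`, `m` are in general position with respect to the pencil of quadratic
forms `l n`, `l n - m²`. -/
structure GeneralPosition (l n m : ℝ × ℝ →L[ℝ] ℝ) : Prop where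
  ln : wedge l n ≠ 0
  mn : wedge m n ≠ 0
  lm : wedge l m ≠ 0
  disc : wedge l n ^ 2 ≠ 4 * (wedge m n * wedge l m)

/-- No tangent direction of `LN = 0` is tangent to `M = 0`. All the transversality statements reduce
to this. -/
theorem GeneralPosition.eq_zero {l n m : ℝ × ℝ →L[ℝ] ℝ} (hp : GeneralPosition l n m) {v : ℝ × ℝ}
    (h1 : l v * n v = 0) (h2 : m v = 0) : v = 0 := by
  have h3 := wedge_mul_apply l n m v
  rw [h2, mul_zero] at h3
  rcases mul_eq_zero.1 h1 with h | h
  · rw [h, mul_zero, zero_add, eq_comm, mul_eq_zero, or_iff_right hp.lm] at h3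
    exact eq_zero_of_wedge_ne_zero hp.ln h h3
  · rw [h, mul_zero, add_zero, eq_comm, mul_eq_zero, or_iff_right hp.mn] at h3
    exact eq_zero_of_wedge_ne_zero hp.ln h3 h

/-- The functions `f`, `g`, `h` are, up to units, `LN`, `LN - M²` and `M`. -/
structure IsNullTriple (f g h L N M : ℝ × ℝ → ℝ) : Prop where
  smoothL : SmoothNear L 0
  smoothN : SmoothNear N 0
  smoothM : SmoothNear M 0
  zeroL : L 0 = 0
  zeroN : N 0 = 0
  zeroM : M 0 = 0
  eq_f : ∃ u : ℝ × ℝ → ℝ, SmoothNear u 0 ∧ 0 < u 0 ∧ ∀ᶠ q in 𝓝 0, f q = u q * (L q * N q)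
  eq_g : ∃ u : ℝ × ℝ → ℝ, SmoothNear u 0 ∧ 0 < u 0 ∧ ∀ᶠ q in 𝓝 0, g q = u q * (L q * N q - M q ^ 2)
  eq_h : ∃ u : ℝ × ℝ → ℝ, SmoothNear u 0 ∧ u 0 ≠ 0 ∧ ∀ᶠ q in 𝓝 0, h q = u q * M q

/-! ### Quadratic parts along curves, and parametrised regular curves -/

section

theorem SmoothNear.fderiv_mul_of_zero {u f : ℝ × ℝ → ℝ} (hu : SmoothNear u 0)
    (hf : SmoothNear f 0) (h0 : f 0 = 0) (c : ℝ × ℝ) :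
    fderiv ℝ (fun q => u q * f q) 0 c = u 0 * fderiv ℝ f 0 c := by
  have := hu.differentiableAt.hasFDerivAt.mul hf.differentiableAt.hasFDerivAt
  rw [HasFDerivAt.fderiv (f := fun q => u q * f q) this]
  simp [h0]

/-- Two functions with independent differentials are coordinates. -/
theorem exists_isDiffeoGerm_prodMk {a b : ℝ × ℝ → ℝ} (ha : SmoothNear a 0) (hb : SmoothNear b 0)
    (ha0 : a 0 = 0) (hb0 : b 0 = 0)
    (hinj : ∀ c, fderiv ℝ a 0 c = 0 → fderiv ℝ b 0 c = 0 → c = 0) :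
    ∃ h : OpenPartialHomeomorph (ℝ × ℝ) (ℝ × ℝ), IsDiffeoGerm h ∧ ⇑h = fun q => (a q, b q) := by
  refine SmoothNear.exists_isDiffeoGerm (ha.prodMk hb) (by simp [ha0, hb0]) ?_
  have hd := ha.differentiableAt.hasFDerivAt.prodMk hb.differentiableAt.hasFDerivAt
  rw [hd.fderiv]
  refine (injective_iff_map_eq_zero _).2 fun c hc => ?_
  have h1 := congrArg Prod.fst hc
  have h2 := congrArg Prod.snd hc
  exact hinj c (by simpa using h1) (by simpa using h2)

theorem tendsto_comp_div {L : ℝ × ℝ → ℝ} (hL : DifferentiableAt ℝ L 0) (hL0 : L 0 = 0)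
    {γ : ℝ → ℝ × ℝ} {v : ℝ × ℝ} (hγ : HasDerivAt γ v 0) (hγ0 : γ 0 = 0) :
    Tendsto (fun s => L (γ s) / s) (𝓝[≠] 0) (𝓝 (fderiv ℝ L 0 v)) := by
  have h1 : HasFDerivAt L (fderiv ℝ L 0) (γ 0) := by rw [hγ0]; exact hL.hasFDerivAt
  have h2 := (h1.comp_hasDerivAt 0 hγ).tendsto_slope_zero
  refine h2.congr fun s => ?_
  simp [hγ0, hL0, div_eq_inv_mul]

/-- The limit reads the quadratic part off along any curve through the origin, without a
second-order Taylor expansion. `κ = 0` serves the `LPL` and `κ = -1` the `PC`. -/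
theorem tendsto_comp_div_sq {f u L N M : ℝ × ℝ → ℝ} {κ : ℝ}
    (hu : ContinuousAt u 0) (hL : DifferentiableAt ℝ L 0) (hN : DifferentiableAt ℝ N 0)
    (hM : DifferentiableAt ℝ M 0) (hL0 : L 0 = 0) (hN0 : N 0 = 0) (hM0 : M 0 = 0)
    (hf : ∀ᶠ q in 𝓝 0, f q = u q * (L q * N q + κ * M q ^ 2))
    {γ : ℝ → ℝ × ℝ} {v : ℝ × ℝ} (hγ : HasDerivAt γ v 0) (hγ0 : γ 0 = 0) :
    Tendsto (fun s => f (γ s) / s ^ 2) (𝓝[≠] 0)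
      (𝓝 (u 0 * (fderiv ℝ L 0 v * fderiv ℝ N 0 v + κ * fderiv ℝ M 0 v ^ 2))) := by
  have hγc : Tendsto γ (𝓝[≠] 0) (𝓝 0) := by
    have := hγ.continuousAt.tendsto
    rw [hγ0] at this
    exact this.mono_left nhdsWithin_le_nhds
  have h1 := tendsto_comp_div hL hL0 hγ hγ0
  have h2 := tendsto_comp_div hN hN0 hγ hγ0
  have h3 := tendsto_comp_div hM hM0 hγ hγ0
  have h4 := (hu.tendsto.comp hγc).mul ((h1.mul h2).add ((h3.pow 2).const_mul κ))
  refine h4.congr' ?_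
  filter_upwards [hγc.eventually hf, self_mem_nhdsWithin] with s hs hs0
  have hs0' : s ≠ 0 := hs0
  rw [hs]
  simp only [Function.comp_apply]
  field_simp

theorem hasDerivAt_line_zero (c : ℝ × ℝ) : HasDerivAt (fun s : ℝ => s • c) c 0 := by
  simpa using (hasDerivAt_id (0 : ℝ)).smul_const c

/-- The quadratic part of a germ that is right equivalent to a quadratic normal form. -/
theorem quadratic_part_eq {f u L N M : ℝ × ℝ → ℝ} {κ ε ε' : ℝ}
    (hu : ContinuousAt u 0) (hL : DifferentiableAt ℝ L 0) (hN : DifferentiableAt ℝ N 0)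
    (hM : DifferentiableAt ℝ M 0) (hL0 : L 0 = 0) (hN0 : N 0 = 0) (hM0 : M 0 = 0)
    (hf : ∀ᶠ q in 𝓝 0, f q = u q * (L q * N q + κ * M q ^ 2))
    (hA : RightEquiv f (fun p => ε * (p.1 ^ 2 + ε' * p.2 ^ 2))) :
    ∃ A : ℝ × ℝ →L[ℝ] ℝ × ℝ, Function.Injective A ∧ ∀ c,
      u 0 * (fderiv ℝ L 0 c * fderiv ℝ N 0 c + κ * fderiv ℝ M 0 c ^ 2) =
        ε * ((A c).1 ^ 2 + ε' * (A c).2 ^ 2) := by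
  obtain ⟨h, hh, he⟩ := hA
  refine ⟨fderiv ℝ h 0, hh.injective_fderiv hh.mem_source, fun c => ?_⟩
  have hd := hh.smoothNear.differentiableAt
  have h1 : HasFDerivAt (fun q => (h q).1)
      ((ContinuousLinearMap.fst ℝ ℝ ℝ).comp (fderiv ℝ h 0)) 0 := hd.hasFDerivAt.fst
  have h2 : HasFDerivAt (fun q => (h q).2)
      ((ContinuousLinearMap.snd ℝ ℝ ℝ).comp (fderiv ℝ h 0)) 0 := hd.hasFDerivAt.snd
  -- The limit of `f(sc)/s²` is computed twice, from the product form and from the normal form.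
  have t1 := tendsto_comp_div_sq hu hL hN hM hL0 hN0 hM0 hf (hasDerivAt_line_zero c) (by simp)
  have t2 := tendsto_comp_div_sq (f := f) (u := fun _ => ε) (L := fun q => (h q).1)
    (N := fun q => (h q).1) (M := fun q => (h q).2) (κ := ε') continuousAt_const
    h1.differentiableAt h1.differentiableAt h2.differentiableAt (by simp [hh.map_zero])
    (by simp [hh.map_zero]) (by simp [hh.map_zero])
    (he.mono fun q hq => by rw [hq]; ring) (hasDerivAt_line_zero c) (by simp)
  have := tendsto_nhds_unique t1 t2
  rw [this, h1.fderiv, h2.fderiv]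
  simp [sq]

theorem exists_eq_of_injective {A : ℝ × ℝ →L[ℝ] ℝ × ℝ} (hA : Function.Injective A) (w : ℝ × ℝ) :
    ∃ v, A v = w :=
  (LinearMap.injective_iff_surjective (f := A.toLinearMap)).1 hA w

/-- A regular curve has a smooth parametrisation. -/
theorem exists_curve {f : ℝ × ℝ → ℝ} (hf : SmoothNear f 0) (h0 : f 0 = 0)
    (hd : fderiv ℝ f 0 ≠ 0) :
    ∃ γ : ℝ → ℝ × ℝ, SmoothNear γ 0 ∧ γ 0 = 0 ∧ deriv γ 0 ≠ 0 ∧ (∀ᶠ s in 𝓝 0, f (γ s) = 0) ∧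
      fderiv ℝ f 0 (deriv γ 0) = 0 := by
  set A := fderiv ℝ f 0 with hA
  -- `K` is `A` turned by a right angle, so `wedge A K = |A|²` and `(f, K)` are coordinates; the
  -- curve is the axis on which `f = 0`, parametrised by `K`.
  let K : ℝ × ℝ →L[ℝ] ℝ :=
    A (1, 0) • ContinuousLinearMap.snd ℝ ℝ ℝ - A (0, 1) • ContinuousLinearMap.fst ℝ ℝ ℝ
  have hW : wedge A K ≠ 0 := by
    have e : wedge A K = A (1, 0) ^ 2 + A (0, 1) ^ 2 := by
      simp [wedge, K]; ring
    rw [e]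
    intro h
    apply hd
    have h1 : A (1, 0) = 0 := by nlinarith [sq_nonneg (A (1, 0)), sq_nonneg (A (0, 1))]
    have h2 : A (0, 1) = 0 := by nlinarith [sq_nonneg (A (1, 0)), sq_nonneg (A (0, 1))]
    refine ContinuousLinearMap.ext fun v => ?_
    rw [planeForm_apply, h1, h2]
    simp
  have hK : SmoothNear (fun q => K q) 0 := K.contDiff.smoothNear
  obtain ⟨h, hh, he⟩ := exists_isDiffeoGerm_prodMk hf hK h0 (by simp) (fun c h1 h2 =>
    eq_zero_of_wedge_ne_zero hW h1 (by rwa [K.hasFDerivAt.fderiv] at h2))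
  have hsm : SmoothNear (fun s : ℝ => h.symm ((0 : ℝ), s)) 0 := by
    refine SmoothNear.comp (g := h.symm) (f := fun s : ℝ => ((0 : ℝ), s)) hh.symm.smoothNear ?_
    exact ContDiff.smoothNear (by fun_prop)
  have hz : h.symm ((0 : ℝ), (0 : ℝ)) = 0 := hh.symm.map_zero
  have hev : ∀ᶠ s : ℝ in 𝓝 0, h (h.symm (0, s)) = (0, s) := by
    have hc : Tendsto (fun s : ℝ => ((0 : ℝ), s)) (𝓝 0) (𝓝 0) := by
      have : Continuous fun s : ℝ => ((0 : ℝ), s) := by fun_prop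
      exact this.tendsto 0
    filter_upwards [hc.eventually (h.open_target.mem_nhds hh.symm.mem_source)] with s hs
    exact h.right_inv hs
  have hderiv := hsm.differentiableAt.hasDerivAt
  have hA' : HasFDerivAt f A (h.symm ((0 : ℝ), (0 : ℝ))) := by
    rw [hz]; exact hf.differentiableAt.hasFDerivAt
  have hK' : HasFDerivAt K K (h.symm ((0 : ℝ), (0 : ℝ))) := K.hasFDerivAt
  have d1 := hA'.comp_hasDerivAt (0 : ℝ) hderiv
  have d2 := hK'.comp_hasDerivAt (0 : ℝ) hderiv
  have e1 : (f ∘ fun s : ℝ => h.symm ((0 : ℝ), s)) =ᶠ[𝓝 0] fun _ => 0 := by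
    filter_upwards [hev] with s hs
    rw [he] at hs
    exact congrArg Prod.fst hs
  have e2 : (K ∘ fun s : ℝ => h.symm ((0 : ℝ), s)) =ᶠ[𝓝 0] fun s => s := by
    filter_upwards [hev] with s hs
    rw [he] at hs
    exact congrArg Prod.snd hs
  have k1 := (d1.congr_of_eventuallyEq e1.symm).unique (hasDerivAt_const 0 0)
  have k2 := (d2.congr_of_eventuallyEq e2.symm).unique (hasDerivAt_id 0)
  refine ⟨_, hsm, hz, fun h => ?_, e1, k1⟩
  rw [h] at k2
  simp at k2

theorem eq_zero_of_linearIndependent {v w : ℝ × ℝ} (h : LinearIndependent ℝ ![v, w])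
    {A : ℝ × ℝ →L[ℝ] ℝ} (hv : A v = 0) (hw : A w = 0) : A = 0 := by
  rw [LinearIndependent.pair_iff] at h
  have hdet : v.1 * w.2 - v.2 * w.1 ≠ 0 := by
    intro h0
    have h1 := h w.2 (-v.2) (by ext <;> simp <;> linarith)
    have h2 := h w.1 (-v.1) (by ext <;> simp <;> linarith)
    have h3 := h 0 1 (by ext <;> simp [h1.1, h2.1])
    exact one_ne_zero h3.2
  rw [planeForm_apply] at hv hw
  have h1 : (v.1 * w.2 - v.2 * w.1) * A (1, 0) = 0 := by
    linear_combination w.2 * hv - v.2 * hw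
  have h2 : (v.1 * w.2 - v.2 * w.1) * A (0, 1) = 0 := by
    linear_combination v.1 * hw - w.1 * hv
  refine ContinuousLinearMap.ext fun c => ?_
  rw [planeForm_apply, (mul_eq_zero.1 h1).resolve_left hdet, (mul_eq_zero.1 h2).resolve_left hdet]
  simp

theorem linearIndependent_of_forall {v w : ℝ × ℝ} (hv : v ≠ 0)
    (h : ∀ a : ℝ, a ≠ 0 → w = a • v → False) (hw : w ≠ 0) : LinearIndependent ℝ ![v, w] := by
  rw [LinearIndependent.pair_iff' hv]
  intro a ha
  refine h a ?_ ha.symm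
  rintro rfl
  simp at ha
  exact hw ha.symm

end

/-! ### Singularity types and tangents of branches in terms of the differentials -/

namespace IsNullTriple

variable {f g h L N M : ℝ × ℝ → ℝ}

theorem fderiv_h (T : IsNullTriple f g h L N M) :
    ∃ c : ℝ, c ≠ 0 ∧ fderiv ℝ h 0 = c • fderiv ℝ M 0 := by
  obtain ⟨u, hu, hu0, he⟩ := T.eq_h
  refine ⟨u 0, hu0, ?_⟩
  rw [Filter.EventuallyEq.fderiv_eq he]
  refine ContinuousLinearMap.ext fun c => ?_
  rw [hu.fderiv_mul_of_zero T.smoothM T.zeroM]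
  rfl

theorem branch_f (T : IsNullTriple f g h L N M) {γ : ℝ → ℝ × ℝ} (hγ : IsBranch f γ) :
    fderiv ℝ L 0 (deriv γ 0) * fderiv ℝ N 0 (deriv γ 0) = 0 := by
  obtain ⟨u, hu, hu0, he⟩ := T.eq_f
  have h1 := tendsto_comp_div_sq (f := f) (κ := 0) hu.contDiffAt.continuousAt T.smoothL.differentiableAt
    T.smoothN.differentiableAt T.smoothM.differentiableAt T.zeroL T.zeroN T.zeroM
    (he.mono fun q hq => by rw [hq]; ring) hγ.smooth.differentiableAt.hasDerivAt hγ.map_zero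
  have h2 : Tendsto (fun s => f (γ s) / s ^ 2) (𝓝[≠] 0) (𝓝 0) := by
    refine tendsto_const_nhds.congr' ?_
    filter_upwards [nhdsWithin_le_nhds hγ.mem] with s hs
    simp [hs]
  have h3 := tendsto_nhds_unique h1 h2
  simpa [hu0.ne'] using h3

theorem branch_g (T : IsNullTriple f g h L N M) {γ : ℝ → ℝ × ℝ} (hγ : IsBranch g γ) :
    fderiv ℝ L 0 (deriv γ 0) * fderiv ℝ N 0 (deriv γ 0) = fderiv ℝ M 0 (deriv γ 0) ^ 2 := by
  obtain ⟨u, hu, hu0, he⟩ := T.eq_g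
  have h1 := tendsto_comp_div_sq (f := g) (κ := -1) hu.contDiffAt.continuousAt T.smoothL.differentiableAt
    T.smoothN.differentiableAt T.smoothM.differentiableAt T.zeroL T.zeroN T.zeroM
    (he.mono fun q hq => by rw [hq]; ring) hγ.smooth.differentiableAt.hasDerivAt hγ.map_zero
  have h2 : Tendsto (fun s => g (γ s) / s ^ 2) (𝓝[≠] 0) (𝓝 0) := by
    refine tendsto_const_nhds.congr' ?_
    filter_upwards [nhdsWithin_le_nhds hγ.mem] with s hs
    simp [hs]
  have h3 := (mul_eq_zero.1 (tendsto_nhds_unique h1 h2)).resolve_left hu0.ne'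
  linarith

theorem branch_h (T : IsNullTriple f g h L N M) {γ : ℝ → ℝ × ℝ} (hγ : IsBranch h γ) :
    fderiv ℝ M 0 (deriv γ 0) = 0 := by
  obtain ⟨u, hu, hu0, he⟩ := T.eq_h
  have hγd := hγ.smooth.differentiableAt.hasDerivAt
  have h1 := tendsto_comp_div T.smoothM.differentiableAt T.zeroM hγd hγ.map_zero
  have h2 : Tendsto (fun s => M (γ s) / s) (𝓝[≠] 0) (𝓝 0) := by
    refine tendsto_const_nhds.congr' ?_
    have hγc : Tendsto γ (𝓝 0) (𝓝 0) := by
      have := hγd.continuousAt.tendsto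
      rwa [hγ.map_zero] at this
    filter_upwards [nhdsWithin_le_nhds hγ.mem, nhdsWithin_le_nhds (hγc.eventually he),
      nhdsWithin_le_nhds (hγc.eventually (hu.contDiffAt.continuousAt.eventually_ne hu0))]
      with s hs hs' hs''
    rw [hs, eq_comm, mul_eq_zero, or_iff_right hs''] at hs'
    simp [hs']
  exact tendsto_nhds_unique h1 h2

/-- Polarisation: `LN = ((L + N)/2)² - ((L - N)/2)²`, with the square root of the unit absorbed in
the coordinates. -/
theorem hasA1Minus_f (T : IsNullTriple f g h L N M)
    (hp : wedge (fderiv ℝ L 0) (fderiv ℝ N 0) ≠ 0) : HasA1Minus f := by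
  obtain ⟨u, hu, hu0, he⟩ := T.eq_f
  have hs := hu.sqrt hu0.ne'
  have hs0 := Real.sqrt_pos.2 hu0
  have hhalf : SmoothNear (fun _ : ℝ × ℝ => (1 / 2 : ℝ)) 0 := smoothNear_const _
  have ha := (hs.mul hhalf).mul (T.smoothL.add T.smoothN)
  have hb := (hs.mul hhalf).mul (T.smoothL.sub T.smoothN)
  have dL := T.smoothL.differentiableAt
  have dN := T.smoothN.differentiableAt
  obtain ⟨φ, hφ, hφe⟩ := exists_isDiffeoGerm_prodMk ha hb (by simp [T.zeroL, T.zeroN])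
    (by simp [T.zeroL, T.zeroN]) (fun c h1 h2 => by
      rw [(hs.mul hhalf).fderiv_mul_of_zero (T.smoothL.add T.smoothN) (by simp [T.zeroL, T.zeroN]),
        fderiv_fun_add dL dN, mul_eq_zero, or_iff_right (by positivity)] at h1
      rw [(hs.mul hhalf).fderiv_mul_of_zero (T.smoothL.sub T.smoothN) (by simp [T.zeroL, T.zeroN]),
        fderiv_fun_sub dL dN, mul_eq_zero, or_iff_right (by positivity)] at h2
      rw [add_apply] at h1
      rw [sub_apply] at h2
      exact eq_zero_of_wedge_ne_zero hp (by linarith) (by linarith))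
  refine ⟨φ, hφ, ?_⟩
  filter_upwards [he, hu.contDiffAt.continuousAt.eventually (lt_mem_nhds hu0)] with q hq hq0
  rw [hφe, hq]
  have := Real.sq_sqrt hq0.le
  simp only
  linear_combination (-(L q * N q)) * this

/-- Hadamard's lemma in the coordinates `(L, N)`. The coefficients are germs; their values at the
origin are the coefficients of `dM` with respect to `dL` and `dN`. -/
theorem exists_eq_add (T : IsNullTriple f g h L N M)
    (hp : wedge (fderiv ℝ L 0) (fderiv ℝ N 0) ≠ 0) :
    ∃ p₁ p₂ : ℝ × ℝ → ℝ, SmoothNear p₁ 0 ∧ SmoothNear p₂ 0 ∧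
      (∀ᶠ q in 𝓝 0, M q = p₁ q * L q + p₂ q * N q) ∧
      ∀ c, fderiv ℝ M 0 c = p₁ 0 * fderiv ℝ L 0 c + p₂ 0 * fderiv ℝ N 0 c := by
  obtain ⟨φ, hφ, hφe⟩ := exists_isDiffeoGerm_prodMk T.smoothL T.smoothN T.zeroL T.zeroN
    (fun c h1 h2 => eq_zero_of_wedge_ne_zero hp h1 h2)
  have hM' : SmoothNear (fun y => M (φ.symm y)) 0 := by
    refine SmoothNear.comp (g := M) ?_ hφ.symm.smoothNear
    rw [hφ.symm.map_zero]
    exact T.smoothM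
  obtain ⟨g₁, g₂, hg₁, hg₂, hg, -, -⟩ := hM'.hadamard (by simp [hφ.symm.map_zero, T.zeroM])
  have hp1 : SmoothNear (fun q => g₁ (φ q)) 0 :=
    SmoothNear.comp (g := g₁) (by rw [hφ.map_zero]; exact hg₁) hφ.smoothNear
  have hp2 : SmoothNear (fun q => g₂ (φ q)) 0 :=
    SmoothNear.comp (g := g₂) (by rw [hφ.map_zero]; exact hg₂) hφ.smoothNear
  have hev : ∀ᶠ q in 𝓝 0, M q = g₁ (φ q) * L q + g₂ (φ q) * N q := by
    filter_upwards [hφ.tendsto.eventually hg, φ.open_source.mem_nhds hφ.mem_source] with q hq hs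
    rw [φ.left_inv hs] at hq
    rw [hq, hφe]
  refine ⟨_, _, hp1, hp2, hev, fun c => ?_⟩
  rw [Filter.EventuallyEq.fderiv_eq hev, fderiv_fun_add (hp1.mul T.smoothL).differentiableAt
    (hp2.mul T.smoothN).differentiableAt, add_apply, hp1.fderiv_mul_of_zero T.smoothL T.zeroL,
    hp2.fderiv_mul_of_zero T.smoothN T.zeroN]

/-- Completing the square with `M = p₁L + p₂N` gives `LN - M² = (1 - 4p₁p₂)/(4p₁²) · N² - (p₁L -
kN)²` with `k = (1 - 2p₁p₂)/(2p₁)`. The discriminant condition says `1 - 4p₁p₂ ≠ 0` at the origin,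
and its sign decides between the two types. -/
theorem hasA1_g (T : IsNullTriple f g h L N M)
    (hp : GeneralPosition (fderiv ℝ L 0) (fderiv ℝ N 0) (fderiv ℝ M 0)) :
    HasA1Plus g ∨ HasA1Minus g := by
  obtain ⟨u, hu, hu0, he⟩ := T.eq_g
  obtain ⟨p₁, p₂, hp₁, hp₂, hM, hMd⟩ := T.exists_eq_add hp.ln
  set l := fderiv ℝ L 0
  set n := fderiv ℝ N 0
  set m := fderiv ℝ M 0
  have w1 : wedge m n = p₁ 0 * wedge l n := by
    unfold wedge; rw [hMd, hMd]; ring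
  have w2 : wedge l m = p₂ 0 * wedge l n := by
    unfold wedge; rw [hMd, hMd]; ring
  have hp10 : p₁ 0 ≠ 0 := by
    intro h0; apply hp.mn; rw [w1, h0, zero_mul]
  have hκ : 1 - 4 * (p₁ 0 * p₂ 0) ≠ 0 := by
    intro h0
    apply hp.disc
    rw [w1, w2]
    linear_combination (wedge l n ^ 2) * h0
  have hs := hu.sqrt hu0.ne'
  have hs0 := Real.sqrt_pos.2 hu0
  have c1 : ∀ c : ℝ, SmoothNear (fun _ : ℝ × ℝ => c) 0 := fun c => smoothNear_const c
  have hκs : SmoothNear (fun q => 1 - 4 * (p₁ q * p₂ q)) 0 :=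
    (c1 1).sub ((c1 4).mul (hp₁.mul hp₂))
  have h2p : SmoothNear (fun q => 2 * p₁ q) 0 := (c1 2).mul hp₁
  have hk : SmoothNear (fun q => (1 - 2 * (p₁ q * p₂ q)) / (2 * p₁ q)) 0 :=
    ((c1 1).sub ((c1 2).mul (hp₁.mul hp₂))).div h2p (by simpa using hp10)
  have hasub := (hp₁.mul T.smoothL).sub (hk.mul T.smoothN)
  have ha := hs.mul hasub
  have da : ∀ c, fderiv ℝ (fun q => √(u q) * (p₁ q * L q -
      (1 - 2 * (p₁ q * p₂ q)) / (2 * p₁ q) * N q)) 0 c =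
      √(u 0) * (p₁ 0 * l c - (1 - 2 * (p₁ 0 * p₂ 0)) / (2 * p₁ 0) * n c) := by
    intro c
    rw [hs.fderiv_mul_of_zero hasub (by simp [T.zeroL, T.zeroN]),
      fderiv_fun_sub (hp₁.mul T.smoothL).differentiableAt (hk.mul T.smoothN).differentiableAt,
      sub_apply, hp₁.fderiv_mul_of_zero T.smoothL T.zeroL,
      hk.fderiv_mul_of_zero T.smoothN T.zeroN]
  -- `ε` is the sign of `1 - 4p₁p₂` at the origin, which makes the square root real.
  have finish : ∀ ε : ℝ, ε ^ 2 = 1 → 0 < ε * (1 - 4 * (p₁ 0 * p₂ 0)) →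
      ∃ φ : OpenPartialHomeomorph (ℝ × ℝ) (ℝ × ℝ), IsDiffeoGerm φ ∧
        ∀ᶠ q in 𝓝 0, g q = ε * (φ q).1 ^ 2 - (φ q).2 ^ 2 := by
    intro ε hε hpos
    have hr := ((c1 ε).mul hκs).sqrt hpos.ne'
    have hb := (hs.mul (hr.div h2p (by simpa using hp10))).mul T.smoothN
    have hr0 := Real.sqrt_pos.2 hpos
    obtain ⟨φ, hφ, hφe⟩ := exists_isDiffeoGerm_prodMk hb ha (by simp [T.zeroN])
      (by simp [T.zeroL, T.zeroN]) (fun c h1 h2 => by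
        rw [(hs.mul (hr.div h2p (by simpa using hp10))).fderiv_mul_of_zero T.smoothN T.zeroN,
          mul_eq_zero, or_iff_right (by positivity)] at h1
        rw [da, h1, mul_zero, sub_zero] at h2
        have h3 : l c = 0 := by
          have := (mul_eq_zero.1 h2).resolve_left hs0.ne'
          exact (mul_eq_zero.1 this).resolve_left hp10
        exact eq_zero_of_wedge_ne_zero hp.ln h3 h1)
    refine ⟨φ, hφ, ?_⟩
    have hcont : ContinuousAt (fun q => ε * (1 - 4 * (p₁ q * p₂ q))) 0 :=
      ((c1 ε).mul hκs).contDiffAt.continuousAt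
    filter_upwards [he, hM, hu.contDiffAt.continuousAt.eventually (lt_mem_nhds hu0),
      hcont.eventually (lt_mem_nhds hpos), hp₁.contDiffAt.continuousAt.eventually_ne hp10]
      with q hq hMq hq0 hqp hq1
    rw [hφe, hq, hMq]
    have k1 := Real.sq_sqrt hq0.le
    have k2 := Real.sq_sqrt hqp.le
    simp only
    simp only [mul_pow √(u q), mul_pow _ (N q), div_pow, k1, k2]
    field_simp
    linear_combination (-(N q ^ 2 * (1 - 4 * p₁ q * p₂ q))) * hε
  rcases lt_or_gt_of_ne hκ with hneg | hpos
  · left; right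
    obtain ⟨φ, hφ, hφe⟩ := finish (-1) (by norm_num) (by linarith)
    exact ⟨φ, hφ, hφe.mono fun q hq => by rw [hq]; ring⟩
  · right
    obtain ⟨φ, hφ, hφe⟩ := finish 1 (by norm_num) (by linarith)
    exact ⟨φ, hφ, hφe.mono fun q hq => by rw [hq]; ring⟩

/-- Branches need not be determined: the tangent vector of a branch satisfies the equation of the
tangent cone. A tangent common to two of the curves would satisfy both `l n = 0` and `m = 0`. -/
theorem nondegenerate_of_generalPosition (T : IsNullTriple f g h L N M)
    (hp : GeneralPosition (fderiv ℝ L 0) (fderiv ℝ N 0) (fderiv ℝ M 0)) :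
    HasA1Minus f ∧ (HasA1Plus g ∨ HasA1Minus g) ∧ IsRegularCurve h ∧ BranchesTransverse f g ∧
      BranchesTransverse f h ∧ BranchesTransverse g h := by
  refine ⟨T.hasA1Minus_f hp.ln, T.hasA1_g hp, ⟨?_, ?_⟩, ?_, ?_, ?_⟩
  · obtain ⟨u, -, -, he⟩ := T.eq_h
    rw [he.self_of_nhds, T.zeroM, mul_zero]
  · obtain ⟨c, hc, he⟩ := T.fderiv_h
    rw [he]
    intro h0
    rw [smul_eq_zero, or_iff_right hc] at h0
    apply hp.mn
    rw [h0]
    simp [wedge]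
  · intro γ η hγ hη
    refine linearIndependent_of_forall hγ.regular (fun a ha hw => hγ.regular ?_) hη.regular
    have h1 := T.branch_f hγ
    have h2 := T.branch_g hη
    rw [hw, map_smul, map_smul, map_smul, smul_eq_mul, smul_eq_mul, smul_eq_mul] at h2
    refine hp.eq_zero h1 ?_
    have h3 : (a * fderiv ℝ M 0 (deriv γ 0)) ^ 2 = 0 := by
      rw [← h2]; linear_combination a ^ 2 * h1
    simpa [ha] using h3
  · intro γ η hγ hη
    refine linearIndependent_of_forall hγ.regular (fun a ha hw => hγ.regular ?_) hη.regular
    have h2 := T.branch_h hη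
    rw [hw, map_smul, smul_eq_mul, mul_eq_zero, or_iff_right ha] at h2
    exact hp.eq_zero (T.branch_f hγ) h2
  · intro γ η hγ hη
    refine linearIndependent_of_forall hγ.regular (fun a ha hw => hγ.regular ?_) hη.regular
    have h2 := T.branch_h hη
    rw [hw, map_smul, smul_eq_mul, mul_eq_zero, or_iff_right ha] at h2
    refine hp.eq_zero ?_ h2
    rw [T.branch_g hγ, h2]
    ring

/-- If `l`, `n` were proportional, `l n` would be semidefinite, against the type `A₁⁻`.
Transversality, tested on the curves `L = 0`, `N = 0` and `M = 0`, separates `m` from `l` and `n`.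
If the discriminant vanished, `l n - m²` would be minus a square, against both types allowed for the
`PC`. The remaining transversality conditions are not needed. -/
theorem generalPosition_of_nondegenerate (T : IsNullTriple f g h L N M)
    (hf : HasA1Minus f) (hg : HasA1Plus g ∨ HasA1Minus g) (hh : IsRegularCurve h)
    (hfh : BranchesTransverse f h) :
    GeneralPosition (fderiv ℝ L 0) (fderiv ℝ N 0) (fderiv ℝ M 0) := by
  have dL := T.smoothL.differentiableAt
  have dN := T.smoothN.differentiableAt
  have dM := T.smoothM.differentiableAt
  have hln : wedge (fderiv ℝ L 0) (fderiv ℝ N 0) ≠ 0 := by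
    intro h0
    obtain ⟨u, hu, hu0, he⟩ := T.eq_f
    have hf' : RightEquiv f (fun p => 1 * (p.1 ^ 2 + (-1) * p.2 ^ 2)) := by
      obtain ⟨φ, hφ, hφe⟩ := hf
      exact ⟨φ, hφ, hφe.mono fun q hq => by rw [hq]; ring⟩
    obtain ⟨A, hA, hq⟩ := quadratic_part_eq (κ := 0) hu.contDiffAt.continuousAt dL dN dM T.zeroL
      T.zeroN T.zeroM (he.mono fun q hq => by rw [hq]; ring) hf'
    obtain ⟨v, hv⟩ := exists_eq_of_injective hA (1, 0)
    obtain ⟨w, hw⟩ := exists_eq_of_injective hA (0, 1)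
    have hqv : u 0 * (fderiv ℝ L 0 v * fderiv ℝ N 0 v) = 1 := by
      have := hq v
      rw [hv] at this
      simpa using this
    have hqw : u 0 * (fderiv ℝ L 0 w * fderiv ℝ N 0 w) = -1 := by
      have := hq w
      rw [hw] at this
      simpa using this
    have hc := mul_comm_of_wedge_eq_zero h0 v w
    -- For proportional forms the product of the values at `v` and at `w` is a square; here the two
    -- values are `1` and `-1`.
    have hsq : (u 0 * (fderiv ℝ L 0 v * fderiv ℝ N 0 w)) ^ 2 =
        (u 0 * (fderiv ℝ L 0 v * fderiv ℝ N 0 v)) *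
          (u 0 * (fderiv ℝ L 0 w * fderiv ℝ N 0 w)) := by
      linear_combination (u 0 ^ 2 * (fderiv ℝ L 0 v * fderiv ℝ N 0 w)) * hc
    rw [hqv, hqw] at hsq
    linarith [sq_nonneg (u 0 * (fderiv ℝ L 0 v * fderiv ℝ N 0 w))]
  have hm0 : fderiv ℝ M 0 ≠ 0 := by
    obtain ⟨c, hc, he⟩ := T.fderiv_h
    intro h0
    apply hh.2
    rw [he, h0, smul_zero]
  have hl0 : fderiv ℝ L 0 ≠ 0 := by
    intro h0; apply hln; rw [h0]; simp [wedge]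
  have hn0 : fderiv ℝ N 0 ≠ 0 := by
    intro h0; apply hln; rw [h0]; simp [wedge]
  obtain ⟨η, hη1, hη2, hη3, hη4, hη5⟩ := exists_curve T.smoothM T.zeroM hm0
  have hη : IsBranch h η := by
    refine ⟨hη1, hη2, hη3, ?_⟩
    obtain ⟨u, -, -, he⟩ := T.eq_h
    have hc : Tendsto η (𝓝 0) (𝓝 0) := by
      have := hη1.contDiffAt.continuousAt.tendsto
      rwa [hη2] at this
    filter_upwards [hη4, hc.eventually he] with s hs hs'
    rw [hs', hs, mul_zero]
  have aux : ∀ K : ℝ × ℝ → ℝ, SmoothNear K 0 → K 0 = 0 → fderiv ℝ K 0 ≠ 0 →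
      (∀ᶠ q in 𝓝 0, K q = 0 → f q = 0) → wedge (fderiv ℝ M 0) (fderiv ℝ K 0) ≠ 0 := by
    intro K hK hK0 hKd hKf h0
    obtain ⟨γ, hγ1, hγ2, hγ3, hγ4, hγ5⟩ := exists_curve hK hK0 hKd
    have hγ : IsBranch f γ := by
      refine ⟨hγ1, hγ2, hγ3, ?_⟩
      have hc : Tendsto γ (𝓝 0) (𝓝 0) := by
        have := hγ1.contDiffAt.continuousAt.tendsto
        rwa [hγ2] at this
      filter_upwards [hγ4, hc.eventually hKf] with s hs hs'
      exact hs' hs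
    have hli := hfh γ η hγ hη
    refine hm0 (eq_zero_of_linearIndependent hli ?_ hη5)
    by_contra hne
    apply hKd
    refine ContinuousLinearMap.ext fun w => ?_
    have := mul_comm_of_wedge_eq_zero h0 (deriv γ 0) w
    rw [hγ5, mul_zero, mul_eq_zero, or_iff_right hne] at this
    exact this
  have hmn := aux N T.smoothN T.zeroN hn0 (by
    obtain ⟨u, -, -, he⟩ := T.eq_f
    filter_upwards [he] with q hq h0
    rw [hq, h0]; ring)
  have hml := aux L T.smoothL T.zeroL hl0 (by
    obtain ⟨u, -, -, he⟩ := T.eq_f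
    filter_upwards [he] with q hq h0
    rw [hq, h0]; ring)
  refine ⟨hln, hmn, ?_, fun hdisc => ?_⟩
  · intro h0
    apply hml
    unfold wedge at h0 ⊢
    linarith
  · obtain ⟨u, hu, hu0, he⟩ := T.eq_g
    set l := fderiv ℝ L 0
    set n := fderiv ℝ N 0
    set m := fderiv ℝ M 0
    -- With zero discriminant, `LN - M²` has a quadratic part of rank at most one and never
    -- positive.
    have hform : ∀ c, wedge l n ^ 2 * (l c * n c - m c ^ 2) =
        -(wedge m n * l c - wedge l m * n c) ^ 2 := by
      intro c
      have := wedge_mul_apply l n m c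
      linear_combination (-(wedge l n * m c) - (wedge m n * l c + wedge l m * n c)) * this +
        (l c * n c) * hdisc
    have hW : 0 < wedge l n ^ 2 := by positivity
    rcases hg with hg | hg
    · obtain ⟨ε, hε, hg'⟩ : ∃ ε : ℝ, ε ≠ 0 ∧
          RightEquiv g (fun p => ε * (p.1 ^ 2 + 1 * p.2 ^ 2)) := by
        rcases hg with ⟨φ, hφ, hφe⟩ | ⟨φ, hφ, hφe⟩
        · exact ⟨1, one_ne_zero, φ, hφ, hφe.mono fun q hq => by rw [hq]; ring⟩
        · exact ⟨-1, by norm_num, φ, hφ, hφe.mono fun q hq => by rw [hq]; ring⟩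
      obtain ⟨A, hA, hq⟩ := quadratic_part_eq (κ := -1) hu.contDiffAt.continuousAt dL dN dM T.zeroL
        T.zeroN T.zeroM (he.mono fun q hq => by rw [hq]; ring) hg'
      set ℓ : ℝ × ℝ →L[ℝ] ℝ := wedge m n • l - wedge l m • n
      have hℓ : ∀ c, ℓ c = wedge m n * l c - wedge l m * n c := fun c => rfl
      obtain ⟨c, hc0, hc⟩ : ∃ c : ℝ × ℝ, c ≠ 0 ∧ ℓ c = 0 := by
        by_cases h1 : ℓ (1, 0) = 0
        · exact ⟨(1, 0), by simp, h1⟩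
        · refine ⟨(ℓ (0, 1), -ℓ (1, 0)), fun h => h1 ?_, ?_⟩
          · simpa using congrArg Prod.snd h
          · rw [planeForm_apply]; ring
      have h1 := hform c
      rw [← hℓ, hc] at h1
      have h2 : l c * n c - m c ^ 2 = 0 := by
        have : wedge l n ^ 2 * (l c * n c - m c ^ 2) = 0 := by rw [h1]; ring
        exact (mul_eq_zero.1 this).resolve_left hW.ne'
      have h3 := hq c
      rw [show l c * n c + -1 * m c ^ 2 = 0 by linarith, mul_zero, eq_comm, mul_eq_zero,
        or_iff_right hε] at h3
      apply hc0
      apply hA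
      rw [map_zero]
      ext
      · simp only [Prod.fst_zero]; nlinarith [sq_nonneg (A c).1, sq_nonneg (A c).2]
      · simp only [Prod.snd_zero]; nlinarith [sq_nonneg (A c).1, sq_nonneg (A c).2]
    · have hg' : RightEquiv g (fun p => 1 * (p.1 ^ 2 + (-1) * p.2 ^ 2)) := by
        obtain ⟨φ, hφ, hφe⟩ := hg
        exact ⟨φ, hφ, hφe.mono fun q hq => by rw [hq]; ring⟩
      obtain ⟨A, hA, hq⟩ := quadratic_part_eq (κ := -1) hu.contDiffAt.continuousAt dL dN dM T.zeroL
        T.zeroN T.zeroM (he.mono fun q hq => by rw [hq]; ring) hg'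
      obtain ⟨v, hv⟩ := exists_eq_of_injective hA (1, 0)
      have h1 := hq v
      rw [hv] at h1
      norm_num at h1
      have h2 := hform v
      have h3 : u 0 * (wedge l n ^ 2 * (l v * n v - m v ^ 2)) = wedge l n ^ 2 := by
        linear_combination wedge l n ^ 2 * h1
      rw [h2] at h3
      nlinarith [sq_nonneg (wedge m n * l v - wedge l m * n v)]

end IsNullTriple

/-! ### The lightlike decomposition at a flat timelike umbilic point -/

namespace Minkowski

section Congr

variable {V : Type*} [NormedAddCommGroup V] [NormedSpace ℝ V]

theorem dir_congr {W : Type*} [NormedAddCommGroup W] [NormedSpace ℝ W] {X Y : V → W} {p : V}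
    (h : X =ᶠ[𝓝 p] Y) (a : V) : dir a X =ᶠ[𝓝 p] dir a Y := by
  filter_upwards [h.eventuallyEq_nhds] with q hq
  simp only [dir, hq.fderiv_eq]

theorem frame_congr {X Y : V → Fin 3 → ℝ} {p : V} (h : X =ᶠ[𝓝 p] Y) (e : V × V) :
    frameE e X p = frameE e Y p ∧ frameF e X p = frameF e Y p ∧ frameG e X p = frameG e Y p ∧
      ∀ a b, frameSnd e X p a b = frameSnd e Y p a b := by
  have h1 := fun a => (dir_congr h a).self_of_nhds
  have h2 := fun a b => (dir_congr (dir_congr h a) b).self_of_nhds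
  simp only [frameE, frameF, frameG, frameSnd, h1, h2, implies_true, and_self]

theorem curves_congr {x y : ℝ × ℝ → Fin 3 → ℝ} {q : ℝ × ℝ} (h : x =ᶠ[𝓝 q] y) :
    lplFun x q = lplFun y q ∧ pcFun x q = pcFun y q ∧ mcncFun x q = mcncFun y q := by
  obtain ⟨h1, h2, h3, h4⟩ := frame_congr h planeFrame
  rw [lplFun_eq, lplFun_eq, pcFun_eq, pcFun_eq, mcncFun_eq, mcncFun_eq]
  simp only [frameLpl, framePc, frameMcnc, h1, h2, h3, h4, and_self]

end Congr

/-- Conditions at a flat timelike umbilic point, for a frame and a choice of sign such that the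
lightlike vectors `(R, -E)` and `(-G, R)` are independent. -/
structure IsFlatFrame {V : Type*} [NormedAddCommGroup V] [NormedSpace ℝ V] (e : V × V) (σ : ℝ)
    (X : V → Fin 3 → ℝ) (p : V) : Prop where
  smooth : SmoothNear X p
  sign : σ ^ 2 = 1
  delta_pos : 0 < frameDelta e X p
  snd : SndVanishes e X p
  R_ne : frameR e σ X p ≠ 0

/-- Giving `σ` the sign of `F` prevents cancellation in `R = F + σ√δ`. -/
theorem exists_isFlatFrame {V : Type*} [NormedAddCommGroup V] [NormedSpace ℝ V] {e : V × V}
    {X : V → Fin 3 → ℝ} {p : V} (hX : SmoothNear X p) (hδ : 0 < frameDelta e X p)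
    (h0 : SndVanishes e X p) : ∃ σ, IsFlatFrame e σ X p := by
  have hs := Real.sqrt_pos.2 hδ
  rcases le_total 0 (frameF e X p) with h | h
  · refine ⟨1, hX, by norm_num, hδ, h0, ?_⟩
    unfold frameR
    linarith
  · refine ⟨-1, hX, by norm_num, hδ, h0, ?_⟩
    unfold frameR
    linarith

namespace IsFlatFrame

variable {V : Type*} [NormedAddCommGroup V] [NormedSpace ℝ V] {e : V × V} {σ : ℝ}
  {X : V → Fin 3 → ℝ} {p : V}

theorem eventually (H : IsFlatFrame e σ X p) : ∀ᶠ q in 𝓝 p, 0 < frameDelta e X q ∧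
    frameR e σ X q ≠ 0 ∧
    frameR e σ X q ^ 2 * frameLpl e X q = nullL e σ X q * nullN e σ X q ∧
    4 * frameDelta e X q * frameR e σ X q ^ 2 * framePc e X q =
      nullL e σ X q * nullN e σ X q - nullM e σ X q ^ 2 := by
  filter_upwards [(smoothNear_frameDelta H.smooth).contDiffAt.continuousAt.eventually
    (lt_mem_nhds H.delta_pos),
    (smoothNear_frameR H.smooth H.delta_pos).contDiffAt.continuousAt.eventually_ne H.R_ne]
    with q h1 h2
  exact ⟨h1, h2, sq_mul_frameLpl H.sign h1.le, four_mul_framePc H.sign h1.le⟩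

theorem eventually_zero_iff (H : IsFlatFrame e σ X p) : ∀ᶠ q in 𝓝 p,
    (frameLpl e X q = 0 ↔ nullL e σ X q = 0 ∨ nullN e σ X q = 0) ∧
    (framePc e X q = 0 ↔ nullL e σ X q * nullN e σ X q - nullM e σ X q ^ 2 = 0) ∧
    (frameMcnc e X q = 0 ↔ nullM e σ X q = 0) := by
  filter_upwards [H.eventually] with q ⟨h1, h2, h3, h4⟩
  refine ⟨?_, ?_, ?_⟩
  · rw [← mul_eq_zero, ← h3]
    simp [h2]
  · rw [← h4]
    simp [h2, h1.ne']
  · simp [nullM, h2]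

theorem isNullTriple {x : ℝ × ℝ → Fin 3 → ℝ} (H : IsFlatFrame planeFrame σ x 0) :
    IsNullTriple (lplFun x) (pcFun x) (mcncFun x) (nullL planeFrame σ x) (nullN planeFrame σ x)
      (nullM planeFrame σ x) := by
  have hR := smoothNear_frameR (σ := σ) H.smooth H.delta_pos
  have hδ := smoothNear_frameDelta (e := planeFrame) H.smooth
  have one : SmoothNear (fun _ : ℝ × ℝ => (1 : ℝ)) 0 := smoothNear_const 1
  have four : SmoothNear (fun _ : ℝ × ℝ => (4 : ℝ)) 0 := smoothNear_const 4
  have hR0 := H.R_ne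
  have hδ0 := H.delta_pos
  refine ⟨smoothNear_nullL H.smooth H.delta_pos, smoothNear_nullN H.smooth H.delta_pos,
    smoothNear_nullM H.smooth H.delta_pos, H.snd.nullL, H.snd.nullN, H.snd.nullM,
    ⟨_, one.div (hR.pow 2) (pow_ne_zero 2 hR0), by positivity, ?_⟩,
    ⟨_, one.div ((four.mul hδ).mul (hR.pow 2)) (by positivity), by positivity, ?_⟩,
    ⟨_, one.div hR hR0, by positivity, ?_⟩⟩
  · filter_upwards [H.eventually] with q ⟨h1, h2, h3, h4⟩
    rw [lplFun_eq, ← h3]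
    field_simp
  · filter_upwards [H.eventually] with q ⟨h1, h2, h3, h4⟩
    rw [pcFun_eq, ← h4]
    field_simp
  · filter_upwards [H.eventually] with q ⟨h1, h2, h3, h4⟩
    rw [mcncFun_eq, nullM]
    field_simp

theorem isNondegenerate_iff {x : ℝ × ℝ → Fin 3 → ℝ} (H : IsFlatFrame planeFrame σ x 0) :
    IsNondegenerate x ↔ GeneralPosition (fderiv ℝ (nullL planeFrame σ x) 0)
      (fderiv ℝ (nullN planeFrame σ x) 0) (fderiv ℝ (nullM planeFrame σ x) 0) := by
  constructor
  · intro h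
    exact H.isNullTriple.generalPosition_of_nondegenerate h.lpl h.pc h.mcnc h.lpl_mcnc
  · intro h
    obtain ⟨h1, h2, h3, h4, h5, h6⟩ := H.isNullTriple.nondegenerate_of_generalPosition h
    exact ⟨h1, h2, h3, h4, h5, h6⟩

end IsFlatFrame

end Minkowski

/-! ### The position of the three curves and the three configurations -/

/-- The product of the coefficients of `m` with respect to `l` and `n`. -/
def crossRatio (l n m : ℝ × ℝ →L[ℝ] ℝ) : ℝ := wedge m n * wedge l m / wedge l n ^ 2

/-- The values of `crossRatio` that give the configuration. -/
def Configuration.range : Configuration → Set ℝ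
  | isolated => Set.Ioi (1 / 4)
  | separated => Set.Ioo 0 (1 / 4)
  | between => Set.Iio 0

theorem Configuration.isOpen_range (k : Configuration) : IsOpen k.range := by
  cases k
  · exact isOpen_Ioi
  · exact isOpen_Ioo
  · exact isOpen_Iio

/-- Independence of `m` from `l` and `n` excludes the value 0, and the discriminant excludes `1/4`.
-/
theorem GeneralPosition.exists_mem_range {l n m : ℝ × ℝ →L[ℝ] ℝ} (h : GeneralPosition l n m) :
    ∃ k : Configuration, crossRatio l n m ∈ k.range := by
  have h1 : crossRatio l n m ≠ 0 := by
    have := h.ln; have := h.mn; have := h.lm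
    unfold crossRatio
    positivity
  have h2 : crossRatio l n m ≠ 1 / 4 := by
    intro h0
    apply h.disc
    have := h.ln
    unfold crossRatio at h0
    field_simp at h0
    linarith
  rcases lt_or_gt_of_ne h1 with h3 | h3
  · exact ⟨.between, h3⟩
  · rcases lt_or_gt_of_ne h2 with h4 | h4
    · exact ⟨.separated, h3, h4⟩
    · exact ⟨.isolated, h4⟩

theorem generalPosition_of_mem_range {l n m : ℝ × ℝ →L[ℝ] ℝ} (hln : wedge l n ≠ 0)
    {k : Configuration} (h : crossRatio l n m ∈ k.range) : GeneralPosition l n m := by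
  have h1 : crossRatio l n m ≠ 0 ∧ crossRatio l n m ≠ 1 / 4 := by
    cases k
    · have h' : 1 / 4 < crossRatio l n m := h
      exact ⟨by linarith, h'.ne'⟩
    · have h' : 0 < crossRatio l n m ∧ crossRatio l n m < 1 / 4 := h
      exact ⟨h'.1.ne', h'.2.ne⟩
    · have h' : crossRatio l n m < 0 := h
      exact ⟨h'.ne, by linarith⟩
  refine ⟨hln, ?_, ?_, ?_⟩
  · intro h0; apply h1.1; simp [crossRatio, h0]
  · intro h0; apply h1.1; simp [crossRatio, h0]
  · intro h0
    apply h1.2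
    unfold crossRatio
    field_simp
    linarith

/-- Rescaling `P` normalises `s` to the sign of `r`, with `κ = √|r|`. The excluded slopes are then 0
and, for `s = 1`, also `±2`; since `κ⁻¹ < 2` means `r > 1/4`, the range of `r` determines the
interval containing `κ⁻¹`. The model slope, a solution of `coeff · μ² = s`, is 1, `√8` or 1 and lies
in the same interval. -/
theorem Configuration.exists_arrangement {k : Configuration} {r : ℝ} (hr : r ∈ k.range) :
    ∃ (s κ μ : ℝ) (I : Set ℝ), 0 < κ ∧ r = s * κ ^ 2 ∧ IsPreconnected I ∧
      (∀ ν ∈ I, ν ≠ 0 ∧ ν ^ 2 ≠ 4 * s) ∧ κ⁻¹ ∈ I ∧ μ ∈ I ∧ k.coeff * μ ^ 2 = s := by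
  cases k
  · have hr' : 1 / 4 < r := hr
    have hr0 : 0 < r := by linarith
    have hκ := Real.sqrt_pos.2 hr0
    have hκ2 : 1 / 2 < √r := Real.lt_sqrt_of_sq_lt (by norm_num; linarith)
    refine ⟨1, √r, 1, Set.Ioo 0 2, hκ, by rw [Real.sq_sqrt hr0.le]; ring, isPreconnected_Ioo,
      fun ν hν => ⟨hν.1.ne', ?_⟩, ⟨by positivity, ?_⟩, by norm_num, by norm_num [coeff]⟩
    · nlinarith [hν.1, hν.2]
    · rw [inv_lt_comm₀ hκ two_pos]; linarith
  · have hr' : 0 < r ∧ r < 1 / 4 := hr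
    have hκ := Real.sqrt_pos.2 hr'.1
    have hκ2 : √r < 1 / 2 := by
      rw [Real.sqrt_lt' (by norm_num)]; norm_num; linarith [hr'.2]
    refine ⟨1, √r, √8, Set.Ioi 2, hκ, by rw [Real.sq_sqrt hr'.1.le]; ring, isPreconnected_Ioi,
      fun ν hν => ?_, ?_, ?_, ?_⟩
    · have hν' : 2 < ν := hν
      exact ⟨by linarith, by nlinarith⟩
    · rw [Set.mem_Ioi, lt_inv_comm₀ two_pos hκ]; linarith
    · exact Real.lt_sqrt_of_sq_lt (by norm_num)
    · rw [Real.sq_sqrt (by norm_num)]; norm_num [coeff]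
  · have hr' : r < 0 := hr
    have hr0 : 0 < -r := by linarith
    have hκ := Real.sqrt_pos.2 hr0
    refine ⟨-1, √(-r), 1, Set.Ioi 0, hκ, by rw [Real.sq_sqrt hr0.le]; ring, isPreconnected_Ioi,
      fun ν hν => ⟨ne_of_gt hν, ?_⟩, ?_, ?_, by norm_num [coeff]⟩
    · nlinarith [sq_nonneg ν]
    · exact inv_pos.2 hκ
    · exact (one_pos : (0 : ℝ) < 1)

/-! ### Bifurcation in a generic family -/

namespace Minkowski

/-- The restriction of a linear form to the plane `t = 0`. -/
def planePart (A : (ℝ × ℝ) × ℝ →L[ℝ] ℝ) : ℝ × ℝ →L[ℝ] ℝ :=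
  A.comp (ContinuousLinearMap.inl ℝ (ℝ × ℝ) ℝ)

theorem planePart_apply (A : (ℝ × ℝ) × ℝ →L[ℝ] ℝ) (c : ℝ × ℝ) : planePart A c = A (c, 0) := rfl

/-- The determinant of three linear forms, expanded along the direction of the parameter. -/
def wedge₃ (l n m : (ℝ × ℝ) × ℝ →L[ℝ] ℝ) : ℝ :=
  wedge (planePart l) (planePart n) * m (0, 1) - wedge (planePart m) (planePart n) * l (0, 1)
    - wedge (planePart l) (planePart m) * n (0, 1)

theorem family_apply (A : (ℝ × ℝ) × ℝ →L[ℝ] ℝ) (c : (ℝ × ℝ) × ℝ) :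
    A c = planePart A c.1 + c.2 * A (0, 1) := by
  rw [planePart_apply, ← smul_eq_mul, ← map_smul, ← map_add]
  congr 1
  ext <;> simp

/-- The homeomorphism is a composite of three: the coordinates `(X, Z, P)` proportional to `(L, N,
M)`, the map straightening the parameter to `μP - X - Z`, and the linear change replacing `P` by
that height, which is the model parameter `T`. -/
theorem deformsAs_of_mem_range {X : (ℝ × ℝ) × ℝ → Fin 3 → ℝ} {σ : ℝ}
    (H : IsFlatFrame familyFrame σ X 0) {l n m : (ℝ × ℝ) × ℝ →L[ℝ] ℝ}
    (hl : l = fderiv ℝ (nullL familyFrame σ X) 0) (hn : n = fderiv ℝ (nullN familyFrame σ X) 0)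
    (hm : m = fderiv ℝ (nullM familyFrame σ X) 0) {k : Configuration}
    (hln : wedge (planePart l) (planePart n) ≠ 0)
    (hk : crossRatio (planePart l) (planePart n) (planePart m) ∈ k.range)
    (h3 : wedge₃ l n m ≠ 0) : DeformsAs k X := by
  obtain ⟨s, κ, μ, I, hκ, hr, hI, hI', hκI, hμI, hc⟩ := Configuration.exists_arrangement hk
  have hgp := generalPosition_of_mem_range hln hk
  set W := wedge (planePart l) (planePart n) with hW
  set α := wedge (planePart m) (planePart n) / W with hα
  set β := wedge (planePart l) (planePart m) / W with hβ
  have hα0 : α ≠ 0 := div_ne_zero hgp.mn hln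
  have hβ0 : β ≠ 0 := div_ne_zero hgp.lm hln
  have hαβ : α * β = s * κ ^ 2 := by
    rw [← hr, crossRatio, hα, hβ, ← hW]
    field_simp
  have hμ0 : μ ≠ 0 := (hI' μ hμI).1
  set γ := wedge₃ l n m / W with hγ
  have hγ0 : γ ≠ 0 := div_ne_zero h3 hln
  -- Cramer's rule in the plane `t = 0`; `γ` collects the discrepancy in the direction of the
  -- parameter and is nonzero exactly because the three differentials are independent.
  have hmd : ∀ c, m c = α * l c + β * n c + γ * c.2 := by
    intro c
    have h1 := wedge_mul_apply (planePart l) (planePart n) (planePart m) c.1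
    rw [family_apply m, family_apply l, family_apply n, hα, hβ, hγ]
    field_simp
    rw [← hW] at h1
    have h2 : wedge₃ l n m = W * m (0, 1) - wedge (planePart m) (planePart n) * l (0, 1)
      - wedge (planePart l) (planePart m) * n (0, 1) := rfl
    rw [h2]
    linear_combination h1
  have sL := smoothNear_nullL (σ := σ) H.smooth H.delta_pos
  have sN := smoothNear_nullN (σ := σ) H.smooth H.delta_pos
  have sM := smoothNear_nullM (σ := σ) H.smooth H.delta_pos
  have zL : nullL familyFrame σ X 0 = 0 := H.snd.nullL
  have zN : nullN familyFrame σ X 0 = 0 := H.snd.nullN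
  have zM : nullM familyFrame σ X 0 = 0 := H.snd.nullM
  -- The factors are chosen so that `t = κ⁻¹P - X - Z` to first order and, as `αβ = sκ²`, `XZ - sP²`
  -- is a multiple of `LN - M²`.
  let Θ : (ℝ × ℝ) × ℝ → (ℝ × ℝ) × ℝ := fun p =>
    ((α / γ * nullL familyFrame σ X p, β / γ * nullN familyFrame σ X p),
      κ / γ * nullM familyFrame σ X p)
  have sΘ : SmoothNear Θ 0 := (((smoothNear_const _).mul sL).prodMk
    ((smoothNear_const _).mul sN)).prodMk ((smoothNear_const _).mul sM)
  have dL : HasFDerivAt (nullL familyFrame σ X) l 0 := hl ▸ sL.differentiableAt.hasFDerivAt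
  have dN : HasFDerivAt (nullN familyFrame σ X) n 0 := hn ▸ sN.differentiableAt.hasFDerivAt
  have dM : HasFDerivAt (nullM familyFrame σ X) m 0 := hm ▸ sM.differentiableAt.hasFDerivAt
  have dΘ : HasFDerivAt Θ ((((α / γ) • l).prod ((β / γ) • n)).prod ((κ / γ) • m)) 0 :=
    ((dL.const_mul _).prodMk (dN.const_mul _)).prodMk (dM.const_mul _)
  have Θ0 : Θ 0 = 0 := by simp [Θ, zL, zN, zM]
  have aΘ : ∀ c, fderiv ℝ Θ 0 c = ((α / γ * l c, β / γ * n c), κ / γ * m c) := by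
    intro c
    rw [dΘ.fderiv]
    rfl
  have hinj : Function.Injective (fderiv ℝ Θ 0) := by
    refine (injective_iff_map_eq_zero _).2 fun c hc => ?_
    rw [aΘ] at hc
    have e1 : α / γ * l c = 0 := congrArg (fun p : (ℝ × ℝ) × ℝ => p.1.1) hc
    have e2 : β / γ * n c = 0 := congrArg (fun p : (ℝ × ℝ) × ℝ => p.1.2) hc
    have e3 : κ / γ * m c = 0 := congrArg (fun p : (ℝ × ℝ) × ℝ => p.2) hc
    have f1 := (mul_eq_zero.1 e1).resolve_left (div_ne_zero hα0 hγ0)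
    have f2 := (mul_eq_zero.1 e2).resolve_left (div_ne_zero hβ0 hγ0)
    have f3 := (mul_eq_zero.1 e3).resolve_left (div_ne_zero hκ.ne' hγ0)
    have f4 := hmd c
    rw [f1, f2, f3] at f4
    have f5 : c.2 = 0 := by
      have : γ * c.2 = 0 := by linarith
      exact (mul_eq_zero.1 this).resolve_left hγ0
    rw [family_apply, f5, zero_mul, add_zero] at f1 f2
    have f6 := eq_zero_of_wedge_ne_zero hln f1 f2
    ext
    · simp [f6]
    · simp [f6]
    · simp [f5]
  obtain ⟨h, h0, he, hs1, hs2⟩ := sΘ.exists_openPartialHomeomorph hinj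
  have hz : h 0 = 0 := by rw [he, Θ0]
  have hcone : IsConeDiffeoGerm h := .of_smooth h0 hz hs1 hs2
  have hsz : h.symm 0 = 0 := hcone.symm.map_zero
  have ssym : SmoothNear h.symm 0 := by
    filter_upwards [h.open_target.mem_nhds hcone.symm.mem_source] with q hq
    exact hs2.contDiffAt (h.open_target.mem_nhds hq)
  have sτ : SmoothNear (fun y => (h.symm y).2) 0 :=
    SmoothNear.comp (g := fun p : (ℝ × ℝ) × ℝ => p.2) contDiff_snd.smoothNear ssym
  have hτd : ∀ v, fderiv ℝ (fun y => (h.symm y).2) 0 v = Arrangement.height κ⁻¹ v := by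
    intro v
    obtain ⟨c, rfl⟩ := (LinearMap.injective_iff_surjective
      (f := (fderiv ℝ Θ 0).toLinearMap)).1 hinj v
    have hcomp : HasFDerivAt (fun p => (h.symm (Θ p)).2)
        ((fderiv ℝ (fun y => (h.symm y).2) 0).comp (fderiv ℝ Θ 0)) 0 := by
      refine HasFDerivAt.comp (0 : (ℝ × ℝ) × ℝ) (f := Θ) (g := fun y => (h.symm y).2) ?_
        dΘ.differentiableAt.hasFDerivAt
      rw [Θ0]
      exact sτ.differentiableAt.hasFDerivAt
    have hev : (fun p => (h.symm (Θ p)).2) =ᶠ[𝓝 0] fun p => p.2 := by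
      filter_upwards [h.open_source.mem_nhds h0] with p hp
      rw [← he, h.left_inv hp]
    have huniq := (hcomp.congr_of_eventuallyEq hev.symm).unique hasFDerivAt_snd
    have := congrArg (fun A : (ℝ × ℝ) × ℝ →L[ℝ] ℝ => A c) huniq
    refine (show _ = c.2 from this).trans ?_
    change c.2 = Arrangement.height κ⁻¹ (fderiv ℝ Θ 0 c)
    rw [aΘ, Arrangement.height]
    simp only
    rw [hmd c]
    field_simp
    ring
  obtain ⟨Φ, hΦ, hΦ'⟩ := Arrangement.straightens_of_fderiv_eq hI hI' hμI hκI sτ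
    (by simp [hsz]) hτd
  let Λ : (ℝ × ℝ) × ℝ → (ℝ × ℝ) × ℝ := fun y => (y.1, Arrangement.height μ y)
  have sΛ : SmoothNear Λ 0 := ContDiff.smoothNear (by unfold Λ Arrangement.height; fun_prop)
  have dΛ := (hasFDerivAt_fst (𝕜 := ℝ) (p := (0 : (ℝ × ℝ) × ℝ))).prodMk
    (Arrangement.hasFDerivAt_height (μ := μ) 0)
  obtain ⟨ℓ, l0, le, ls1, ls2⟩ := sΛ.exists_openPartialHomeomorph (by
    refine (injective_iff_map_eq_zero _).2 fun c hc => ?_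
    rw [HasFDerivAt.fderiv (f := Λ) dΛ] at hc
    have e1 : c.1 = 0 := congrArg Prod.fst hc
    have e2 : μ * c.2 - c.1.1 - c.1.2 = 0 := congrArg Prod.snd hc
    rw [e1] at e2
    simp [hμ0] at e2
    ext
    · simp [e1]
    · simp [e1]
    · simp [e2])
  have hcone' : IsConeDiffeoGerm ℓ :=
    .of_smooth l0 (by rw [le]; simp [Λ, Arrangement.height]) ls1 ls2
  have hT := (hcone.trans hΦ).trans hcone'
  obtain ⟨Ψ, hΨ, hΨe, hΨp⟩ := hT.exists_restr
    ((eventually_lplFun_slice H.smooth).and (H.eventually_zero_iff.and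
      (((h.trans Φ).trans ℓ).open_source.mem_nhds hT.mem_source)))
  refine ⟨Ψ, hΨ, fun p hp => ?_⟩
  obtain ⟨⟨i1, i2, i3⟩, ⟨j1, j2, j3⟩, hmem⟩ := hΨp p hp
  have m0 : p ∈ (h.trans Φ).source := (((h.trans Φ).trans_source ℓ) ▸ hmem).1
  have m1 : p ∈ h.source := ((h.trans_source Φ) ▸ m0).1
  have m2 : h p ∈ Φ.source := ((h.trans_source Φ) ▸ m0).2
  obtain ⟨⟨s1, s2, s3, s4⟩, s5⟩ := hΦ' _ m2
  have hval : Ψ p = ((Φ (h p)).1, Arrangement.height μ (Φ (h p))) := by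
    rw [hΨe]
    simp only [OpenPartialHomeomorph.coe_trans, Function.comp_apply, le, Λ]
  replace s5 := s5.trans (congrArg Prod.snd (h.left_inv m1))
  have hp' : h p = Θ p := by rw [he]
  rw [i1, i2, i3, j1, j2, j3, hval]
  generalize Φ (h p) = y at s1 s2 s3 s4 s5 ⊢
  rw [hp'] at s1 s2 s3 s4
  -- With `T = μP - X - Z`, the model `MCNC` is `P = 0` and the model `PC` is `XZ = coeff · μ²P² =
  -- sP²`.
  have hsum : y.1.1 + y.1.2 + Arrangement.height μ y = μ * y.2 := by
    unfold Arrangement.height; ring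
  have hpc : modelPC k (y.1, Arrangement.height μ y) = Arrangement.cone s y := by
    simp only [modelPC, hsum, Arrangement.cone, ← hc]
    ring
  have hΘc : Arrangement.cone s (Θ p) = α * β / γ ^ 2 *
      (nullL familyFrame σ X p * nullN familyFrame σ X p - nullM familyFrame σ X p ^ 2) := by
    simp only [Arrangement.cone, Θ]
    field_simp
    linear_combination (nullM familyFrame σ X p) ^ 2 * hαβ
  refine ⟨s5, ?_, ?_, ?_⟩
  · simp only [Θ, mul_eq_zero, div_eq_zero_iff, hα0, hβ0, hγ0, false_or] at s1 s2
    simp only [modelLPL, mul_eq_zero, s1, s2]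
  · rw [hpc, s4, hΘc]
    simp [hα0, hβ0, hγ0]
  · simp only [Θ, mul_eq_zero, div_eq_zero_iff, hκ.ne', hγ0, false_or] at s3
    simp only [modelMCNC, hsum, mul_eq_zero, hμ0, false_or, s3]

end Minkowski

/-! ### Restriction of a family to the initial surface -/

/-- The homeomorphism preserves the parameter, so it and its inverse restrict to the slice `t = 0`.
-/
theorem hasConfiguration_of_deformsAs {X : (ℝ × ℝ) × ℝ → Fin 3 → ℝ} {x : ℝ × ℝ → Fin 3 → ℝ}
    {k : Configuration} (h : DeformsAs k X) (hx : ∀ᶠ q in 𝓝 (0 : ℝ × ℝ), X (q, 0) = x q) :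
    HasConfiguration x k := by
  obtain ⟨Φ, hΦ, hΦ'⟩ := h
  have hc : Continuous fun q : ℝ × ℝ => (q, (0 : ℝ)) := by fun_prop
  have hcd : ContDiff ℝ ∞ fun q : ℝ × ℝ => (q, (0 : ℝ)) := by fun_prop
  have hval : ∀ q : ℝ × ℝ, (q, (0 : ℝ)) ∈ Φ.source → ((Φ (q, 0)).1, (0 : ℝ)) = Φ (q, 0) :=
    fun q hq => Prod.ext rfl (hΦ' _ hq).1.symm
  have hval' : ∀ q : ℝ × ℝ, (q, (0 : ℝ)) ∈ Φ.target →
      ((Φ.symm (q, 0)).1, (0 : ℝ)) = Φ.symm (q, 0) := by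
    intro q hq
    have h1 := (hΦ' _ (Φ.map_target hq)).1
    rw [Φ.right_inv hq] at h1
    exact Prod.ext rfl h1
  have hne : ∀ {q : ℝ × ℝ}, q ≠ 0 → (q, (0 : ℝ)) ≠ 0 := fun hq h0 => hq (congrArg Prod.fst h0)
  let φ : OpenPartialHomeomorph (ℝ × ℝ) (ℝ × ℝ) :=
    { toFun := fun q => (Φ (q, 0)).1
      invFun := fun q => (Φ.symm (q, 0)).1
      source := (fun q => (q, (0 : ℝ))) ⁻¹' Φ.source
      target := (fun q => (q, (0 : ℝ))) ⁻¹' Φ.target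
      map_source' := fun q hq => by
        rw [Set.mem_preimage, hval q hq]
        exact Φ.map_source hq
      map_target' := fun q hq => by
        rw [Set.mem_preimage, hval' q hq]
        exact Φ.map_target hq
      left_inv' := fun q hq => by rw [hval q hq, Φ.left_inv hq]
      right_inv' := fun q hq => by rw [hval' q hq, Φ.right_inv hq]
      open_source := Φ.open_source.preimage hc
      open_target := Φ.open_target.preimage hc
      continuousOn_toFun := continuous_fst.comp_continuousOn
        (Φ.continuousOn.comp hc.continuousOn fun _ h => h)
      continuousOn_invFun := continuous_fst.comp_continuousOn
        (Φ.symm.continuousOn.comp hc.continuousOn fun _ h => h) }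
  have hφ : IsConeDiffeoGerm φ :=
    { mem_source := hΦ.mem_source
      map_zero := congrArg Prod.fst hΦ.map_zero
      smooth := contDiff_fst.comp_contDiffOn
        (hΦ.smooth.comp hcd.contDiffOn fun q hq => ⟨hq.1, hne hq.2⟩)
      smooth_symm := contDiff_fst.comp_contDiffOn
        (hΦ.smooth_symm.comp hcd.contDiffOn fun q hq => ⟨hq.1, hne hq.2⟩) }
  obtain ⟨ψ, hψ, hψe, hψp⟩ := hφ.exists_restr
    ((eventually_eventually_nhds.2 hx).and (φ.open_source.mem_nhds hφ.mem_source))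
  refine ⟨ψ, hψ, fun q hq => ?_⟩
  obtain ⟨h1, h2⟩ := hψp q hq
  obtain ⟨-, e1, e2, e3⟩ := hΦ' _ h2
  obtain ⟨c1, c2, c3⟩ := Minkowski.curves_congr h1
  have hv : (ψ q, (0 : ℝ)) = Φ (q, 0) := by
    rw [hψe]
    exact hval q h2
  rw [hv, ← c1, ← c2, ← c3]
  exact ⟨e1, e2, e3⟩

/-! ### Change of parameters -/

namespace Minkowski

theorem eventually_jac_ne_zero {h : OpenPartialHomeomorph (ℝ × ℝ) (ℝ × ℝ)} (hh : IsDiffeoGerm h) :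
    SmoothNear (jac h) 0 ∧ jac h 0 ≠ 0 ∧ ∀ᶠ q in 𝓝 0, jac h q ≠ 0 := by
  have h1 := smoothNear_dir hh.smoothNear (1, 0)
  have h2 := smoothNear_dir hh.smoothNear (0, 1)
  have hs : SmoothNear (jac h) 0 := by
    filter_upwards [h1, h2] with q q1 q2
    unfold jac
    fun_prop
  have h0 : jac h 0 ≠ 0 := jac_ne_zero (hh.injective_fderiv hh.mem_source)
  exact ⟨hs, h0, hs.contDiffAt.continuousAt.eventually_ne h0⟩

variable {x y : ℝ × ℝ → Fin 3 → ℝ}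

theorem _root_.HasConfiguration.of_rightEquiv (hx : SmoothNear x 0) (hxy : RightEquiv y x)
    {k : Configuration} (H : HasConfiguration x k) : HasConfiguration y k := by
  obtain ⟨h, hh, he⟩ := hxy
  obtain ⟨φ, hφ, hφ'⟩ := H
  have hcone : IsConeDiffeoGerm h := .of_smooth hh.mem_source hh.map_zero hh.smooth hh.smooth_symm
  obtain ⟨ψ, hψ, hψe, hψp⟩ := (hcone.trans hφ).exists_restr
    ((eventually_comp (hh.map_zero.symm ▸ hx) hh.smoothNear he).and
      ((eventually_jac_ne_zero hh).2.2.and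
        ((h.trans φ).open_source.mem_nhds (hcone.trans hφ).mem_source)))
  refine ⟨ψ, hψ, fun q hq => ?_⟩
  obtain ⟨⟨e1, e2, e3, -, -⟩, hj, hm⟩ := hψp q hq
  rw [OpenPartialHomeomorph.trans_source] at hm
  have := hφ' (h q) hm.2
  rw [hψe, e1, e2, e3]
  simpa [hj] using this

theorem IsFlatTimelikeUmbilic.of_rightEquiv (hx : SmoothNear x 0)
    (hy : SmoothNear y 0) (hxy : RightEquiv y x) (H : IsFlatTimelikeUmbilic x 0) :
    IsFlatTimelikeUmbilic y 0 := by
  obtain ⟨h, hh, he⟩ := hxy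
  rw [isFlatTimelikeUmbilic_iff hx] at H
  rw [isFlatTimelikeUmbilic_iff hy]
  obtain ⟨-, -, -, e4, e5⟩ :=
    (eventually_comp (hh.map_zero.symm ▸ hx) hh.smoothNear he).self_of_nhds
  rw [hh.map_zero] at e4 e5
  have hj := (eventually_jac_ne_zero hh).2.1
  refine ⟨?_, e5 H.2⟩
  have h1 : frameDelta planeFrame y 0 = jac h 0 ^ 2 * frameDelta planeFrame x 0 := e4
  rw [h1]
  have := H.1
  positivity

theorem _root_.IsNullTriple.comp {f g m f' g' m' L N M : ℝ × ℝ → ℝ}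
    (T : IsNullTriple f g m L N M) {h : OpenPartialHomeomorph (ℝ × ℝ) (ℝ × ℝ)}
    (hh : IsDiffeoGerm h) (he : ∀ᶠ q in 𝓝 0, f' q = jac h q ^ 6 * f (h q) ∧
      g' q = jac h q ^ 4 * g (h q) ∧ m' q = jac h q ^ 3 * m (h q)) :
    IsNullTriple f' g' m' (fun q => L (h q)) (fun q => N (h q)) (fun q => M (h q)) := by
  have hs : ∀ {u : ℝ × ℝ → ℝ}, SmoothNear u 0 → SmoothNear (fun q => u (h q)) 0 :=
    fun hu => SmoothNear.comp (hh.map_zero.symm ▸ hu) hh.smoothNear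
  obtain ⟨hj, hj0, -⟩ := eventually_jac_ne_zero hh
  obtain ⟨u, hu, hu0, eu⟩ := T.eq_f
  obtain ⟨v, hv, hv0, ev⟩ := T.eq_g
  obtain ⟨w, hw, hw0, ew⟩ := T.eq_h
  refine ⟨hs T.smoothL, hs T.smoothN, hs T.smoothM, by simp [hh.map_zero, T.zeroL],
    by simp [hh.map_zero, T.zeroN], by simp [hh.map_zero, T.zeroM],
    ⟨_, (hj.pow 6).mul (hs hu), ?_, ?_⟩, ⟨_, (hj.pow 4).mul (hs hv), ?_, ?_⟩,
    ⟨_, (hj.pow 3).mul (hs hw), ?_, ?_⟩⟩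
  · simp only [hh.map_zero]
    have : 0 < jac h 0 ^ 6 := Even.pow_pos (by decide) hj0
    positivity
  · filter_upwards [he, hh.tendsto.eventually eu] with q h1 h2
    rw [h1.1, h2]; ring
  · simp only [hh.map_zero]
    have : 0 < jac h 0 ^ 4 := Even.pow_pos (by decide) hj0
    positivity
  · filter_upwards [he, hh.tendsto.eventually ev] with q h1 h2
    rw [h1.2.1, h2]; ring
  · simp only [hh.map_zero]
    positivity
  · filter_upwards [he, hh.tendsto.eventually ew] with q h1 h2
    rw [h1.2.2, h2]; ring

theorem wedge_comp (A B : ℝ × ℝ →L[ℝ] ℝ) (D : ℝ × ℝ →L[ℝ] ℝ × ℝ) :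
    wedge (A.comp D) (B.comp D) =
      ((D (1, 0)).1 * (D (0, 1)).2 - (D (1, 0)).2 * (D (0, 1)).1) * wedge A B := by
  simp only [wedge, ContinuousLinearMap.comp_apply]
  rw [planeForm_apply A (D (1, 0)), planeForm_apply A (D (0, 1)), planeForm_apply B (D (1, 0)),
    planeForm_apply B (D (0, 1))]
  ring

/-- The functions `L`, `N`, `M` of `x`, composed with the diffeomorphism, serve for `y` as well. All
the `wedge`s are multiplied by the Jacobian determinant, and the conditions of general position are
homogeneous in them. -/
theorem _root_.IsNondegenerate.of_rightEquiv (hx : SmoothNear x 0)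
    (H : IsFlatTimelikeUmbilic x 0) (hxy : RightEquiv y x) (hn : IsNondegenerate x) :
    IsNondegenerate y := by
  rw [isFlatTimelikeUmbilic_iff hx] at H
  obtain ⟨σ, hσ⟩ := exists_isFlatFrame hx H.1 H.2
  have hgp := hσ.isNondegenerate_iff.1 hn
  obtain ⟨h, hh, he⟩ := hxy
  have T := hσ.isNullTriple.comp hh
    ((eventually_comp (hh.map_zero.symm ▸ hx) hh.smoothNear he).mono
      fun q hq => ⟨hq.1, hq.2.1, hq.2.2.1⟩)
  have hd : ∀ {u : ℝ × ℝ → ℝ}, SmoothNear u 0 →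
      fderiv ℝ (fun q => u (h q)) 0 = (fderiv ℝ u 0).comp (fderiv ℝ h 0) := by
    intro u hu
    have h1 := fderiv_comp (𝕜 := ℝ) (g := u) (f := h) 0
      (hh.map_zero.symm ▸ hu.differentiableAt) hh.smoothNear.differentiableAt
    rw [hh.map_zero] at h1
    exact h1
  have hj : (fderiv ℝ h 0 (1, 0)).1 * (fderiv ℝ h 0 (0, 1)).2 -
      (fderiv ℝ h 0 (1, 0)).2 * (fderiv ℝ h 0 (0, 1)).1 ≠ 0 := (eventually_jac_ne_zero hh).2.1
  obtain ⟨h1, h2, h3, h4, h5, h6⟩ := T.nondegenerate_of_generalPosition (by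
    rw [hd hσ.isNullTriple.smoothL, hd hσ.isNullTriple.smoothN, hd hσ.isNullTriple.smoothM]
    refine ⟨?_, ?_, ?_, ?_⟩
    · rw [wedge_comp]; exact mul_ne_zero hj hgp.ln
    · rw [wedge_comp]; exact mul_ne_zero hj hgp.mn
    · rw [wedge_comp]; exact mul_ne_zero hj hgp.lm
    · rw [wedge_comp, wedge_comp, wedge_comp]
      intro h0
      apply hgp.disc
      apply mul_left_cancel₀ (pow_ne_zero 2 hj)
      linear_combination h0)
  exact ⟨h1, h2, h3, h4, h5, h6⟩

end Minkowski

/-! ### The configurations are distinct -/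

theorem HasConfiguration.exists_transition {x : ℝ × ℝ → Fin 3 → ℝ} {k k' : Configuration}
    (h : HasConfiguration x k) (h' : HasConfiguration x k') :
    ∃ ψ : OpenPartialHomeomorph (ℝ × ℝ) (ℝ × ℝ), IsConeDiffeoGerm ψ ∧ ∀ q ∈ ψ.source,
      (modelLPL (q, 0) = 0 ↔ modelLPL (ψ q, 0) = 0) ∧
      (modelPC k (q, 0) = 0 ↔ modelPC k' (ψ q, 0) = 0) ∧
      (modelMCNC (q, 0) = 0 ↔ modelMCNC (ψ q, 0) = 0) := by
  obtain ⟨φ, hφ, h1⟩ := h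
  obtain ⟨φ', hφ', h2⟩ := h'
  refine ⟨φ.symm.trans φ', hφ.symm.trans hφ', fun q hq => ?_⟩
  rw [OpenPartialHomeomorph.trans_source] at hq
  have hq1 : q ∈ φ.target := hq.1
  obtain ⟨a1, a2, a3⟩ := h1 _ (φ.map_target hq1)
  obtain ⟨b1, b2, b3⟩ := h2 _ hq.2
  rw [φ.right_inv hq1] at a1 a2 a3
  exact ⟨a1.symm.trans b1, a2.symm.trans b2, a3.symm.trans b3⟩

/-- The slope of a line of the model parabolic curve, when it is a pair of lines. -/
theorem Configuration.exists_slope {k : Configuration} (hk : k ≠ .isolated) :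
    ∃ r : ℝ, r = k.coeff * (1 + r) ^ 2 ∧ (k = .between → r < 0) := by
  have h5 := Real.sq_sqrt (show (0 : ℝ) ≤ 5 by norm_num)
  have h2 := Real.sq_sqrt (show (0 : ℝ) ≤ 8 by norm_num)
  cases k
  · exact absurd rfl hk
  -- Putting `Z = rX` in the `PC` gives `r² - 6r + 1 = 0` here and `r² + 3r + 1 = 0` in the next
  -- case.
  · exact ⟨3 + √8, by simp only [coeff]; linear_combination -h2 / 8, fun h => by cases h⟩
  · refine ⟨(-3 + √5) / 2, by simp only [coeff]; linear_combination h5 / 4, fun _ => ?_⟩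
    nlinarith [Real.sqrt_nonneg 5]

theorem eq_zero_of_modelPC_isolated {q : ℝ × ℝ} (h : modelPC .isolated (q, 0) = 0) : q = 0 := by
  simp only [modelPC, Configuration.coeff] at h
  have h1 : q.1 = 0 := by
    have : q.1 ^ 2 = 0 := by nlinarith [sq_nonneg q.1, sq_nonneg q.2, sq_nonneg (q.1 + q.2)]
    simpa using this
  have h2 : q.2 = 0 := by
    have : q.2 ^ 2 = 0 := by nlinarith [sq_nonneg q.1, sq_nonneg q.2, sq_nonneg (q.1 + q.2)]
    simpa using this
  exact Prod.ext h1 h2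

/-- A line of the other `PC` would be mapped injectively into a single point. -/
theorem HasConfiguration.eq_isolated {x : ℝ × ℝ → Fin 3 → ℝ} {k : Configuration}
    (h : HasConfiguration x k) (h' : HasConfiguration x .isolated) : k = .isolated := by
  by_contra hk
  obtain ⟨ψ, hψ, H⟩ := h.exists_transition h'
  obtain ⟨r, hr, -⟩ := Configuration.exists_slope hk
  have hc : Tendsto (fun s : ℝ => (s, r * s)) (𝓝[≠] 0) (𝓝 0) := by
    have : Continuous fun s : ℝ => (s, r * s) := by fun_prop
    have h0 := this.tendsto 0
    simp only [mul_zero] at h0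
    exact h0.mono_left nhdsWithin_le_nhds
  obtain ⟨s, hs, hs0⟩ := ((hc.eventually (ψ.open_source.mem_nhds hψ.mem_source)).and
    self_mem_nhdsWithin).exists
  have h1 : modelPC k ((s, r * s), 0) = 0 := by
    simp only [modelPC]
    linear_combination s ^ 2 * hr
  refine hψ.map_ne_zero hs (fun h0 => hs0 ?_)
    (eq_zero_of_modelPC_isolated ((H _ hs).2.1.1 h1))
  exact congrArg Prod.fst h0

/-- A sector bounded by the `LPL` that meets both the `MCNC` and the `PC` would have a connected
image off the `LPL`. There `XZ` is nonpositive at a point of the `MCNC` and nonnegative at a point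
of the `PC`, so it vanishes somewhere, a contradiction. -/
theorem HasConfiguration.not_between_separated {x : ℝ × ℝ → Fin 3 → ℝ}
    (h : HasConfiguration x .between) (h' : HasConfiguration x .separated) : False := by
  obtain ⟨ψ, hψ, H⟩ := h.exists_transition h'
  obtain ⟨r, hr, hr0⟩ := Configuration.exists_slope (k := .between) (by simp)
  replace hr0 := hr0 rfl
  obtain ⟨ε, hε, hball⟩ := Metric.mem_nhds_iff.1 (ψ.open_source.mem_nhds hψ.mem_source)
  set Q : Set (ℝ × ℝ) := Set.Ioo 0 ε ×ˢ Set.Ioo (-ε) 0 with hQ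
  have hsub : Q ⊆ ψ.source := by
    rintro q ⟨h1, h2⟩
    apply hball
    rw [mem_ball_zero_iff, Prod.norm_def, max_lt_iff, Real.norm_eq_abs, Real.norm_eq_abs, abs_lt,
      abs_lt]
    exact ⟨⟨by linarith [h1.1], h1.2⟩, ⟨h2.1, by linarith [h2.2]⟩⟩
  have hpre : IsPreconnected Q := isPreconnected_Ioo.prod isPreconnected_Ioo
  have hcont : ContinuousOn (fun q => (ψ q).1 * (ψ q).2) Q :=
    (continuous_fst.comp_continuousOn (ψ.continuousOn.mono hsub)).mul
      (continuous_snd.comp_continuousOn (ψ.continuousOn.mono hsub))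
  have hne : ∀ q ∈ Q, (ψ q).1 * (ψ q).2 ≠ 0 := by
    intro q hq h0
    have h1 : q.1 * q.2 = 0 := (H q (hsub hq)).1.2 h0
    exact mul_ne_zero hq.1.1.ne' hq.2.2.ne h1
  have hab : ∃ a ∈ Q, (ψ a).1 * (ψ a).2 ≤ 0 := by
    have ha : (ε / 2, -(ε / 2)) ∈ Q := ⟨⟨by simp; linarith, by simp; linarith⟩,
      ⟨by simp; linarith, by simp; linarith⟩⟩
    refine ⟨_, ha, ?_⟩
    have h1 : (ψ (ε / 2, -(ε / 2))).1 + (ψ (ε / 2, -(ε / 2))).2 + 0 = 0 :=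
      (H _ (hsub ha)).2.2.1 (by simp [modelMCNC])
    have h2 : (ψ (ε / 2, -(ε / 2))).2 = -(ψ (ε / 2, -(ε / 2))).1 := by linarith
    rw [h2]
    nlinarith [sq_nonneg (ψ (ε / 2, -(ε / 2))).1]
  have hbb : ∃ b ∈ Q, 0 ≤ (ψ b).1 * (ψ b).2 := by
    -- With this `s`, the coordinates of `(s, rs)` have absolute values summing to `ε/2`, so the
    -- point lies in the square.
    have hs : 0 < ε / (2 * (1 - r)) := by
      have : 0 < 1 - r := by linarith
      positivity
    set s := ε / (2 * (1 - r)) with hsd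
    have hs' : 2 * (s - r * s) = ε := by
      have : (1 - r) ≠ 0 := by linarith
      rw [hsd]; field_simp
    have hrs : r * s < 0 := mul_neg_of_neg_of_pos hr0 hs
    have hb : (s, r * s) ∈ Q := ⟨⟨hs, by simp; linarith⟩, ⟨by simp; linarith, hrs⟩⟩
    refine ⟨_, hb, ?_⟩
    have h1 := (H _ (hsub hb)).2.1.1 (by
      simp only [modelPC]
      linear_combination s ^ 2 * hr)
    simp only [modelPC, Configuration.coeff] at h1
    nlinarith [sq_nonneg ((ψ (s, r * s)).1 + (ψ (s, r * s)).2)]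
  obtain ⟨a, ha, ha'⟩ := hab
  obtain ⟨b, hb, hb'⟩ := hbb
  obtain ⟨c, hc, hc'⟩ := hpre.intermediate_value ha hb hcont ⟨ha', hb'⟩
  exact hne c hc hc'

theorem HasConfiguration.unique {x : ℝ × ℝ → Fin 3 → ℝ} {k k' : Configuration}
    (h : HasConfiguration x k) (h' : HasConfiguration x k') : k = k' := by
  by_cases hk : k = .isolated
  · subst hk
    exact (h'.eq_isolated h).symm
  by_cases hk' : k' = .isolated
  · subst hk'
    exact h.eq_isolated h'
  cases k <;> cases k' <;> first | rfl | exact absurd rfl hk | exact absurd rfl hk' | skip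
  · exact (h'.not_between_separated h).elim
  · exact (h.not_between_separated h').elim

/-! ### Continuity with respect to the jets -/

section Jets

variable {V W : Type*} [NormedAddCommGroup V] [NormedSpace ℝ V] [NormedAddCommGroup W]
  [NormedSpace ℝ W]

open Minkowski in
-- It links repeated directional derivatives, in which the fundamental forms are expressed, to the
-- jets that define the topology.
theorem eventually_dir_iteratedFDeriv {f : V → W} {p : V} (hf : SmoothNear f p) {n : ℕ}
    (m : Fin n → V) (a : V) : ∀ᶠ q in 𝓝 p, dir a (fun q => iteratedFDeriv ℝ n f q m) q =
      iteratedFDeriv ℝ (n + 1) f q (Fin.cons a m) := by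
  filter_upwards [hf] with q hq
  have hd : DifferentiableAt ℝ (iteratedFDeriv ℝ n f) q :=
    (hq.of_le (m := n + 1) (by exact_mod_cast le_top)).differentiableAt_iteratedFDeriv
      (by exact_mod_cast Nat.lt_succ_self n)
  rw [iteratedFDeriv_succ_apply_left, Fin.cons_zero, Fin.tail_cons, dir]
  have h1 := (ContinuousMultilinearMap.apply ℝ (fun _ : Fin n => V) W m).hasFDerivAt.comp q
    hd.hasFDerivAt
  exact congrArg (fun A : V →L[ℝ] W => A a) h1.fderiv

open Minkowski in
theorem eventually_dir_eq {f : V → W} {p : V} (hf : SmoothNear f p) (a b c : V) :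
    ∀ᶠ q in 𝓝 p, f q = iteratedFDeriv ℝ 0 f q ![] ∧
      dir a f q = iteratedFDeriv ℝ 1 f q ![a] ∧
      dir b (dir a f) q = iteratedFDeriv ℝ 2 f q ![b, a] ∧
      dir c (dir b (dir a f)) q = iteratedFDeriv ℝ 3 f q ![c, b, a] := by
  have h0 : f =ᶠ[𝓝 p] fun q => iteratedFDeriv ℝ 0 f q ![] :=
    Eventually.of_forall fun q => (iteratedFDeriv_zero_apply _).symm
  have h1 : dir a f =ᶠ[𝓝 p] fun q => iteratedFDeriv ℝ 1 f q ![a] :=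
    (dir_congr h0 a).trans (eventually_dir_iteratedFDeriv hf ![] a)
  have h2 : dir b (dir a f) =ᶠ[𝓝 p] fun q => iteratedFDeriv ℝ 2 f q ![b, a] :=
    (dir_congr h1 b).trans (eventually_dir_iteratedFDeriv hf ![a] b)
  have h3 : dir c (dir b (dir a f)) =ᶠ[𝓝 p] fun q => iteratedFDeriv ℝ 3 f q ![c, b, a] :=
    (dir_congr h2 c).trans (eventually_dir_iteratedFDeriv hf ![b, a] c)
  exact h0.and (h1.and (h2.and h3))

variable {T : Type*} [TopologicalSpace T]

theorem continuous_jets_apply {f : T → V → W} (hc : Continuous fun t => jets (f t)) {n : ℕ}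
    (m : Fin n → V) : Continuous fun t => iteratedFDeriv ℝ n (f t) 0 m :=
  (ContinuousMultilinearMap.apply ℝ (fun _ : Fin n => V) W m).continuous.comp
    ((continuous_apply n).comp hc)

theorem continuous_jets_add {f g : T → V → W} (hf : Continuous fun t => jets (f t))
    (hg : Continuous fun t => jets (g t)) (sf : ∀ t, SmoothNear (f t) 0)
    (sg : ∀ t, SmoothNear (g t) 0) : Continuous fun t => jets (fun p => f t p + g t p) := by
  refine continuous_pi fun n => ?_
  have : (fun t => jets (fun p => f t p + g t p) n) = fun t => jets (f t) n + jets (g t) n := by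
    funext t
    exact iteratedFDeriv_add_apply ((sf t).contDiffAt.of_le (by exact_mod_cast le_top))
      ((sg t).contDiffAt.of_le (by exact_mod_cast le_top))
  rw [this]
  exact ((continuous_apply n).comp hf).add ((continuous_apply n).comp hg)

theorem continuous_jets_clm {U : Type*} [NormedAddCommGroup U] [NormedSpace ℝ U]
    {f : T → V → W} (hf : Continuous fun t => jets (f t)) (sf : ∀ t, SmoothNear (f t) 0)
    (A : W →L[ℝ] U) : Continuous fun t => jets (fun p => A (f t p)) := by
  refine continuous_pi fun n => ?_
  have : (fun t => jets (fun p => A (f t p)) n) =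
      fun t => A.compContinuousMultilinearMap (jets (f t) n) := by
    funext t
    exact A.iteratedFDeriv_comp_left (sf t).contDiffAt (i := n) (by exact_mod_cast le_top)
  rw [this]
  exact (ContinuousLinearMap.compContinuousMultilinearMapL ℝ (fun _ : Fin n => V) W U A).continuous.comp
    ((continuous_apply n).comp hf)

theorem continuous_jets_smul {g : V → W} (sg : SmoothNear g 0) :
    Continuous fun ε : ℝ => jets (fun p => ε • g p) := by
  refine continuous_pi fun n => ?_
  have : (fun ε : ℝ => jets (fun p => ε • g p) n) = fun ε => ε • jets g n := by
    funext ε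
    exact iteratedFDeriv_const_smul_apply (sg.contDiffAt.of_le (by exact_mod_cast le_top))
  rw [this]
  fun_prop

/-- By Faà di Bruno's formula the jet of `f ∘ h` is, for fixed `h`, a finite sum of continuous
linear functions of the jets of `f`. -/
theorem continuous_jets_comp {f : T → V → W} (hf : Continuous fun t => jets (f t))
    (sf : ∀ t, SmoothNear (f t) 0) {h : V → V} (hh : SmoothNear h 0) (h0 : h 0 = 0) :
    Continuous fun t => jets (fun p => f t (h p)) := by
  refine continuous_pi fun n => ?_
  have : (fun t => jets (fun p => f t (h p)) n) = fun t => ∑ c : OrderedFinpartition n,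
      c.compAlongOrderedFinpartitionL ℝ V V W (jets (f t) c.length)
        (fun m => iteratedFDeriv ℝ (c.partSize m) h 0) := by
    funext t
    have := iteratedFDeriv_comp (𝕜 := ℝ) (g := f t) (f := h) (x := 0)
      (h0.symm ▸ (sf t).contDiffAt) hh.contDiffAt (i := n) (by exact_mod_cast le_top)
    rw [h0] at this
    exact this
  rw [this]
  refine continuous_finsetSum _ fun c _ => ?_
  exact (ContinuousMultilinearMap.apply ℝ _ _ _).continuous.comp
    ((c.compAlongOrderedFinpartitionL ℝ V V W).continuous.comp
      ((continuous_apply c.length).comp hf))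

theorem jets_congr {f g : V → W} (h : f =ᶠ[𝓝 0] g) : jets f = jets g := by
  funext n
  exact (h.iteratedFDeriv ℝ n).self_of_nhds

end Jets

namespace Minkowski

variable {V : Type*} [NormedAddCommGroup V] [NormedSpace ℝ V] {T : Type*} [TopologicalSpace T]
  {X : T → V → Fin 3 → ℝ}

theorem continuous_dir (hc : Continuous fun t => jets (X t)) (hs : ∀ t, SmoothNear (X t) 0)
    (a b c : V) : (Continuous fun t => dir a (X t) 0) ∧
      (Continuous fun t => dir b (dir a (X t)) 0) ∧
      Continuous fun t => dir c (dir b (dir a (X t))) 0 := by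
  have h := fun t => (eventually_dir_eq (hs t) a b c).self_of_nhds
  refine ⟨?_, ?_, ?_⟩
  · simp only [(h _).2.1]; exact continuous_jets_apply hc _
  · simp only [(h _).2.2.1]; exact continuous_jets_apply hc _
  · simp only [(h _).2.2.2]; exact continuous_jets_apply hc _

theorem continuous_inner {f g : T → Fin 3 → ℝ} (hf : Continuous f) (hg : Continuous g) :
    Continuous fun t => inner (f t) (g t) :=
  contDiff_inner.continuous.comp (hf.prodMk hg)

theorem continuous_cross {f g : T → Fin 3 → ℝ} (hf : Continuous f) (hg : Continuous g) :
    Continuous fun t => cross (f t) (g t) :=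
  contDiff_cross.continuous.comp (hf.prodMk hg)

theorem continuous_frame (hc : Continuous fun t => jets (X t)) (hs : ∀ t, SmoothNear (X t) 0)
    (e : V × V) : (Continuous fun t => frameE e (X t) 0) ∧
      (Continuous fun t => frameF e (X t) 0) ∧ (Continuous fun t => frameG e (X t) 0) ∧
      ∀ a b c, Continuous fun t => dSnd e (X t) 0 a b c := by
  have h1 := fun a => (continuous_dir hc hs a 0 0).1
  have h2 := fun a b => (continuous_dir hc hs a b 0).2.1
  have h3 := fun a b c => (continuous_dir hc hs a b c).2.2
  refine ⟨continuous_inner (h1 _) (h1 _), continuous_inner (h1 _) (h1 _),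
    continuous_inner (h1 _) (h1 _), fun a b c => ?_⟩
  simp only [dSnd, dir_frameSnd (hs _)]
  exact ((continuous_inner (continuous_cross (h2 _ _) (h1 _)) (h2 _ _)).add
    (continuous_inner (continuous_cross (h1 _) (h2 _ _)) (h2 _ _))).add
    (continuous_inner (continuous_cross (h1 _) (h1 _)) (h3 _ _ _))

theorem continuous_dNull (hc : Continuous fun t => jets (X t)) (hs : ∀ t, SmoothNear (X t) 0)
    (e : V × V) (σ : ℝ) : (Continuous fun t => frameDelta e (X t) 0) ∧
      (Continuous fun t => frameR e σ (X t) 0) ∧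
      (∀ c, Continuous fun t => dNullL e σ (X t) 0 c) ∧
      (∀ c, Continuous fun t => dNullN e σ (X t) 0 c) ∧
      ∀ c, Continuous fun t => dNullM e σ (X t) 0 c := by
  obtain ⟨hE, hF, hG, hS⟩ := continuous_frame hc hs e
  have hδ : Continuous fun t => frameDelta e (X t) 0 := by
    unfold frameDelta
    fun_prop
  have hR : Continuous fun t => frameR e σ (X t) 0 := by
    unfold frameR
    fun_prop
  refine ⟨hδ, hR, fun c => ?_, fun c => ?_, fun c => ?_⟩
  · unfold dNullL
    have := hS e.1 e.1 c; have := hS e.1 e.2 c; have := hS e.2 e.2 c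
    fun_prop
  · unfold dNullN
    have := hS e.1 e.1 c; have := hS e.1 e.2 c; have := hS e.2 e.2 c
    fun_prop
  · unfold dNullM
    have := hS e.1 e.1 c; have := hS e.1 e.2 c; have := hS e.2 e.2 c
    fun_prop

end Minkowski

/-! ### The quotient map onto the space of germs of surfaces -/

theorem LocalParam.continuous_jets : Continuous fun x : LocalParam => jets x.toFun :=
  continuous_induced_dom

theorem Deformation.continuous_jets {x : LocalParam} :
    Continuous fun X : Deformation x => jets X.toFun :=
  continuous_induced_dom

theorem Perturbation.continuous_jets : Continuous fun h : Perturbation => jets h.toFun :=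
  continuous_induced_dom

/-- Reparametrisation by a germ of a diffeomorphism. -/
def LocalParam.comp (x : LocalParam) {h : OpenPartialHomeomorph (ℝ × ℝ) (ℝ × ℝ)}
    (hh : IsDiffeoGerm h) : LocalParam where
  toFun q := x.toFun (h q)
  smooth := SmoothNear.comp (hh.map_zero.symm ▸ x.smooth) hh.smoothNear
  immersion := by
    have h1 := fderiv_comp (𝕜 := ℝ) (g := x.toFun) (f := h) 0
      (hh.map_zero.symm ▸ x.smooth.differentiableAt) hh.smoothNear.differentiableAt
    rw [hh.map_zero] at h1
    change Function.Injective (fderiv ℝ (x.toFun ∘ h) 0)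
    rw [h1]
    exact x.immersion.comp (hh.injective_fderiv hh.mem_source)

theorem LocalParam.continuous_comp {h : OpenPartialHomeomorph (ℝ × ℝ) (ℝ × ℝ)}
    (hh : IsDiffeoGerm h) : Continuous fun x : LocalParam => x.comp hh :=
  continuous_induced_rng.2 (continuous_jets_comp LocalParam.continuous_jets (fun x => x.smooth)
    hh.smoothNear hh.map_zero)

/-- If `y` is equivalent to some `x ∈ U` through `h`, then `y ∘ h` has the jets of `x` and lies in
`U`, since open sets see only jets. Reparametrisation by the fixed `h` is continuous, so every `z`
near `y` is equivalent to a member of `U`. -/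
theorem isOpenMap_mk : IsOpenMap (Quotient.mk LocalParam.setoid) := by
  intro U hU
  rw [isOpen_coinduced, isOpen_iff_mem_nhds]
  rintro y ⟨x, hx, hxy⟩
  obtain ⟨h, hh, he⟩ : RightEquiv x.toFun y.toFun := Quotient.exact hxy
  have hy : y.comp hh ∈ U := by
    obtain ⟨S, -, rfl⟩ := isOpen_induced_iff.1 hU
    have : jets (y.comp hh).toFun = jets x.toFun := jets_congr (he.mono fun q hq => hq.symm)
    simpa [this] using hx
  filter_upwards [(LocalParam.continuous_comp hh).continuousAt.eventually (hU.mem_nhds hy)]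
    with z hz
  refine ⟨_, hz, Quotient.sound ?_⟩
  exact ⟨h, hh, Eventually.of_forall fun q => rfl⟩

/-! ### Cubic perturbations -/

section Cubic

variable {V : Type*} [NormedAddCommGroup V] [NormedSpace ℝ V]

/-- The sum of the values of a trilinear form over the permutations of its arguments. -/
def symSum (T : V →L[ℝ] V →L[ℝ] V →L[ℝ] ℝ) (a b c : V) : ℝ :=
  T a b c + T a c b + T b a c + T b c a + T c a b + T c b a

theorem contDiff_cubic (T : V →L[ℝ] V →L[ℝ] V →L[ℝ] ℝ) : ContDiff ℝ ∞ fun p => T p p p := by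
  fun_prop

namespace Minkowski

theorem dir_cubic (T : V →L[ℝ] V →L[ℝ] V →L[ℝ] ℝ) (a : V) :
    dir a (fun p => T p p p) = fun p => T a p p + T p a p + T p p a := by
  funext p
  refine (congrArg (fun A : V →L[ℝ] ℝ => A a) ((T.hasFDerivAt.clm_apply
    (hasFDerivAt_id p)).clm_apply (hasFDerivAt_id p)).fderiv).trans ?_
  simp
  ring

theorem dir_quadratic (T : V →L[ℝ] V →L[ℝ] V →L[ℝ] ℝ) (a b : V) :
    dir b (fun p => T a p p + T p a p + T p p a) = fun p =>
      T a b p + T a p b + (T b a p + T p a b) + (T b p a + T p b a) := by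
  funext p
  have h1 := ((T a).hasFDerivAt (x := p)).clm_apply (hasFDerivAt_id p)
  have h2 := ((T.hasFDerivAt (x := p)).clm_apply (hasFDerivAt_const a p)).clm_apply
    (hasFDerivAt_id p)
  have h3 := ((T.hasFDerivAt (x := p)).clm_apply (hasFDerivAt_id p)).clm_apply
    (hasFDerivAt_const a p)
  refine (congrArg (fun A : V →L[ℝ] ℝ => A b) ((h1.add h2).add h3).fderiv).trans ?_
  simp
  ring

theorem dir_linear (T : V →L[ℝ] V →L[ℝ] V →L[ℝ] ℝ) (a b c : V) (p : V) :
    dir c (fun p => T a b p + T a p b + (T b a p + T p a b) + (T b p a + T p b a)) p =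
      symSum T a b c := by
  have h1 := (T a b).hasFDerivAt (x := p)
  have h2 := ((T a).hasFDerivAt (x := p)).clm_apply (hasFDerivAt_const b p)
  have h3 := (T b a).hasFDerivAt (x := p)
  have h4 := ((T.hasFDerivAt (x := p)).clm_apply (hasFDerivAt_const a p)).clm_apply
    (hasFDerivAt_const b p)
  have h5 := ((T b).hasFDerivAt (x := p)).clm_apply (hasFDerivAt_const a p)
  have h6 := ((T.hasFDerivAt (x := p)).clm_apply (hasFDerivAt_const b p)).clm_apply
    (hasFDerivAt_const a p)
  refine (congrArg (fun A : V →L[ℝ] ℝ => A c)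
    (((h1.add h2).add (h3.add h4)).add (h5.add h6)).fderiv).trans ?_
  simp [symSum]
  ring

theorem dir_add_smul {X : V → Fin 3 → ℝ} {g : V → ℝ} {p : V} (hX : SmoothNear X p)
    (hg : SmoothNear g p) (w : Fin 3 → ℝ) (a : V) :
    dir a (fun q => X q + g q • w) =ᶠ[𝓝 p] fun q => dir a X q + dir a g q • w := by
  filter_upwards [hX, hg] with q h1 h2
  have h := (h1.differentiableAt (by simp)).hasFDerivAt.add
    ((h2.differentiableAt (by simp)).hasFDerivAt.smul_const w)
  exact congrArg (fun A : V →L[ℝ] (Fin 3 → ℝ) => A a) h.fderiv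

/-- A cubic perturbation changes only the derivatives of order three. -/
theorem dir_add_cubic {X : V → Fin 3 → ℝ} (hX : SmoothNear X 0)
    (T : V →L[ℝ] V →L[ℝ] V →L[ℝ] ℝ) (w : Fin 3 → ℝ) (a b c : V) :
    dir a (fun q => X q + T q q q • w) 0 = dir a X 0 ∧
      dir b (dir a (fun q => X q + T q q q • w)) 0 = dir b (dir a X) 0 ∧
      dir c (dir b (dir a (fun q => X q + T q q q • w))) 0 =
        dir c (dir b (dir a X)) 0 + symSum T a b c • w := by
  have s1 : SmoothNear (fun p => T a p p + T p a p + T p p a) 0 :=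
    ContDiff.smoothNear (by fun_prop)
  have s2 : SmoothNear
      (fun p => T a b p + T a p b + (T b a p + T p a b) + (T b p a + T p b a)) 0 :=
    ContDiff.smoothNear (by fun_prop)
  have h1 := dir_add_smul hX (contDiff_cubic T).smoothNear w a
  rw [dir_cubic] at h1
  have h2 := (dir_congr h1 b).trans (dir_add_smul (smoothNear_dir hX a) s1 w b)
  rw [dir_quadratic] at h2
  have h3 := (dir_congr h2 c).trans (dir_add_smul (smoothNear_dir (smoothNear_dir hX a) b) s2 w c)
  refine ⟨?_, ?_, ?_⟩
  · rw [h1.self_of_nhds]; simp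
  · rw [h2.self_of_nhds]; simp
  · rw [h3.self_of_nhds]; simp only [dir_linear]

theorem _root_.SmoothNear.add_cubic {X : V → Fin 3 → ℝ} (hX : SmoothNear X 0)
    (T : V →L[ℝ] V →L[ℝ] V →L[ℝ] ℝ) (w : Fin 3 → ℝ) :
    SmoothNear (fun q => X q + T q q q • w) 0 :=
  hX.add (ContDiff.smoothNear (by fun_prop))

variable {e : V × V} {σ : ℝ} {X : V → Fin 3 → ℝ}

/-- The lightlike vectors of the frame. -/
def nullA (e : V × V) (σ : ℝ) (X : V → Fin 3 → ℝ) : V :=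
  frameR e σ X 0 • e.1 - frameE e X 0 • e.2

def nullB (e : V × V) (σ : ℝ) (X : V → Fin 3 → ℝ) : V :=
  frameR e σ X 0 • e.2 - frameG e X 0 • e.1

/-- Only third derivatives change, so the frame data at the origin persist, and the derivative of
the second form in direction `c` changes by `ν · symSum T · · c`. The minus sign in the last formula
reflects that `nullM` is minus the second form on the two lightlike vectors. -/
theorem IsFlatFrame.add_cubic (H : IsFlatFrame e σ X 0) (T : V →L[ℝ] V →L[ℝ] V →L[ℝ] ℝ)
    (w : Fin 3 → ℝ) {ν : ℝ} (hν : ν = inner (cross (dir e.1 X 0) (dir e.2 X 0)) w)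
    {Y : V → Fin 3 → ℝ} (hY : Y = fun q => X q + T q q q • w) :
    IsFlatFrame e σ Y 0 ∧ ∀ c,
      fderiv ℝ (nullL e σ Y) 0 c =
        fderiv ℝ (nullL e σ X) 0 c + ν * symSum T (nullA e σ X) (nullA e σ X) c ∧
      fderiv ℝ (nullN e σ Y) 0 c =
        fderiv ℝ (nullN e σ X) 0 c + ν * symSum T (nullB e σ X) (nullB e σ X) c ∧
      fderiv ℝ (nullM e σ Y) 0 c =
        fderiv ℝ (nullM e σ X) 0 c - ν * symSum T (nullA e σ X) (nullB e σ X) c := by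
  have hsm : SmoothNear Y 0 := by rw [hY]; exact H.smooth.add_cubic T w
  have d1 : ∀ a, dir a Y 0 = dir a X 0 := fun a => by
    rw [hY]; exact (dir_add_cubic H.smooth T w a 0 0).1
  have d2 : ∀ a b, dir b (dir a Y) 0 = dir b (dir a X) 0 := fun a b => by
    rw [hY]; exact (dir_add_cubic H.smooth T w a b 0).2.1
  have d3 : ∀ a b c, dir c (dir b (dir a Y)) 0 = dir c (dir b (dir a X)) 0 + symSum T a b c • w :=
    fun a b c => by rw [hY]; exact (dir_add_cubic H.smooth T w a b c).2.2
  have eE : frameE e Y 0 = frameE e X 0 := by simp only [frameE, d1]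
  have eF : frameF e Y 0 = frameF e X 0 := by simp only [frameF, d1]
  have eG : frameG e Y 0 = frameG e X 0 := by simp only [frameG, d1]
  have eδ : frameDelta e Y 0 = frameDelta e X 0 := by simp only [frameDelta, eE, eF, eG]
  have eR : frameR e σ Y 0 = frameR e σ X 0 := by simp only [frameR, eF, eδ]
  have eS : ∀ a b, frameSnd e Y 0 a b = frameSnd e X 0 a b := fun a b => by
    simp only [frameSnd, d1, d2]
  have eD : ∀ a b c, dSnd e Y 0 a b c = dSnd e X 0 a b c + ν * symSum T a b c := by
    intro a b c
    simp only [dSnd, dir_frameSnd hsm, dir_frameSnd H.smooth, d1, d2, d3, hν]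
    simp only [inner_add_right, inner_smul_right]
    ring
  have HY : IsFlatFrame e σ Y 0 :=
    ⟨hsm, H.sign, eδ ▸ H.delta_pos, by simpa only [SndVanishes, eS] using H.snd, eR ▸ H.R_ne⟩
  refine ⟨HY, fun c => ⟨?_, ?_, ?_⟩⟩
  · have h1 := dir_nullL (σ := σ) hsm HY.delta_pos HY.snd c
    have h2 := dir_nullL (σ := σ) H.smooth H.delta_pos H.snd c
    rw [dir] at h1 h2
    rw [h1, h2]
    simp only [dNullL, eR, eE, eD, symSum, nullA, map_sub, map_smul,
      sub_apply, smul_apply, smul_eq_mul]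
    ring
  · have h1 := dir_nullN (σ := σ) hsm HY.delta_pos HY.snd c
    have h2 := dir_nullN (σ := σ) H.smooth H.delta_pos H.snd c
    rw [dir] at h1 h2
    rw [h1, h2]
    simp only [dNullN, eR, eG, eD, symSum, nullB, map_sub, map_smul,
      sub_apply, smul_apply, smul_eq_mul]
    ring
  · have h1 := dir_nullM (σ := σ) hsm HY.delta_pos HY.snd c
    have h2 := dir_nullM (σ := σ) H.smooth H.delta_pos H.snd c
    have hR := frameR_sq H.sign H.delta_pos.le
    rw [dir] at h1 h2
    rw [h1, h2]
    simp only [dNullM, eR, eE, eF, eG, eD, nullA, nullB]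
    have hsym : symSum T (frameR e σ X 0 • e.1 - frameE e X 0 • e.2)
        (frameR e σ X 0 • e.2 - frameG e X 0 • e.1) c =
        (frameR e σ X 0 ^ 2 + frameE e X 0 * frameG e X 0) * symSum T e.1 e.2 c
          - frameR e σ X 0 * frameG e X 0 * symSum T e.1 e.1 c
          - frameR e σ X 0 * frameE e X 0 * symSum T e.2 e.2 c := by
      simp only [symSum, map_sub, map_smul,
        sub_apply, smul_apply, smul_eq_mul]
      ring
    rw [hsym]
    linear_combination ν * symSum T e.1 e.2 c * hR

/-- The determinant of the two lightlike vectors equals `2Rσ√δ`. -/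
theorem IsFlatFrame.det_ne_zero (H : IsFlatFrame e σ X 0) :
    frameR e σ X 0 ^ 2 - frameE e X 0 * frameG e X 0 ≠ 0 := by
  have hR := frameR_sq H.sign H.delta_pos.le
  have h1 : frameR e σ X 0 ^ 2 - frameE e X 0 * frameG e X 0 =
      2 * frameR e σ X 0 * (σ * √(frameDelta e X 0)) := by
    have : frameR e σ X 0 = frameF e X 0 + σ * √(frameDelta e X 0) := rfl
    have h2 : σ * √(frameDelta e X 0) = frameR e σ X 0 - frameF e X 0 := by linarith
    rw [h2]
    linear_combination -hR
  rw [h1]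
  have hσ : σ ≠ 0 := by
    rintro rfl
    simpa using H.sign
  have := H.R_ne
  have := Real.sqrt_pos.2 H.delta_pos
  positivity

/-- The tensor product of three linear forms. -/
def tensor₃ (φ ψ χ : V →L[ℝ] ℝ) : V →L[ℝ] V →L[ℝ] V →L[ℝ] ℝ := φ.smulRight (ψ.smulRight χ)

theorem tensor₃_apply (φ ψ χ : V →L[ℝ] ℝ) (a b c : V) : tensor₃ φ ψ χ a b c = φ a * (ψ b * χ c) :=
  rfl

set_option maxSynthPendingDepth 3 in
/-- The cubic form `a ξ³ + 3 ξ² η + 3 ξ η² + b η³`, up to a factor, as a trilinear form. -/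
def cubicTensor (ξ η : V →L[ℝ] ℝ) (a b : ℝ) : V →L[ℝ] V →L[ℝ] V →L[ℝ] ℝ :=
  (a / 6) • tensor₃ ξ ξ ξ + (1 / 2 : ℝ) • tensor₃ ξ ξ η + (1 / 2 : ℝ) • tensor₃ ξ η η +
    (b / 6) • tensor₃ η η η

/-- The linear form with the given coefficients. -/
def planeForm (a b : ℝ) : ℝ × ℝ →L[ℝ] ℝ :=
  a • ContinuousLinearMap.fst ℝ ℝ ℝ + b • ContinuousLinearMap.snd ℝ ℝ ℝ

theorem planeForm_eval (a b : ℝ) (v : ℝ × ℝ) : planeForm a b v = a * v.1 + b * v.2 := rfl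

/-- The linear forms dual to the lightlike vectors. -/
theorem IsFlatFrame.exists_dual {x : ℝ × ℝ → Fin 3 → ℝ} (H : IsFlatFrame planeFrame σ x 0) :
    ∃ ξ η : ℝ × ℝ →L[ℝ] ℝ, ξ (nullA planeFrame σ x) = 1 ∧ ξ (nullB planeFrame σ x) = 0 ∧
      η (nullA planeFrame σ x) = 0 ∧ η (nullB planeFrame σ x) = 1 ∧ wedge ξ η ≠ 0 := by
  have hD := H.det_ne_zero
  set R := frameR planeFrame σ x 0 with hR
  set E := frameE planeFrame x 0 with hE
  set G := frameG planeFrame x 0 with hG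
  have hA : nullA planeFrame σ x = (R, -E) := by
    simp only [nullA, ← hR, ← hE]; simp [planeFrame]
  have hB : nullB planeFrame σ x = (-G, R) := by
    simp only [nullB, ← hR, ← hG]; simp [planeFrame]
  refine ⟨planeForm (R / (R ^ 2 - E * G)) (G / (R ^ 2 - E * G)),
    planeForm (E / (R ^ 2 - E * G)) (R / (R ^ 2 - E * G)), ?_, ?_, ?_, ?_, ?_⟩
  · rw [hA, planeForm_eval]; field_simp; ring
  · rw [hB, planeForm_eval]; field_simp; ring
  · rw [hA, planeForm_eval]; field_simp; ring
  · rw [hB, planeForm_eval]; field_simp; ring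
  · have : wedge (planeForm (R / (R ^ 2 - E * G)) (G / (R ^ 2 - E * G)))
        (planeForm (E / (R ^ 2 - E * G)) (R / (R ^ 2 - E * G))) = (R ^ 2 - E * G)⁻¹ := by
      simp only [wedge, planeForm_eval]
      field_simp
      ring
    rw [this]
    exact inv_ne_zero hD

theorem wedge_combination (ξ η : ℝ × ℝ →L[ℝ] ℝ) (a b c d : ℝ) :
    wedge (a • ξ + b • η) (c • ξ + d • η) = (a * d - b * c) * wedge ξ η := by
  simp only [wedge, add_apply, smul_apply, smul_eq_mul]
  ring

/-- Coefficients of cubic forms with the given configuration. -/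
theorem _root_.Configuration.exists_coeff (k : Configuration) : ∃ a b : ℝ, a * b - 1 ≠ 0 ∧
    (b - 1) * (a - 1) / (a * b - 1) ^ 2 ∈ k.range := by
  cases k
  · exact ⟨1 / 2, 1 / 2, by norm_num, by norm_num [Configuration.range]⟩
  · exact ⟨2, 2, by norm_num, by norm_num [Configuration.range]⟩
  · exact ⟨2, -2, by norm_num, by norm_num [Configuration.range]⟩

set_option maxSynthPendingDepth 3 in
-- In the basis dual to the lightlike vectors, `cubicTensor` has polarisations `l = aξ + η`, `n = ξ
-- + bη` and `m = -(ξ + η)`, whose cross ratio is `(a - 1)(b - 1)/(ab - 1)²`. Suitable `a`, `b` give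
-- values in each of the three ranges.
theorem IsFlatFrame.exists_cubic {x : ℝ × ℝ → Fin 3 → ℝ} (H : IsFlatFrame planeFrame σ x 0)
    (k : Configuration) :
    ∃ (T : ℝ × ℝ →L[ℝ] ℝ × ℝ →L[ℝ] ℝ × ℝ →L[ℝ] ℝ) (l n m : ℝ × ℝ →L[ℝ] ℝ),
      (∀ c, symSum T (nullA planeFrame σ x) (nullA planeFrame σ x) c = l c ∧
        symSum T (nullB planeFrame σ x) (nullB planeFrame σ x) c = n c ∧
        symSum T (nullA planeFrame σ x) (nullB planeFrame σ x) c = -m c) ∧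
      wedge l n ≠ 0 ∧ crossRatio l n m ∈ k.range := by
  obtain ⟨ξ, η, h1, h2, h3, h4, h5⟩ := H.exists_dual
  obtain ⟨a, b, hab, hk⟩ := k.exists_coeff
  refine ⟨cubicTensor ξ η a b, a • ξ + (1 : ℝ) • η, (1 : ℝ) • ξ + b • η,
    (-1 : ℝ) • ξ + (-1 : ℝ) • η, fun c => ?_, ?_, ?_⟩
  · simp only [symSum, cubicTensor, add_apply, smul_apply,
      tensor₃_apply, h1, h2, h3, h4, smul_eq_mul]
    refine ⟨?_, ?_, ?_⟩ <;> ring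
  · rw [wedge_combination]
    exact mul_ne_zero (by rwa [mul_one]) h5
  · have : crossRatio (a • ξ + (1 : ℝ) • η) ((1 : ℝ) • ξ + b • η)
        ((-1 : ℝ) • ξ + (-1 : ℝ) • η) = (b - 1) * (a - 1) / (a * b - 1) ^ 2 := by
      rw [crossRatio, wedge_combination, wedge_combination, wedge_combination, mul_one (1 : ℝ),
        div_eq_div_iff (pow_ne_zero 2 (mul_ne_zero hab h5)) (pow_ne_zero 2 hab)]
      ring
    rwa [this]

end Minkowski

end Cubic

/-! ### General position after a perturbation -/

theorem eventually_quartic_ne_zero {c₀ c₁ c₂ c₃ c₄ : ℝ} (h : c₂ ≠ 0 ∨ c₄ ≠ 0) :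
    ∀ᶠ ε in 𝓝[≠] (0 : ℝ), c₀ + c₁ * ε + c₂ * ε ^ 2 + c₃ * ε ^ 3 + c₄ * ε ^ 4 ≠ 0 := by
  open Polynomial in
  set P : ℝ[X] := C c₀ + C c₁ * X + C c₂ * X ^ 2 + C c₃ * X ^ 3 + C c₄ * X ^ 4 with hP
  have hP0 : P ≠ 0 := by
    intro h0
    have h2 := congrArg (fun Q : ℝ[X] => Q.coeff 2) h0
    have h4 := congrArg (fun Q : ℝ[X] => Q.coeff 4) h0
    simp [hP] at h2 h4
    exact h.elim (fun h => h h2) fun h => h h4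
  have hfin : (↑P.roots.toFinset : Set ℝ)ᶜ ∪ {0} ∈ 𝓝 (0 : ℝ) := by
    have : ((↑P.roots.toFinset : Set ℝ) \ {0})ᶜ ∈ 𝓝 (0 : ℝ) :=
      ((P.roots.toFinset.finite_toSet.subset Set.sdiff_subset).isClosed.isOpen_compl).mem_nhds
        (by simp)
    refine Filter.mem_of_superset this fun ε hε => ?_
    by_cases h : ε = 0
    · exact Or.inr h
    · exact Or.inl fun h' => hε ⟨h', h⟩
  filter_upwards [nhdsWithin_le_nhds hfin, self_mem_nhdsWithin] with ε h1 h2 h3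
  rcases h1 with h1 | h1
  · apply h1
    have : P.eval ε = 0 := by simpa [hP] using h3
    simpa [hP0] using this
  · exact h2 h1

theorem wedge_add_smul (A A' B B' : ℝ × ℝ →L[ℝ] ℝ) (ε : ℝ) :
    wedge (A + ε • A') (B + ε • B') =
      wedge A B + (wedge A B' + wedge A' B) * ε + wedge A' B' * ε ^ 2 := by
  simp only [wedge, add_apply, smul_apply, smul_eq_mul]
  ring

/-- Every condition is the nonvanishing of a polynomial in `ε`, quadratic for the `wedge`s and
quartic for the discriminant. The top coefficient is the same expression in `l'`, `n'`, `m'`, hence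
nonzero. -/
theorem GeneralPosition.eventually_add_smul {l' n' m' : ℝ × ℝ →L[ℝ] ℝ}
    (h : GeneralPosition l' n' m') (l n m : ℝ × ℝ →L[ℝ] ℝ) :
    ∀ᶠ ε in 𝓝[≠] (0 : ℝ), GeneralPosition (l + ε • l') (n + ε • n') (m + ε • m') := by
  have hquad : ∀ {c₀ c₁ c₂ : ℝ}, c₂ ≠ 0 → ∀ᶠ ε in 𝓝[≠] (0 : ℝ), c₀ + c₁ * ε + c₂ * ε ^ 2 ≠ 0 :=
    fun {c₀ c₁ c₂} hc => (eventually_quartic_ne_zero (c₀ := c₀) (c₁ := c₁) (c₃ := 0) (c₄ := 0)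
      (Or.inl hc)).mono fun ε hε => by simpa using hε
  have hd : wedge l' n' ^ 2 - 4 * (wedge m' n' * wedge l' m') ≠ 0 := sub_ne_zero.2 h.disc
  have hquart := eventually_quartic_ne_zero
    (c₀ := wedge l n ^ 2 - 4 * (wedge m n * wedge l m))
    (c₁ := 2 * wedge l n * (wedge l n' + wedge l' n) - 4 * (wedge m n * (wedge l m' + wedge l' m) +
      (wedge m n' + wedge m' n) * wedge l m))
    (c₂ := (wedge l n' + wedge l' n) ^ 2 + 2 * wedge l n * wedge l' n' - 4 * (wedge m n * wedge l' m'
      + (wedge m n' + wedge m' n) * (wedge l m' + wedge l' m) + wedge m' n' * wedge l m))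
    (c₃ := 2 * (wedge l n' + wedge l' n) * wedge l' n' - 4 * ((wedge m n' + wedge m' n) *
      wedge l' m' + wedge m' n' * (wedge l m' + wedge l' m)))
    (Or.inr hd)
  filter_upwards [hquad h.ln, hquad h.mn, hquad h.lm, hquart] with ε h1 h2 h3 h4
  refine ⟨?_, ?_, ?_, fun h0 => h4 ?_⟩
  · rw [wedge_add_smul]; exact h1
  · rw [wedge_add_smul]; exact h2
  · rw [wedge_add_smul]; exact h3
  · rw [wedge_add_smul, wedge_add_smul, wedge_add_smul] at h0
    linear_combination h0

/-! ### Generic families -/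

namespace Minkowski

/-- The coefficients solve the Gram system of `u`, `v`. The contrapositive shows that a vector
transverse to the surface has a nonzero product with the normal. -/
theorem exists_eq_add_of_inner_cross_eq_zero {u v w : Fin 3 → ℝ}
    (hδ : inner (cross u v) (cross u v) ≠ 0) (hw : inner (cross u v) w = 0) :
    ∃ α β : ℝ, w = α • u + β • v := by
  have hd := inner_cross_self u v
  set d := inner (cross u v) (cross u v) with hd'
  refine ⟨(inner w v * inner u v - inner w u * inner v v) / d,
    (inner w u * inner u v - inner w v * inner u u) / d, ?_⟩
  refine sub_eq_zero.1 (eq_zero_of_inner_eq_zero hδ ?_ ?_ ?_)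
  · have : ∀ α β : ℝ, inner (w - (α • u + β • v)) u =
        inner w u - α * inner u u - β * inner u v := fun α β => by simp [inner]; ring
    rw [this]
    field_simp
    rw [hd]
    ring
  · have : ∀ α β : ℝ, inner (w - (α • u + β • v)) v =
        inner w v - α * inner u v - β * inner v v := fun α β => by simp [inner]; ring
    rw [this]
    field_simp
    rw [hd]
    ring
  · have : ∀ α β : ℝ, inner (w - (α • u + β • v)) (cross u v) =
        inner (cross u v) w - α * inner (cross u v) u - β * inner (cross u v) v :=
      fun α β => by simp [inner]; ring
    rw [this, hw, inner_cross_left, inner_cross_right]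
    simp

theorem eventually_frame_initial {X : (ℝ × ℝ) × ℝ → Fin 3 → ℝ} {x : ℝ × ℝ → Fin 3 → ℝ}
    (hX : SmoothNear X 0) (h0 : ∀ᶠ q in 𝓝 (0 : ℝ × ℝ), X (q, 0) = x q) :
    ∀ᶠ q in 𝓝 (0 : ℝ × ℝ),
      frameE familyFrame X (q, 0) = frameE planeFrame x q ∧
      frameF familyFrame X (q, 0) = frameF planeFrame x q ∧
      frameG familyFrame X (q, 0) = frameG planeFrame x q ∧
      frameSnd familyFrame X (q, 0) familyFrame.1 familyFrame.1 =
        frameSnd planeFrame x q planeFrame.1 planeFrame.1 ∧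
      frameSnd familyFrame X (q, 0) familyFrame.1 familyFrame.2 =
        frameSnd planeFrame x q planeFrame.1 planeFrame.2 ∧
      frameSnd familyFrame X (q, 0) familyFrame.2 familyFrame.2 =
        frameSnd planeFrame x q planeFrame.2 planeFrame.2 := by
  have ht : Tendsto (fun q : ℝ × ℝ => (q, (0 : ℝ))) (𝓝 0) (𝓝 0) := by
    have : Continuous fun q : ℝ × ℝ => (q, (0 : ℝ)) := by fun_prop
    exact this.tendsto 0
  filter_upwards [ht.eventually (eventually_frame_slice hX), eventually_eventually_nhds.2 h0]
    with q ⟨h1, h2, h3, h4, h5, h6⟩ hq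
  obtain ⟨g1, g2, g3, g4⟩ := frame_congr (p := q) hq planeFrame
  exact ⟨h1.symm.trans g1, h2.symm.trans g2, h3.symm.trans g3, h4.symm.trans (g4 _ _),
    h5.symm.trans (g4 _ _), h6.symm.trans (g4 _ _)⟩

theorem planePart_fderiv {f : (ℝ × ℝ) × ℝ → ℝ} {g : ℝ × ℝ → ℝ} (hf : DifferentiableAt ℝ f 0)
    (h : ∀ᶠ q in 𝓝 (0 : ℝ × ℝ), f (q, 0) = g q) : planePart (fderiv ℝ f 0) = fderiv ℝ g 0 := by
  have h1 : HasFDerivAt (fun q : ℝ × ℝ => f (q, 0))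
      ((fderiv ℝ f 0).comp (ContinuousLinearMap.inl ℝ (ℝ × ℝ) ℝ)) 0 :=
    HasFDerivAt.comp (0 : ℝ × ℝ) (f := fun q : ℝ × ℝ => (q, (0 : ℝ))) hf.hasFDerivAt
      (hasFDerivAt_prodMk_left 0 0)
  exact (h1.congr_of_eventuallyEq (h.mono fun q hq => hq.symm)).fderiv.symm

variable {σ : ℝ} {X : (ℝ × ℝ) × ℝ → Fin 3 → ℝ} {x : ℝ × ℝ → Fin 3 → ℝ}

theorem IsFlatFrame.family (H : IsFlatFrame planeFrame σ x 0) (hX : SmoothNear X 0)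
    (h0 : ∀ᶠ q in 𝓝 (0 : ℝ × ℝ), X (q, 0) = x q) :
    IsFlatFrame familyFrame σ X 0 ∧
      planePart (fderiv ℝ (nullL familyFrame σ X) 0) = fderiv ℝ (nullL planeFrame σ x) 0 ∧
      planePart (fderiv ℝ (nullN familyFrame σ X) 0) = fderiv ℝ (nullN planeFrame σ x) 0 ∧
      planePart (fderiv ℝ (nullM familyFrame σ X) 0) = fderiv ℝ (nullM planeFrame σ x) 0 ∧
      nullA familyFrame σ X = (nullA planeFrame σ x, 0) ∧
      nullB familyFrame σ X = (nullB planeFrame σ x, 0) := by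
  have hev := eventually_frame_initial hX h0
  obtain ⟨e1, e2, e3, e4, e5, e6⟩ := hev.self_of_nhds
  change frameE familyFrame X 0 = _ at e1
  change frameF familyFrame X 0 = _ at e2
  change frameG familyFrame X 0 = _ at e3
  change frameSnd familyFrame X 0 _ _ = _ at e4
  change frameSnd familyFrame X 0 _ _ = _ at e5
  change frameSnd familyFrame X 0 _ _ = _ at e6
  have eδ : frameDelta familyFrame X 0 = frameDelta planeFrame x 0 := by
    simp only [frameDelta, e1, e2, e3]
  have eR : frameR familyFrame σ X 0 = frameR planeFrame σ x 0 := by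
    simp only [frameR, eδ, e2]
  have HX : IsFlatFrame familyFrame σ X 0 :=
    ⟨hX, H.sign, eδ ▸ H.delta_pos, by simpa only [SndVanishes, e4, e5, e6] using H.snd,
      eR ▸ H.R_ne⟩
  refine ⟨HX, planePart_fderiv (smoothNear_nullL hX HX.delta_pos).differentiableAt ?_,
    planePart_fderiv (smoothNear_nullN hX HX.delta_pos).differentiableAt ?_,
    planePart_fderiv (smoothNear_nullM hX HX.delta_pos).differentiableAt ?_, ?_, ?_⟩
  · filter_upwards [hev] with q ⟨h1, h2, h3, h4, h5, h6⟩
    simp only [nullL, frameR, frameDelta, h1, h2, h3, h4, h5, h6]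
  · filter_upwards [hev] with q ⟨h1, h2, h3, h4, h5, h6⟩
    simp only [nullN, frameR, frameDelta, h1, h2, h3, h4, h5, h6]
  · filter_upwards [hev] with q ⟨h1, h2, h3, h4, h5, h6⟩
    simp only [nullM, frameMcnc, frameR, frameDelta, h1, h2, h3, h4, h5, h6]
  · simp only [nullA, eR, e1]
    simp [familyFrame, planeFrame]
  · simp only [nullB, eR, e3]
    simp [familyFrame, planeFrame]

theorem dir_initial (hX : SmoothNear X 0) (h0 : ∀ᶠ q in 𝓝 (0 : ℝ × ℝ), X (q, 0) = x q)
    (a : ℝ × ℝ) : dir (a, (0 : ℝ)) X 0 = dir a x 0 := by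
  have h1 := (eventually_dir_slice hX a).self_of_nhds
  rw [← h1]
  exact (dir_congr (X := fun q => X (q, (0 : ℝ))) h0 a).self_of_nhds

/-- The determinant of the differentials at the origin of the three functions of the family. -/
def familyDet (σ : ℝ) (X : (ℝ × ℝ) × ℝ → Fin 3 → ℝ) : ℝ :=
  wedge₃ (fderiv ℝ (nullL familyFrame σ X) 0) (fderiv ℝ (nullN familyFrame σ X) 0)
    (fderiv ℝ (nullM familyFrame σ X) 0)

/-- The cubic form is `t ξ η`, with `ξ`, `η` dual to the lightlike vectors. It vanishes for `t = 0`,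
leaves `dL` and `dN` unchanged and alters only the `t`-component of `dM`, by `-ν`. -/
theorem IsFlatFrame.exists_familyDet_add (H : IsFlatFrame planeFrame σ x 0) :
    ∃ T : (ℝ × ℝ) × ℝ →L[ℝ] (ℝ × ℝ) × ℝ →L[ℝ] (ℝ × ℝ) × ℝ →L[ℝ] ℝ,
      (∀ q : ℝ × ℝ, T (q, 0) (q, 0) (q, 0) = 0) ∧
      ∀ X : (ℝ × ℝ) × ℝ → Fin 3 → ℝ, SmoothNear X 0 →
        (∀ᶠ q in 𝓝 (0 : ℝ × ℝ), X (q, 0) = x q) → ∀ w : Fin 3 → ℝ,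
        familyDet σ (fun p => X p + T p p p • w) = familyDet σ X -
          inner (cross (dir (1, 0) x 0) (dir (0, 1) x 0)) w *
            wedge (fderiv ℝ (nullL planeFrame σ x) 0) (fderiv ℝ (nullN planeFrame σ x) 0) := by
  obtain ⟨ξ, η, h1, h2, h3, h4, -⟩ := H.exists_dual
  refine ⟨tensor₃ (ContinuousLinearMap.snd ℝ (ℝ × ℝ) ℝ)
    (ξ.comp (ContinuousLinearMap.fst ℝ (ℝ × ℝ) ℝ)) (η.comp (ContinuousLinearMap.fst ℝ (ℝ × ℝ) ℝ)),
    fun q => by simp [tensor₃_apply], fun X hX h0 w => ?_⟩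
  obtain ⟨HX, pL, pN, pM, eA, eB⟩ := H.family hX h0
  generalize hYe : (fun p => X p + tensor₃ (ContinuousLinearMap.snd ℝ (ℝ × ℝ) ℝ)
    (ξ.comp (ContinuousLinearMap.fst ℝ (ℝ × ℝ) ℝ))
    (η.comp (ContinuousLinearMap.fst ℝ (ℝ × ℝ) ℝ)) p p p • w) = Y
  obtain ⟨-, hY⟩ := HX.add_cubic _ w rfl hYe.symm
  have hν : inner (cross (dir familyFrame.1 X 0) (dir familyFrame.2 X 0)) w =
      inner (cross (dir (1, 0) x 0) (dir (0, 1) x 0)) w := by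
    rw [← dir_initial hX h0, ← dir_initial hX h0]
    rfl
  rw [eA, eB, hν] at hY
  set ν := inner (cross (dir (1, 0) x 0) (dir (0, 1) x 0)) w
  simp only [symSum, tensor₃_apply, ContinuousLinearMap.comp_apply,
    ContinuousLinearMap.coe_fst', ContinuousLinearMap.coe_snd', h1, h2, h3, h4] at hY
  rw [← pL, ← pN]
  simp only [familyDet, wedge₃, wedge, planePart_apply, hY]
  ring

/-- The initial surface is fixed, so the origin remains a flat point of every deformation, with the
same `σ`. The differentials are therefore given by the formulas in the 3-jet. -/
theorem continuous_familyDet {x : LocalParam} (H : IsFlatFrame planeFrame σ x.toFun 0) :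
    Continuous fun X : Deformation x => familyDet σ X.toFun := by
  obtain ⟨-, -, hL, hN, hM⟩ := continuous_dNull (Deformation.continuous_jets (x := x))
    (fun X => X.smooth) familyFrame σ
  have HX := fun X : Deformation x => (H.family X.smooth X.at_zero).1
  have cL : ∀ c, Continuous fun X : Deformation x => fderiv ℝ (nullL familyFrame σ X.toFun) 0 c :=
    fun c => (hL c).congr fun X => (dir_nullL X.smooth (HX X).delta_pos (HX X).snd c).symm
  have cN : ∀ c, Continuous fun X : Deformation x => fderiv ℝ (nullN familyFrame σ X.toFun) 0 c :=
    fun c => (hN c).congr fun X => (dir_nullN X.smooth (HX X).delta_pos (HX X).snd c).symm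
  have cM : ∀ c, Continuous fun X : Deformation x => fderiv ℝ (nullM familyFrame σ X.toFun) 0 c :=
    fun c => (hM c).congr fun X => (dir_nullM X.smooth (HX X).delta_pos (HX X).snd c).symm
  simp only [familyDet, wedge₃, wedge, planePart_apply]
  have a1 := cL ((1, 0), 0); have a2 := cL ((0, 1), 0); have a3 := cL (0, 1)
  have b1 := cN ((1, 0), 0); have b2 := cN ((0, 1), 0); have b3 := cN (0, 1)
  have c1 := cM ((1, 0), 0); have c2 := cM ((0, 1), 0); have c3 := cM (0, 1)
  fun_prop

end Minkowski

/-- A criterion for the density of a set in a space of germs. -/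
theorem mem_closure_of_jets {S V W : Type*} [TopologicalSpace S] [NormedAddCommGroup V]
    [NormedSpace ℝ V] [NormedAddCommGroup W] [NormedSpace ℝ W] {F : S → V → W}
    (hF : IsInducing fun s => jets (F s)) {g : V → W} (hg : SmoothNear g 0) {a : S}
    (ha : SmoothNear (F a) 0) {f : ℝ → S} (hf : ∀ ε, F (f ε) = fun p => F a p + ε • g p)
    {O : Set S} (hO : ∀ᶠ ε in 𝓝[≠] (0 : ℝ), f ε ∈ O) : a ∈ closure O := by
  have hc : Continuous fun ε : ℝ => jets (fun p => F a p + ε • g p) :=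
    continuous_jets_add continuous_const (continuous_jets_smul hg) (fun _ => ha)
      fun ε => hg.mono fun q hq => contDiffAt_const.smul hq
  refine mem_closure_of_tendsto (b := 𝓝[≠] (0 : ℝ)) (f := f) (hF.tendsto_nhds_iff.2 ?_) hO
  have h0 := (hc.tendsto 0).mono_left (nhdsWithin_le_nhds (s := {0}ᶜ))
  simp only [zero_smul, add_zero] at h0
  exact h0.congr fun ε => by rw [Function.comp_apply, hf]

/-- Addition of a cubic form that vanishes for `t = 0`. -/
def Deformation.addCubic {x : LocalParam} (X : Deformation x)
    (T : (ℝ × ℝ) × ℝ →L[ℝ] (ℝ × ℝ) × ℝ →L[ℝ] (ℝ × ℝ) × ℝ →L[ℝ] ℝ)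
    (hT : ∀ q : ℝ × ℝ, T (q, 0) (q, 0) (q, 0) = 0) (w : Fin 3 → ℝ) : Deformation x where
  toFun p := X.toFun p + T p p p • w
  smooth := X.smooth.add_cubic T w
  at_zero := X.at_zero.mono fun q hq => by simp [hT, hq]

def Perturbation.addCubic (h : Perturbation)
    (T : (ℝ × ℝ) × ℝ →L[ℝ] (ℝ × ℝ) × ℝ →L[ℝ] (ℝ × ℝ) × ℝ →L[ℝ] ℝ)
    (hT : ∀ q : ℝ × ℝ, T (q, 0) (q, 0) (q, 0) = 0) (ε : ℝ) : Perturbation where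
  toFun p := h.toFun p + ε • T p p p
  smooth := h.smooth.add (ContDiff.smoothNear (by fun_prop))
  at_zero := h.at_zero.mono fun q hq => by simp [hT, hq]

theorem continuous_graphDeformation (x : LocalParam) (w : Fin 3 → ℝ) :
    Continuous (graphDeformation x w) := by
  refine continuous_induced_rng.2 ?_
  refine continuous_jets_add (f := fun _ (p : (ℝ × ℝ) × ℝ) => x.toFun p.1)
    (g := fun (h : Perturbation) p => h.toFun p • w)
    continuous_const ?_ ?_ ?_
  · exact continuous_jets_clm Perturbation.continuous_jets (fun h => h.smooth)
      (ContinuousLinearMap.toSpanSingleton ℝ w)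
  · exact fun _ => SmoothNear.comp (g := x.toFun) x.smooth contDiff_fst.smoothNear
  · exact fun h => SmoothNear.comp (g := fun s : ℝ => s • w)
      (ContDiff.smoothNear (by fun_prop)) h.smooth

open Minkowski in
-- The generic set is `familyDet ≠ 0`. At a family with zero determinant, an arbitrarily small
-- multiple of the cubic form `t ξ η` in a transverse direction makes it nonzero; the same
-- perturbation can be made on the function `h`.
theorem forGenericFamilies {x : LocalParam} {σ : ℝ} (H : IsFlatFrame planeFrame σ x.toFun 0)
    {k : Configuration}
    (hln : wedge (fderiv ℝ (nullL planeFrame σ x.toFun) 0)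
      (fderiv ℝ (nullN planeFrame σ x.toFun) 0) ≠ 0)
    (hk : crossRatio (fderiv ℝ (nullL planeFrame σ x.toFun) 0)
      (fderiv ℝ (nullN planeFrame σ x.toFun) 0)
      (fderiv ℝ (nullM planeFrame σ x.toFun) 0) ∈ k.range) :
    ForGenericFamilies x (DeformsAs k) := by
  obtain ⟨T, hT, hdet⟩ := H.exists_familyDet_add
  have hδ : inner (cross (dir (1, 0) x.toFun 0) (dir (0, 1) x.toFun 0))
      (cross (dir (1, 0) x.toFun 0) (dir (0, 1) x.toFun 0)) ≠ 0 := by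
    rw [inner_cross_self]
    exact H.delta_pos.ne'
  have hO : IsOpen {X : Deformation x | familyDet σ X.toFun ≠ 0} :=
    isOpen_ne.preimage (continuous_familyDet H)
  have hstep : ∀ (X : Deformation x) (w : Fin 3 → ℝ),
      inner (cross (dir (1, 0) x.toFun 0) (dir (0, 1) x.toFun 0)) w ≠ 0 →
      familyDet σ X.toFun = 0 → ∀ ε : ℝ, ε ≠ 0 →
      familyDet σ (fun p => X.toFun p + T p p p • (ε • w)) ≠ 0 := by
    intro X w hw hX ε hε
    rw [hdet X.toFun X.smooth X.at_zero, hX, zero_sub, inner_smul_right]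
    exact neg_ne_zero.2 (mul_ne_zero (mul_ne_zero hε hw) hln)
  refine ⟨{X | familyDet σ X.toFun ≠ 0}, hO, fun X => ?_, fun w hw => ⟨?_, fun h => ?_⟩,
    fun X hX => ?_⟩
  · by_cases hX : familyDet σ X.toFun = 0
    · refine mem_closure_of_jets (F := fun X : Deformation x => X.toFun) ⟨rfl⟩
        (g := fun p => T p p p • cross (dir (1, 0) x.toFun 0) (dir (0, 1) x.toFun 0))
        (ContDiff.smoothNear (by fun_prop)) X.smooth
        (f := fun ε => X.addCubic T hT
          (ε • cross (dir (1, 0) x.toFun 0) (dir (0, 1) x.toFun 0)))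
        (fun ε => ?_) ?_
      · funext p
        simp only [Deformation.addCubic, smul_comm (T p p p) ε]
      · filter_upwards [self_mem_nhdsWithin] with ε hε
        exact hstep X _ hδ hX ε hε
    · exact subset_closure hX
  · exact hO.preimage (continuous_graphDeformation x w)
  · have hw' : inner (cross (dir (1, 0) x.toFun 0) (dir (0, 1) x.toFun 0)) w ≠ 0 := by
      intro h0
      obtain ⟨α, β, hαβ⟩ := exists_eq_add_of_inner_cross_eq_zero hδ h0
      refine hw ⟨(α, β), ?_⟩
      rw [clm_plane_apply, hαβ]
      rfl
    by_cases hX : familyDet σ (graphDeformation x w h).toFun = 0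
    · refine mem_closure_of_jets (F := fun h : Perturbation => h.toFun) ⟨rfl⟩
        (g := fun p => T p p p) (contDiff_cubic T).smoothNear h.smooth
        (f := fun ε => h.addCubic T hT ε) (fun ε => rfl) ?_
      filter_upwards [self_mem_nhdsWithin] with ε hε
      have := hstep (graphDeformation x w h) w hw' hX ε hε
      have he : (fun p => (graphDeformation x w h).toFun p + T p p p • (ε • w)) =
          (graphDeformation x w (h.addCubic T hT ε)).toFun := by
        funext p
        simp only [graphDeformation, Perturbation.addCubic, add_smul, smul_smul, smul_eq_mul,
          add_assoc, mul_comm]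
      rw [he] at this
      exact this
    · exact subset_closure hX
  · obtain ⟨HX, pL, pN, pM, -, -⟩ := H.family X.smooth X.at_zero
    exact deformsAs_of_mem_range HX rfl rfl rfl (by rwa [pL, pN]) (by rwa [pL, pN, pM]) hX

/-! ### Open conditions on the jets -/

namespace Minkowski

/-- The differentials of `nullL`, `nullN`, `nullM`, where the second fundamental form vanishes. -/
def formL (σ : ℝ) (x : ℝ × ℝ → Fin 3 → ℝ) : ℝ × ℝ →L[ℝ] ℝ :=
  planeForm (dNullL planeFrame σ x 0 (1, 0)) (dNullL planeFrame σ x 0 (0, 1))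

def formN (σ : ℝ) (x : ℝ × ℝ → Fin 3 → ℝ) : ℝ × ℝ →L[ℝ] ℝ :=
  planeForm (dNullN planeFrame σ x 0 (1, 0)) (dNullN planeFrame σ x 0 (0, 1))

def formM (σ : ℝ) (x : ℝ × ℝ → Fin 3 → ℝ) : ℝ × ℝ →L[ℝ] ℝ :=
  planeForm (dNullM planeFrame σ x 0 (1, 0)) (dNullM planeFrame σ x 0 (0, 1))

theorem eq_planeForm (A : ℝ × ℝ →L[ℝ] ℝ) : A = planeForm (A (1, 0)) (A (0, 1)) := by
  refine ContinuousLinearMap.ext fun v => ?_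
  rw [planeForm_eval, planeForm_apply]
  ring

theorem wedge_planeForm (a b c d : ℝ) : wedge (planeForm a b) (planeForm c d) = a * d - b * c := by
  simp [wedge, planeForm_eval]

theorem IsFlatFrame.fderiv_eq {σ : ℝ} {x : ℝ × ℝ → Fin 3 → ℝ} (H : IsFlatFrame planeFrame σ x 0) :
    fderiv ℝ (nullL planeFrame σ x) 0 = formL σ x ∧
      fderiv ℝ (nullN planeFrame σ x) 0 = formN σ x ∧
      fderiv ℝ (nullM planeFrame σ x) 0 = formM σ x := by
  refine ⟨(eq_planeForm _).trans ?_, (eq_planeForm _).trans ?_, (eq_planeForm _).trans ?_⟩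
  · exact congrArg₂ planeForm (dir_nullL H.smooth H.delta_pos H.snd _)
      (dir_nullL H.smooth H.delta_pos H.snd _)
  · exact congrArg₂ planeForm (dir_nullN H.smooth H.delta_pos H.snd _)
      (dir_nullN H.smooth H.delta_pos H.snd _)
  · exact congrArg₂ planeForm (dir_nullM H.smooth H.delta_pos H.snd _)
      (dir_nullM H.smooth H.delta_pos H.snd _)

/-- The condition on the 3-jet that gives the configuration `k` at a flat timelike umbilic point. -/
structure JetCondition (k : Configuration) (σ : ℝ) (x : ℝ × ℝ → Fin 3 → ℝ) : Prop where
  sign : σ ^ 2 = 1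
  delta_pos : 0 < frameDelta planeFrame x 0
  R_ne : frameR planeFrame σ x 0 ≠ 0
  ln : wedge (formL σ x) (formN σ x) ≠ 0
  mem : crossRatio (formL σ x) (formN σ x) (formM σ x) ∈ k.range

/-- The formulas for the differentials make sense on all 3-jets, without the vanishing of the second
fundamental form, so openness can be proved in the space of all parametrisations. -/
theorem isOpen_jetCondition (k : Configuration) :
    IsOpen {x : LocalParam | ∃ σ, JetCondition k σ x.toFun} := by
  have : {x : LocalParam | ∃ σ, JetCondition k σ x.toFun} =
      ⋃ σ : ℝ, {x : LocalParam | JetCondition k σ x.toFun} := by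
    ext x
    simp
  rw [this]
  refine isOpen_iUnion fun σ => ?_
  by_cases hσ : σ ^ 2 = 1
  swap
  · convert isOpen_empty
    exact Set.eq_empty_of_forall_notMem fun x hx => hσ hx.sign
  obtain ⟨hδ, hR, hL, hN, hM⟩ := continuous_dNull LocalParam.continuous_jets
    (fun x => x.smooth) planeFrame σ
  have hln : Continuous fun x : LocalParam => wedge (formL σ x.toFun) (formN σ x.toFun) := by
    simp only [formL, formN, wedge_planeForm]
    exact ((hL _).mul (hN _)).sub ((hL _).mul (hN _))
  have hmn : Continuous fun x : LocalParam => wedge (formM σ x.toFun) (formN σ x.toFun) := by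
    simp only [formM, formN, wedge_planeForm]
    exact ((hM _).mul (hN _)).sub ((hM _).mul (hN _))
  have hlm : Continuous fun x : LocalParam => wedge (formL σ x.toFun) (formM σ x.toFun) := by
    simp only [formL, formM, wedge_planeForm]
    exact ((hL _).mul (hM _)).sub ((hL _).mul (hM _))
  have hopen : IsOpen {x : LocalParam | wedge (formL σ x.toFun) (formN σ x.toFun) ≠ 0} :=
    isOpen_ne.preimage hln
  have hratio : ContinuousOn
      (fun x : LocalParam => crossRatio (formL σ x.toFun) (formN σ x.toFun) (formM σ x.toFun))
      {x : LocalParam | wedge (formL σ x.toFun) (formN σ x.toFun) ≠ 0} :=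
    (hmn.mul hlm).continuousOn.div (hln.pow 2).continuousOn fun x hx => pow_ne_zero 2 hx
  have := ((isOpen_lt (continuous_const (y := (0 : ℝ))) hδ).inter
    ((isOpen_ne (x := (0 : ℝ))).preimage hR)).inter
    (hratio.isOpen_inter_preimage hopen k.isOpen_range)
  convert this using 1
  ext x
  exact ⟨fun h => ⟨⟨h.delta_pos, h.R_ne⟩, h.ln, h.mem⟩,
    fun h => ⟨hσ, h.1.1, h.1.2, h.2.1, h.2.2⟩⟩

variable {k : Configuration} {σ : ℝ} {x : LocalParam}

theorem JetCondition.isFlatFrame (h : JetCondition k σ x.toFun)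
    (H : IsFlatTimelikeUmbilic x.toFun 0) : IsFlatFrame planeFrame σ x.toFun 0 :=
  ⟨x.smooth, h.sign, h.delta_pos, ((isFlatTimelikeUmbilic_iff x.smooth).1 H).2, h.R_ne⟩

theorem JetCondition.isNondegenerate (h : JetCondition k σ x.toFun)
    (H : IsFlatTimelikeUmbilic x.toFun 0) : IsNondegenerate x.toFun := by
  have H' := h.isFlatFrame H
  obtain ⟨eL, eN, eM⟩ := H'.fderiv_eq
  rw [H'.isNondegenerate_iff, eL, eN, eM]
  exact generalPosition_of_mem_range h.ln h.mem

theorem JetCondition.forGenericFamilies (h : JetCondition k σ x.toFun)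
    (H : IsFlatTimelikeUmbilic x.toFun 0) : ForGenericFamilies x (DeformsAs k) := by
  have H' := h.isFlatFrame H
  obtain ⟨eL, eN, eM⟩ := H'.fderiv_eq
  exact _root_.forGenericFamilies H' (by rw [eL, eN]; exact h.ln)
    (by rw [eL, eN, eM]; exact h.mem)

/-- The surface is the slice `t = 0` of any one of its generic families; one exists because a dense
set in a nonempty space is nonempty. -/
theorem JetCondition.hasConfiguration (h : JetCondition k σ x.toFun)
    (H : IsFlatTimelikeUmbilic x.toFun 0) : HasConfiguration x.toFun k := by
  obtain ⟨O, -, hd, -, hO⟩ := h.forGenericFamilies H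
  have : Nonempty (Deformation x) := ⟨graphDeformation x 0
    ⟨fun _ => 0, smoothNear_const 0, Eventually.of_forall fun _ => rfl⟩⟩
  obtain ⟨X, hX⟩ := hd.nonempty
  exact hasConfiguration_of_deformsAs (hO X hX) X.at_zero

theorem exists_jetCondition (H : IsFlatTimelikeUmbilic x.toFun 0)
    (hn : IsNondegenerate x.toFun) : ∃ k σ, JetCondition k σ x.toFun := by
  obtain ⟨hδ, h0⟩ := (isFlatTimelikeUmbilic_iff x.smooth).1 H
  obtain ⟨σ, H'⟩ := exists_isFlatFrame x.smooth hδ h0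
  obtain ⟨eL, eN, eM⟩ := H'.fderiv_eq
  have hgp := H'.isNondegenerate_iff.1 hn
  rw [eL, eN, eM] at hgp
  obtain ⟨k, hk⟩ := hgp.exists_mem_range
  exact ⟨k, σ, H'.sign, hδ, H'.R_ne, hgp.ln, hk⟩

end Minkowski

/-- Addition of a cubic form to a parametrisation. -/
def LocalParam.addCubic (x : LocalParam) (T : ℝ × ℝ →L[ℝ] ℝ × ℝ →L[ℝ] ℝ × ℝ →L[ℝ] ℝ)
    (w : Fin 3 → ℝ) : LocalParam where
  toFun p := x.toFun p + T p p p • w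
  smooth := x.smooth.add_cubic T w
  immersion := by
    have : fderiv ℝ (fun p => x.toFun p + T p p p • w) 0 = fderiv ℝ x.toFun 0 :=
      ContinuousLinearMap.ext fun a => (Minkowski.dir_add_cubic x.smooth T w a 0 0).1
    rw [this]
    exact x.immersion

/-! ### Perturbation of a flat umbilic, and the timelike plane as starting point -/

namespace Minkowski

/-- A flat timelike umbilic point can be perturbed by cubic forms in the direction of the normal;
the differentials of the three functions are then arbitrary to the extent needed. -/
theorem exists_addCubic {x : LocalParam} {σ : ℝ} (H : IsFlatFrame planeFrame σ x.toFun 0)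
    (k : Configuration) :
    ∃ (T : ℝ × ℝ →L[ℝ] ℝ × ℝ →L[ℝ] ℝ × ℝ →L[ℝ] ℝ) (w : Fin 3 → ℝ) (l n m : ℝ × ℝ →L[ℝ] ℝ),
      wedge l n ≠ 0 ∧ crossRatio l n m ∈ k.range ∧
      ∀ ε : ℝ, IsFlatFrame planeFrame σ (x.addCubic T (ε • w)).toFun 0 ∧
        formL σ (x.addCubic T (ε • w)).toFun = formL σ x.toFun + ε • l ∧
        formN σ (x.addCubic T (ε • w)).toFun = formN σ x.toFun + ε • n ∧
        formM σ (x.addCubic T (ε • w)).toFun = formM σ x.toFun + ε • m := by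
  obtain ⟨T, l, n, m, hT, hln, hk⟩ := H.exists_cubic k
  set N := cross (dir (1, 0) x.toFun 0) (dir (0, 1) x.toFun 0) with hN
  have hδ : inner N N ≠ 0 := by
    rw [hN, inner_cross_self]
    exact H.delta_pos.ne'
  refine ⟨T, (inner N N)⁻¹ • N, l, n, m, hln, hk, fun ε => ?_⟩
  obtain ⟨HY, hY⟩ := H.add_cubic T (ε • (inner N N)⁻¹ • N) (ν := ε) (by
    change ε = inner N _
    rw [inner_smul_right, inner_smul_right, inv_mul_cancel₀ hδ, mul_one]) rfl
  obtain ⟨eL, eN, eM⟩ := H.fderiv_eq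
  obtain ⟨fL, fN, fM⟩ := HY.fderiv_eq
  rw [eL, eN, eM, fL, fN, fM] at hY
  refine ⟨HY, ?_, ?_, ?_⟩
  · refine ContinuousLinearMap.ext fun c => (hY c).1.trans ?_
    rw [(hT c).1]
    rfl
  · refine ContinuousLinearMap.ext fun c => (hY c).2.1.trans ?_
    rw [(hT c).2.1]
    rfl
  · refine ContinuousLinearMap.ext fun c => (hY c).2.2.trans ?_
    rw [(hT c).2.2, mul_neg, sub_neg_eq_add]
    rfl

/-- A timelike plane. -/
def timelikePlane : ℝ × ℝ →L[ℝ] (Fin 3 → ℝ) :=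
  (ContinuousLinearMap.fst ℝ ℝ ℝ).smulRight ![1, 0, 1] +
    (ContinuousLinearMap.snd ℝ ℝ ℝ).smulRight ![1, 0, -1]

theorem timelikePlane_apply (v : ℝ × ℝ) : timelikePlane v = ![v.1 + v.2, 0, v.1 - v.2] := by
  ext i
  fin_cases i <;> simp [timelikePlane, sub_eq_add_neg]

/-- The parametrisation of a timelike plane by lightlike coordinates. -/
def timelikePlaneParam : LocalParam where
  toFun := timelikePlane
  smooth := timelikePlane.contDiff.smoothNear
  immersion := by
    rw [timelikePlane.fderiv]
    refine (injective_iff_map_eq_zero _).2 fun v hv => ?_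
    rw [timelikePlane_apply] at hv
    have h0 := congrFun hv 0
    have h2 := congrFun hv 2
    simp at h0 h2
    ext
    · simp; linarith
    · simp; linarith

theorem dir_timelikePlane (a : ℝ × ℝ) :
    dir a timelikePlane = fun _ => timelikePlane a := by
  funext p
  rw [dir, timelikePlane.fderiv]

theorem dir_dir_timelikePlane (a b : ℝ × ℝ) : dir b (dir a timelikePlane) = fun _ => 0 := by
  rw [dir_timelikePlane]
  funext p
  simp [dir]

theorem timelikePlane_isFlat :
    ∃ σ, IsFlatFrame planeFrame σ timelikePlaneParam.toFun 0 ∧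
      formL σ timelikePlaneParam.toFun = 0 ∧ formN σ timelikePlaneParam.toFun = 0 ∧
      formM σ timelikePlaneParam.toFun = 0 := by
  have hz : ∀ a : Fin 3 → ℝ, inner a 0 = 0 := fun a => by simp [inner]
  have hS : ∀ p a b, frameSnd planeFrame timelikePlane p a b = 0 := fun p a b => by
    rw [frameSnd, dir_dir_timelikePlane, hz]
  have hD : ∀ a b c, dSnd planeFrame timelikePlane 0 a b c = 0 := fun a b c => by
    rw [dSnd, show (fun q => frameSnd planeFrame timelikePlane q a b) = fun _ => 0 from
      funext fun q => hS q a b]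
    simp [dir]
  have hp : planeForm 0 0 = 0 := ContinuousLinearMap.ext fun v => by simp [planeForm_eval]
  obtain ⟨σ, H⟩ := exists_isFlatFrame (e := planeFrame) timelikePlaneParam.smooth (p := 0) (by
    change 0 < frameDelta planeFrame timelikePlane 0
    simp only [frameDelta, frameE, frameF, frameG, planeFrame, dir_timelikePlane,
      timelikePlane_apply, inner, Matrix.cons_val]
    norm_num) ⟨hS _ _ _, hS _ _ _, hS _ _ _⟩
  refine ⟨σ, H, ?_, ?_, ?_⟩
  · change formL σ timelikePlane = 0
    simp [formL, dNullL, hD, hp]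
  · change formN σ timelikePlane = 0
    simp [formN, dNullN, hD, hp]
  · change formM σ timelikePlane = 0
    simp [formM, dNullM, hD, hp]

theorem IsFlatFrame.isFlatTimelikeUmbilic {x : LocalParam} {σ : ℝ}
    (H : IsFlatFrame planeFrame σ x.toFun 0) : IsFlatTimelikeUmbilic x.toFun 0 :=
  (isFlatTimelikeUmbilic_iff x.smooth).2 ⟨H.delta_pos, H.snd⟩

end Minkowski

/-! ### The main theorem -/

open Minkowski

theorem isFlatTimelikeUmbilic_of_mk (g : flatTimelikeUmbilics) {x : LocalParam}
    (hx : Quotient.mk _ x = g.1) : IsFlatTimelikeUmbilic x.toFun 0 := by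
  obtain ⟨y, hy, H⟩ := g.2
  exact H.of_rightEquiv y.smooth x.smooth (Quotient.exact (hx.trans hy.symm))

/-- One parametrisation suffices, since nondegeneracy and configuration are invariant under right
equivalence. Conversely, nondegeneracy yields the jet condition for some configuration, and
uniqueness identifies it with `k`. -/
theorem mem_umbilicsWithConfiguration_iff (g : flatTimelikeUmbilics) {x : LocalParam}
    (hx : Quotient.mk _ x = g.1) (k : Configuration) :
    g ∈ umbilicsWithConfiguration k ↔ ∃ σ, JetCondition k σ x.toFun := by
  have H := isFlatTimelikeUmbilic_of_mk g hx
  constructor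
  · rintro ⟨h1, h2⟩
    obtain ⟨k', σ, h⟩ := exists_jetCondition H (h1 x hx)
    obtain rfl := (h.hasConfiguration H).unique (h2 x hx)
    exact ⟨σ, h⟩
  · rintro ⟨σ, h⟩
    refine ⟨fun y hy => ?_, fun y hy => ?_⟩
    · exact (h.isNondegenerate H).of_rightEquiv x.smooth H (Quotient.exact (hy.trans hx.symm))
    · exact (h.hasConfiguration H).of_rightEquiv x.smooth (Quotient.exact (hy.trans hx.symm))

theorem nondegenerateUmbilics_eq :
    nondegenerateUmbilics = ⋃ k : Configuration, umbilicsWithConfiguration k := by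
  ext g
  rw [Set.mem_iUnion]
  refine ⟨fun hg => ?_, fun ⟨k, hk⟩ => hk.1⟩
  obtain ⟨x, hx⟩ := Quotient.exists_rep g.1
  obtain ⟨k, hk⟩ := exists_jetCondition (isFlatTimelikeUmbilic_of_mk g hx) (hg x hx)
  exact ⟨k, (mem_umbilicsWithConfiguration_iff g hx k).2 hk⟩

theorem isOpen_umbilicsWithConfiguration (k : Configuration) :
    IsOpen (umbilicsWithConfiguration k) := by
  refine isOpen_induced_iff.2 ⟨_, isOpenMap_mk _ (isOpen_jetCondition k), ?_⟩
  ext g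
  constructor
  · rintro ⟨x, hx, hxg⟩
    exact (mem_umbilicsWithConfiguration_iff g hxg k).2 hx
  · intro hg
    obtain ⟨x, hx⟩ := Quotient.exists_rep g.1
    exact ⟨x, (mem_umbilicsWithConfiguration_iff g hx k).1 hg, hx⟩

/-- At a plane the three differentials vanish, so after a cubic perturbation they are exactly the
prescribed forms. -/
theorem umbilicsWithConfiguration_nonempty (k : Configuration) :
    (umbilicsWithConfiguration k).Nonempty := by
  obtain ⟨σ, H, eL, eN, eM⟩ := timelikePlane_isFlat
  obtain ⟨T, w, l, n, m, hln, hk, hY⟩ := exists_addCubic H k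
  obtain ⟨HY, fL, fN, fM⟩ := hY 1
  rw [eL, one_smul, zero_add] at fL
  rw [eN, one_smul, zero_add] at fN
  rw [eM, one_smul, zero_add] at fM
  rw [one_smul] at *
  refine ⟨⟨Quotient.mk _ (timelikePlaneParam.addCubic T w), _, rfl, HY.isFlatTimelikeUmbilic⟩,
    (mem_umbilicsWithConfiguration_iff _ rfl k).2 ⟨σ, ?_⟩⟩
  exact ⟨HY.sign, HY.delta_pos, HY.R_ne, by rwa [fL, fN], by rwa [fL, fN, fM]⟩

theorem dense_nondegenerateUmbilics : Dense nondegenerateUmbilics := by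
  intro g
  obtain ⟨x, hx⟩ := Quotient.exists_rep g.1
  obtain ⟨hδ, h0⟩ := (isFlatTimelikeUmbilic_iff x.smooth).1 (isFlatTimelikeUmbilic_of_mk g hx)
  obtain ⟨σ, H⟩ := exists_isFlatFrame x.smooth hδ h0
  -- Any configuration would serve: only the general position of the added forms matters.
  obtain ⟨T, w, l, n, m, hln, hk, hY⟩ := exists_addCubic H .isolated
  have hev := (generalPosition_of_mem_range hln hk).eventually_add_smul (formL σ x.toFun)
    (formN σ x.toFun) (formM σ x.toFun)
  have hcl : x ∈ closure {y : LocalParam | IsFlatTimelikeUmbilic y.toFun 0 ∧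
      IsNondegenerate y.toFun} := by
    refine mem_closure_of_jets (F := LocalParam.toFun) ⟨rfl⟩ (g := fun p => T p p p • w)
      (ContDiff.smoothNear (by fun_prop)) x.smooth (f := fun ε => x.addCubic T (ε • w))
      (fun ε => ?_) ?_
    · funext p
      simp only [LocalParam.addCubic, smul_comm (T p p p) ε]
    · filter_upwards [hev] with ε hε
      obtain ⟨HY, fL, fN, fM⟩ := hY ε
      refine ⟨HY.isFlatTimelikeUmbilic, HY.isNondegenerate_iff.2 ?_⟩
      obtain ⟨eL, eN, eM⟩ := HY.fderiv_eq
      rw [eL, eN, eM, fL, fN, fM]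
      exact hε
  rw [mem_closure_iff]
  intro U hU hgU
  obtain ⟨S, hS, rfl⟩ := isOpen_induced_iff.1 hU
  obtain ⟨y, hyS, hy1, hy2⟩ := mem_closure_iff.1 hcl (Quotient.mk _ ⁻¹' S)
    (hS.preimage continuous_quotient_mk') (by
      rw [Set.mem_preimage, hx]
      exact hgU)
  refine ⟨⟨Quotient.mk _ y, y, rfl, hy1⟩, hyS, fun z hz => ?_⟩
  exact hy2.of_rightEquiv y.smooth hy1 (Quotient.exact hz)

theorem mainTheorem3 :
    -- the nondegeneracy properties are generic among flat timelike umbilic points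
    (IsOpen nondegenerateUmbilics ∧ Dense nondegenerateUmbilics) ∧
    -- each of the three configurations occurs, on an open set
    (∀ k : Configuration,
      IsOpen (umbilicsWithConfiguration k) ∧ (umbilicsWithConfiguration k).Nonempty) ∧
    -- exactly one configuration occurs at a given point, and it determines the bifurcation
    (∀ g ∈ nondegenerateUmbilics, ∃ k : Configuration,
      g ∈ umbilicsWithConfiguration k ∧
      (∀ k' : Configuration, ∀ x : LocalParam, Quotient.mk _ x = g.1 →
        HasConfiguration x.toFun k' → k' = k) ∧
      ∀ x : LocalParam, Quotient.mk _ x = g.1 → ForGenericFamilies x (DeformsAs k)) := by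
  refine ⟨⟨?_, dense_nondegenerateUmbilics⟩, fun k =>
    ⟨isOpen_umbilicsWithConfiguration k, umbilicsWithConfiguration_nonempty k⟩, fun g hg => ?_⟩
  · rw [nondegenerateUmbilics_eq]
    exact isOpen_iUnion isOpen_umbilicsWithConfiguration
  · rw [nondegenerateUmbilics_eq, Set.mem_iUnion] at hg
    obtain ⟨k, hk⟩ := hg
    refine ⟨k, hk, fun k' x hx h => h.unique (hk.2 x hx), fun x hx => ?_⟩
    obtain ⟨σ, h⟩ := (mem_umbilicsWithConfiguration_iff g hx k).1 hk
    exact h.forGenericFamilies (isFlatTimelikeUmbilic_of_mk g hx)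

end
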